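/- **Conventions.** A plain multicategory $D$ has a set $D_0$ of objects, sets $D[a_1,\ldots,a_n;a]$ of arrows ($n\ge 0$), and associative and unital composition $f\circ(f_1,\ldots,f_n)$ (no symmetric group actions). $|D|$ is its underlying category: the objects of $D$ and the unary arrows of $D$. For a family of sets $X=(X(n))_{n\in\mathbb{N}}$, let $T_2X(n)$ be the set of planar trees with $n$ leaves in which each node with $m$ incoming edges is labelled by an element of $X(m)$ (the tree with no node, which is one edge, is allowed); $T_2$ is a monad, whose multiplication substitutes trees in the nodes of a tree. A *$T_2$-multicategory* $V$ consists of sets $V_0(n)$ of objects over $n$, a set $V[\theta;x]$ of arrows for each $\theta\in T_2V_0(n)$ and $x\in V_0(n)$, identities in $V[x;x]$ (where $x$ also denotes the one-node tree labelled by $x$), and a composite of an arrow $\theta\to x$ with arrows into the labels of all nodes of $\theta$, whose domain is obtained from $\theta$ by substitution; composition is associative and unital. *Maps* of $T_2$-multicategories preserve all this. Let $\mathbf{TR}(n)=T_2 1(n)$ be the set of $n$-leafed planar trees. It is a category, in which a map $\tau'\to\tau$ is a choice of a planar tree with $m$ leaves for each node of $\tau$ with $m$ incoming edges, such that substituting these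 trees in the nodes of $\tau$ yields $\tau'$. For $\theta\in T_2\mathbf{TR}(n)$ let $\bar\theta\in\mathbf{TR}(n)$ be the tree obtained by substitution. $\mathbf{TR}^{\mathrm{op}}$ is the $T_2$-multicategory with the $n$-leafed trees as objects over $n$, in which an arrow $\theta\to\tau$ is a map $\tau\to\bar\theta$ in $\mathbf{TR}(n)$. For $\tau\in\mathbf{TR}(n)$ and $\tau_i\in\mathbf{TR}(k_i)$, $\tau\circ(\tau_1,\ldots,\tau_n)$ is $\tau$ with $\tau_i$ grafted on its $i$-th leaf, and maps $\varphi,\varphi_i$ of trees likewise induce a map $\varphi\circ(\varphi_1,\ldots,\varphi_n)$; $|\in\mathbf{TR}(1)$ is the tree with no node. $[D,D]$ is the $T_2$-multicategory in which an object over $n$ is a functor $F:|D|\to|D|$ (for every $n$). An arrow $\theta\to F$ is a family of functions, one for each labelling of the edges of $\theta$ by objects of $D$, which send a family of arrows of $D$, one in $D[b_1,\ldots,b_m;F_v c]$ for each node $v$ of $\theta$ (where $F_v$ is the label of $v$, the $b_i$ are the labels of its incoming edges and $c$ is the label of its outgoing edge), to an element of $D[a_1,\ldots,a_n;Fa]$,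 where $a_1,\ldots,a_n$ are the labels of the leaves and $a$ is the label of the root; the functions are compatible with composition with arrows of $|D|$ at all edges, that is, they are arrows between the profunctors $\hat F=D[-,\ldots,-;F-]$. Composition and identities are those of functions. A *relaxed multicategory* $C$ consists of a set $C_0$ of objects; sets $C_\tau[a_1,\ldots,a_n;a]$ for $\tau\in\mathbf{TR}(n)$ and $a_1,\ldots,a_n,a\in C_0$; functions $f\mapsto f.\varphi$ from $C_\tau[a_1,\ldots,a_n;a]$ to $C_{\tau'}[a_1,\ldots,a_n;a]$ for each map $\varphi:\tau'\to\tau$; compositions sending $f\in C_\tau[a_1,\ldots,a_n;a]$ and $f_i\in C_{\tau_i}[a_i^1,\ldots,a_i^{k_i};a_i]$ to $f\circ(f_1,\ldots,f_n)\in C_{\tau\circ(\tau_1,\ldots,\tau_n)}[a_1^1,\ldots,a_n^{k_n};a]$; and identities $1_a\in C_{|}[a;a]$; such that $f.(\varphi\circ\varphi')=(f.\varphi).\varphi'$ and $f.1=f$, composition is associative with the $1_a$ as two-sided identities, and $(f\circ(f_1,\ldots,f_n)).(\varphi\circ(\varphi_1,\ldots,\varphi_n))=(f.\varphi)\circ(f_1.\varphi_1,\ldots,f_n.\varphi_n)$.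 **Theorem.** Let $D$ be a plain multicategory and let $Q:\mathbf{TR}^{\mathrm{op}}\to[D,D]$ be a map of $T_2$-multicategories. Then there is a relaxed multicategory $C$ with $C_0=D_0$ and $$C_\tau[a_1,\ldots,a_n;a]=D[a_1,\ldots,a_n;Q_\tau a]$$ for all $\tau\in\mathbf{TR}(n)$ and $a_1,\ldots,a_n,a\in D_0$, in which * for $\varphi:\tau'\to\tau$ in $\mathbf{TR}(n)$, the function $f\mapsto f.\varphi$ is the image under $Q$ of $\varphi$, regarded as an arrow of $\mathbf{TR}^{\mathrm{op}}$ from the one-node pasting of $\tau$ to $\tau'$; * the composition $(f,f_1,\ldots,f_n)\mapsto f\circ(f_1,\ldots,f_n)$ is the image under $Q$ of the canonical arrow of $\mathbf{TR}^{\mathrm{op}}$ (given by an identity map of trees) from the two-level pasting of $\tau$ and $\tau_1,\ldots,\tau_n$ to $\tau\circ(\tau_1,\ldots,\tau_n)$; * the identity $1_a\in D[a;Q_{|}a]$ is given, at $a$, by the image under $Q$ of the canonical arrow of $\mathbf{TR}^{\mathrm{op}}$ from the empty pasting to $|$. -/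

import Mathlib

open CategoryTheory

universe u v w u₁ v₁ u₂ v₂

namespace Relax

/-! ### Plain multicategories -/

/-- Concatenation of a finite sequence of finite sequences. -/
def concat {A : Type u} {n : ℕ} {k : Fin n → ℕ} (as : ∀ i, Fin (k i) → A) :
    Fin (∑ i, k i) → A :=
  fun l => as (finSigmaFinEquiv.symm l).1 (finSigmaFinEquiv.symm l).2

theorem concat_singletons {A : Type u} {n : ℕ} (c : Fin n → A) (l : Fin (∑ _i : Fin n, 1)) :
    concat (fun i (_ : Fin 1) => c i) l = c (Fin.cast (by simp) l) := by
  obtain ⟨⟨i, j⟩, rfl⟩ := finSigmaFinEquiv.surjective l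
  simp only [concat, Equiv.symm_apply_apply]
  congr 1
  apply Fin.ext
  have : j = 0 := Subsingleton.elim _ _
  subst this
  simp [finSigmaFinEquiv_apply]

theorem concat_one {A : Type u} {n : ℕ} (c : Fin n → A) (l : Fin (∑ _i : Fin 1, n)) :
    concat (fun (_ : Fin 1) => c) l = c (Fin.cast (by simp) l) := by
  obtain ⟨⟨i, j⟩, rfl⟩ := finSigmaFinEquiv.surjective l
  simp only [concat, Equiv.symm_apply_apply]
  congr 1
  apply Fin.ext
  exact (finSigmaFinEquiv_one (n := fun _ => n) ⟨i, j⟩).symm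

/-- The arrows with codomain `a` and arbitrary domain, where `Hom as a` is the set of arrows
`as 0, …, as (n - 1) ⟶ a`. Two arrows whose domains are only propositionally equal are compared
in this type. -/
abbrev ArrowsTo {A : Type u} (Hom : ∀ {n : ℕ}, (Fin n → A) → A → Type v) (a : A) :
    Type (max u v) :=
  Σ n : ℕ, Σ as : Fin n → A, Hom as a

/-- Plain (that is, non-symmetric) multicategories. -/
structure Multicategory where
  /-- objects -/
  Obj : Type u
  /-- `Hom as a` is the set of arrows `as 0, …, as (n - 1) ⟶ a` -/
  Hom : ∀ {n : ℕ}, (Fin n → Obj) → Obj → Type v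
  /-- identities -/
  id (a : Obj) : Hom (fun _ : Fin 1 => a) a
  /-- `comp f g` is the composite `f ∘ (g 0, …, g (n - 1))` -/
  comp {n : ℕ} {k : Fin n → ℕ} {as : ∀ i, Fin (k i) → Obj} {b : Fin n → Obj} {a : Obj}
    (f : Hom b a) (g : ∀ i, Hom (as i) (b i)) : Hom (concat as) a
  id_comp {n : ℕ} {as : Fin n → Obj} {a : Obj} (f : Hom as a) :
    (⟨_, _, comp (id a) (fun _ => f)⟩ : ArrowsTo Hom a) = ⟨_, _, f⟩
  comp_id {n : ℕ} {as : Fin n → Obj} {a : Obj} (f : Hom as a) :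
    (⟨_, _, comp f (fun i => id (as i))⟩ : ArrowsTo Hom a) = ⟨_, _, f⟩
  assoc {n : ℕ} {k : Fin n → ℕ} {m : ∀ i, Fin (k i) → ℕ}
    {cs : ∀ i j, Fin (m i j) → Obj} {bs : ∀ i, Fin (k i) → Obj} {as : Fin n → Obj} {a : Obj}
    (f : Hom as a) (g : ∀ i, Hom (bs i) (as i)) (h : ∀ i j, Hom (cs i j) (bs i j)) :
    (⟨_, _, comp (comp f g)
      (fun l => h (finSigmaFinEquiv.symm l).1 (finSigmaFinEquiv.symm l).2)⟩ : ArrowsTo Hom a) =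
    ⟨_, _, comp f (fun i => comp (g i) (h i))⟩

namespace Multicategory

variable (D : Multicategory.{u, v})

/-- The arrow `f`, regarded as an arrow from an equal sequence of objects. -/
def cast {D : Multicategory.{u, v}} {n m : ℕ} {as : Fin n → D.Obj} {bs : Fin m → D.Obj}
    {a : D.Obj} (hn : n = m) (h : ∀ l, as l = bs (Fin.cast hn l)) (f : D.Hom as a) :
    D.Hom bs a :=
  _root_.cast (by subst hn; obtain rfl : as = bs := funext h; rfl) f

/-- `f` as an arrow with codomain `a`. -/
abbrev arrow {D : Multicategory.{u, v}} {n : ℕ} {as : Fin n → D.Obj} {a : D.Obj}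
    (f : D.Hom as a) : ArrowsTo D.Hom a := ⟨n, as, f⟩

theorem arrow_cast {D : Multicategory.{u, v}} {n m : ℕ} {as : Fin n → D.Obj}
    {bs : Fin m → D.Obj} {a : D.Obj} (hn : n = m) (h : ∀ l, as l = bs (Fin.cast hn l))
    (f : D.Hom as a) : arrow (D.cast hn h f) = arrow f := by
  subst hn
  obtain rfl : as = bs := funext h
  rfl

theorem arrow_inj {D : Multicategory.{u, v}} {n : ℕ} {as : Fin n → D.Obj} {a : D.Obj}
    {f g : D.Hom as a} (h : arrow f = arrow g) : f = g := by
  simpa [arrow] using h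

theorem arrow_comp_congr {D : Multicategory.{u, v}} {n : ℕ} {b : Fin n → D.Obj} {a : D.Obj}
    (f : D.Hom b a) {k k' : Fin n → ℕ} {as : ∀ i, Fin (k i) → D.Obj}
    {as' : ∀ i, Fin (k' i) → D.Obj} {g : ∀ i, D.Hom (as i) (b i)}
    {g' : ∀ i, D.Hom (as' i) (b i)} (h : ∀ i, arrow (g i) = arrow (g' i)) :
    arrow (D.comp f g) = arrow (D.comp f g') := by
  have key : (fun i => arrow (g i)) = fun i => arrow (g' i) := funext h
  exact congrArg (fun (p : ∀ i, ArrowsTo D.Hom (b i)) =>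
    arrow (D.comp f (fun i => (p i).2.2))) key

theorem arrow_comp_cast {D : Multicategory.{u, v}} {n m : ℕ} {b : Fin n → D.Obj}
    {b' : Fin m → D.Obj} {a : D.Obj} (hn : n = m) (h : ∀ l, b l = b' (Fin.cast hn l))
    (f : D.Hom b a) {k : Fin m → ℕ} {as : ∀ i, Fin (k i) → D.Obj}
    (g : ∀ i, D.Hom (as i) (b' i)) (g' : ∀ i, D.Hom (as (Fin.cast hn i)) (b i))
    (hg : ∀ i, HEq (g' i) (g (Fin.cast hn i))) :
    arrow (D.comp (D.cast hn h f) g) = arrow (D.comp f g') := by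
  subst hn
  obtain rfl : b = b' := funext h
  obtain rfl : g' = g := funext fun i => eq_of_heq (hg i)
  rfl

/-- Composition of an arrow with a unary arrow out of its codomain. -/
def post {D : Multicategory.{u, v}} {n : ℕ} {as : Fin n → D.Obj} {a a' : D.Obj}
    (g : D.Hom (fun _ : Fin 1 => a) a') (f : D.Hom as a) : D.Hom as a' :=
  D.cast (by simp) (concat_one as) (D.comp g (fun _ => f))

/-- Composition of an arrow with a unary arrow into each object of its domain. -/
def pre {D : Multicategory.{u, v}} {n : ℕ} {as bs : Fin n → D.Obj} {a : D.Obj}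
    (f : D.Hom bs a) (g : ∀ i, D.Hom (fun _ : Fin 1 => as i) (bs i)) : D.Hom as a :=
  D.cast (by simp) (concat_singletons as) (D.comp f g)

theorem id_post {n : ℕ} {as : Fin n → D.Obj} {a : D.Obj} (f : D.Hom as a) :
    post (D.id a) f = f :=
  arrow_inj ((arrow_cast _ _ _).trans (D.id_comp f))

theorem post_post {n : ℕ} {as : Fin n → D.Obj} {a a' a'' : D.Obj}
    (h : D.Hom (fun _ : Fin 1 => a') a'') (g : D.Hom (fun _ : Fin 1 => a) a')
    (f : D.Hom as a) : post h (post g f) = post (post h g) f := by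
  apply arrow_inj
  refine (arrow_cast _ _ _).trans (Eq.trans ?_ (arrow_cast _ _ _).symm)
  refine Eq.trans (arrow_comp_congr h (fun i => arrow_cast _ _ _)) ?_
  refine Eq.trans ?_
    (arrow_comp_cast _ _ _ (fun _ => f) (fun _ => f) (fun _ => HEq.rfl)).symm
  exact (D.assoc h (fun _ => g) (fun _ _ => f)).symm

/-- The underlying category `|D|` of `D`: it has the objects of `D`, and its arrows are the unary
arrows of `D`. -/
abbrev Under (D : Multicategory.{u, v}) : Type u := D.Obj

instance : Category.{v} D.Under where
  Hom a b := D.Hom (fun _ : Fin 1 => a) b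
  id a := D.id a
  comp f g := post g f
  id_comp f := by
    apply arrow_inj
    exact (arrow_cast _ _ _).trans (D.comp_id f)
  comp_id f := D.id_post f
  assoc f g h := D.post_post h g f

end Multicategory

/-! ### Pasting diagrams -/

/-- Given a family of sets `X n`, whose elements are regarded as cells with `n` inputs and one
output, the formal pastings of such cells: planar trees in which a node with `n` children is
labelled by an element of `X n`. `unit` is the tree that consists of one edge and has no node. -/
inductive Pasting (X : ℕ → Type u) : Type u
  | unit : Pasting X
  | node {n : ℕ} (x : X n) (t : Fin n → Pasting X) : Pasting X

namespace Pasting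

variable {X : ℕ → Type u} {Y : ℕ → Type v} {Z : ℕ → Type w}

/-- The leaves (that is, the input edges) of a tree. -/
def Leaf : Pasting X → Type
  | unit => Unit
  | node _ t => Σ i, Leaf (t i)

/-- The number of leaves of a tree. -/
def leaves : Pasting X → ℕ
  | unit => 1
  | node _ t => ∑ i, leaves (t i)

/-- The numbering of the leaves of a tree from left to right. -/
def leafEquiv : (t : Pasting X) → Leaf t ≃ Fin (leaves t)
  | unit => (Equiv.equivPUnit (Fin 1)).symm
  | node _ t => (Equiv.sigmaCongrRight fun i => leafEquiv (t i)).trans finSigmaFinEquiv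

/-- Replacing the labels of a tree. -/
def map (f : ∀ n, X n → Y n) : Pasting X → Pasting Y
  | unit => unit
  | node x t => node (f _ x) (fun i => map f (t i))

/-- Grafting a tree on each leaf of a tree. -/
def graft : (t : Pasting X) → (Leaf t → Pasting X) → Pasting X
  | unit, c => c ()
  | node x t, c => node x (fun i => graft (t i) (fun l => c ⟨i, l⟩))

/-- An element of `A n x` for each node of the tree `t`, where `x` is the label of that node, and
`n` is the number of its children. -/
def Fill (A : ∀ n, X n → Type w) : Pasting X → Type w
  | unit => PUnit
  | node x t => A _ x × ∀ i, Fill A (t i)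

namespace Fill

variable {A : ∀ n, X n → Type w}

/-- The filling given by a function on all labels. -/
def ofLabels (f : ∀ n x, A n x) : (t : Pasting X) → Fill A t
  | unit => PUnit.unit
  | node x t => (f _ x, fun i => ofLabels f (t i))

/-- Replacing the elements of a filling and the labels of the tree. -/
def mapLabels (g : ∀ n, X n → Y n) {B : ∀ n, Y n → Type u₁} (f : ∀ n x, A n x → B n (g n x)) :
    (t : Pasting X) → Fill A t → Fill B (t.map g)
  | unit, _ => PUnit.unit
  | node _ t, s => (f _ _ s.1, fun i => mapLabels g f (t i) (s.2 i))

/-- A filling of `t` and fillings of trees `c l` form a filling of the grafted tree. -/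
def graft : (t : Pasting X) → (c : Leaf t → Pasting X) → Fill A t → (∀ l, Fill A (c l)) →
    Fill A (t.graft c)
  | unit, _, _, r => r ()
  | node _ t, c, s, r => (s.1, fun i => graft (t i) (fun l => c ⟨i, l⟩) (s.2 i) fun l => r ⟨i, l⟩)

/-- The restriction of a filling of a grafted tree to the lower tree. -/
def lower : (t : Pasting X) → (c : Leaf t → Pasting X) → Fill A (t.graft c) → Fill A t
  | unit, _, _ => PUnit.unit
  | node _ t, c, s => (s.1, fun i => lower (t i) (fun l => c ⟨i, l⟩) (s.2 i))

/-- The restriction of a filling of a grafted tree to one of the upper trees. -/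
def upper : (t : Pasting X) → (c : Leaf t → Pasting X) → Fill A (t.graft c) →
    ∀ l, Fill A (c l)
  | unit, _, s, _ => s
  | node _ t, c, s, ⟨i, l⟩ => upper (t i) (fun l => c ⟨i, l⟩) (s.2 i) l

end Fill

/-! #### Leaves of grafted trees -/

/-- A leaf of a grafted tree is a leaf of one of the upper trees. -/
def graftLeafEquiv : (t : Pasting X) → (c : Leaf t → Pasting X) →
    Leaf (t.graft c) ≃ Σ l, Leaf (c l)
  | unit, c => (Equiv.uniqueSigma (α := Unit) fun l => Leaf (c l)).symm
  | node _ t, c => (Equiv.sigmaCongrRight fun i => graftLeafEquiv (t i) fun l => c ⟨i, l⟩).trans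
      (Equiv.sigmaAssoc fun i l => Leaf (c ⟨i, l⟩)).symm

/-- The order of the leaves of a tree from left to right. -/
def Before : (t : Pasting X) → Leaf t → Leaf t → Prop
  | unit => fun _ _ => False
  | node _ t => Sigma.Lex (· < ·) fun i => Before (t i)

theorem sum_castLE_eq {m : ℕ} (n : Fin m → ℕ) (i : Fin m) :
    (∑ x : Fin i, n (Fin.castLE i.2.le x)) = ∑ x ∈ Finset.univ.filter (· < i), n x := by
  refine Finset.sum_bij (fun x _ => Fin.castLE i.2.le x) ?_ ?_ ?_ ?_
  · intro x _
    exact Finset.mem_filter.2 ⟨Finset.mem_univ _, x.2⟩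
  · intro x _ y _ h
    have h' := congrArg Fin.val h
    exact Fin.ext h'
  · intro x hx
    exact ⟨⟨x, (Finset.mem_filter.1 hx).2⟩, Finset.mem_univ _, rfl⟩
  · intros; rfl

theorem finSigma_lt {m : ℕ} {n : Fin m → ℕ} {i j : Fin m} (h : i < j) (a : Fin (n i))
    (b : Fin (n j)) : finSigmaFinEquiv ⟨i, a⟩ < finSigmaFinEquiv ⟨j, b⟩ := by
  rw [Fin.lt_def, finSigmaFinEquiv_apply, finSigmaFinEquiv_apply, sum_castLE_eq, sum_castLE_eq]
  have hsub : insert i (Finset.univ.filter (· < i)) ⊆ Finset.univ.filter (· < j) := by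
    intro x hx
    simp only [Finset.mem_insert, Finset.mem_filter, Finset.mem_univ, true_and] at hx ⊢
    rcases hx with rfl | hx
    · exact h
    · exact hx.trans h
  have := Finset.sum_le_sum_of_subset (f := n) hsub
  rw [Finset.sum_insert (by simp)] at this
  have ha := a.2
  simp only at ha ⊢
  omega

theorem before_iff : (t : Pasting X) → (l l' : Leaf t) →
    (Before t l l' ↔ leafEquiv t l < leafEquiv t l')
  | unit, _, _ => iff_of_false not_false (lt_irrefl (α := Fin 1) _)
  | node x t, ⟨i, a⟩, ⟨j, b⟩ => by
    have key : ∀ k (a b : Leaf (t k)),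
        (finSigmaFinEquiv (n := fun i => leaves (t i)) ⟨k, leafEquiv _ a⟩ <
          finSigmaFinEquiv ⟨k, leafEquiv _ b⟩ ↔ leafEquiv _ a < leafEquiv _ b) := by
      intro k a b
      rw [Fin.lt_def, finSigmaFinEquiv_apply, finSigmaFinEquiv_apply]
      simp
    constructor
    · intro h
      cases h with
      | left _ _ h => exact finSigma_lt h _ _
      | right _ _ h => exact (key _ _ _).2 ((before_iff (t i) _ _).1 h)
    · intro h
      rcases lt_trichotomy i j with hij | hij | hij
      · exact Sigma.Lex.left _ _ hij
      · subst hij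
        exact Sigma.Lex.right _ _ ((before_iff (t i) _ _).2 ((key _ _ _).1 h))
      · exact absurd (finSigma_lt (n := fun i => leaves (t i)) hij (leafEquiv _ b) (leafEquiv _ a))
          h.asymm

/-- A monotone bijection between the leaves of two trees respects the numbering. -/
theorem leafEquiv_of_mono {t : Pasting X} {t' : Pasting Y} (σ : Leaf t ≃ Leaf t')
    (h : ∀ l l', Before t l l' → Before t' (σ l) (σ l')) :
    leaves t = leaves t' ∧ ∀ l, (leafEquiv t' (σ l) : ℕ) = leafEquiv t l := by
  have e := (leafEquiv t).symm.trans (σ.trans (leafEquiv t'))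
  have hn : leaves t = leaves t' := by simpa using Fintype.card_congr e
  refine ⟨hn, fun l => ?_⟩
  let f : Fin (leaves t) → Fin (leaves t) :=
    fun i => Fin.cast hn.symm (leafEquiv t' (σ ((leafEquiv t).symm i)))
  have hf : StrictMono f := by
    intro i j hij
    exact (before_iff _ _ _).1 (h _ _ ((before_iff _ _ _).2 (by simpa using hij)))
  have hid : f = id := by
    have := Subsingleton.elim (α := Fin (leaves t) ≃o Fin (leaves t))
      (hf.orderIsoOfSurjective f (Finite.surjective_of_injective hf.injective)) (OrderIso.refl _)
    funext i
    exact congrArg (fun s => s i) this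
  have := congrArg Fin.val (congrFun hid (leafEquiv t l))
  simpa [f] using this

theorem lex_assoc {I : Type} {A : I → Type} {B : (Σ i, A i) → Type} {r : I → I → Prop}
    {r' : ∀ i, A i → A i → Prop} {r'' : ∀ p, B p → B p → Prop} (i : I)
    (p q : Σ a : A i, B ⟨i, a⟩) (h : Sigma.Lex (r' i) (fun a => r'' ⟨i, a⟩) p q) :
    Sigma.Lex (α := fun p => B p) (Sigma.Lex r r') r'' ⟨⟨i, p.1⟩, p.2⟩ ⟨⟨i, q.1⟩, q.2⟩ := by
  cases h with
  | left _ _ h => exact Sigma.Lex.left _ _ (Sigma.Lex.right _ _ h)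
  | right _ _ h => exact Sigma.Lex.right _ _ h

theorem before_graft : (t : Pasting X) → (c : Leaf t → Pasting X) → (p q : Leaf (t.graft c)) →
    Before _ p q → Sigma.Lex (Before t) (fun l => Before (c l))
      (graftLeafEquiv t c p) (graftLeafEquiv t c q)
  | unit, _, _, _, h => Sigma.Lex.right _ _ h
  | node _ t, c, _, _, h => by
    cases h with
    | left _ _ h => exact Sigma.Lex.left _ _ (Sigma.Lex.left _ _ h)
    | right _ _ h => exact lex_assoc _ _ _ (before_graft (t _) (fun l => c ⟨_, l⟩) _ _ h)

theorem leaves_map (f : ∀ n, X n → Y n) : (t : Pasting X) → leaves (t.map f) = leaves t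
  | unit => rfl
  | node _ t => Finset.sum_congr rfl fun i _ => leaves_map f (t i)

theorem leaves_eq_card (t : Pasting X) : leaves t = Nat.card (Leaf t) := by
  simp [Nat.card_congr (leafEquiv t)]

end Pasting

open Pasting

/-- `T2 X n` is the set of formal pastings of elements of the sets `X m`, with `n` inputs in
total. The functor `T2` is the free plain operad monad on families of sets indexed by `ℕ`. -/
@[ext]
structure T2 (X : ℕ → Type u) (n : ℕ) : Type u where
  /-- the tree -/
  tree : Pasting X
  /-- the number of leaves is `n` -/
  leaves_tree : tree.leaves = n

namespace T2

variable {X : ℕ → Type u} {Y : ℕ → Type v} {Z : ℕ → Type w} {n : ℕ}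

/-- The numbering of the leaves from left to right. -/
def leafEquiv (t : T2 X n) : Leaf t.1 ≃ Fin n :=
  (Pasting.leafEquiv t.1).trans (finCongr t.2)

/-- Replacing the labels of a tree. -/
def map (f : ∀ n, X n → Y n) (t : T2 X n) : T2 Y n :=
  ⟨t.1.map f, (leaves_map f t.1).trans t.2⟩

/-- The tree with no node. -/
def unit : T2 X 1 := ⟨Pasting.unit, rfl⟩

/-- The tree with one node. -/
def pure (x : X n) : T2 X n :=
  ⟨Pasting.node x fun _ => Pasting.unit, by simp [Pasting.leaves]⟩

/-- Grafting a tree on the `i`-th leaf of a tree, for each `i`. -/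
def plug (t : T2 X n) (c : Fin n → Pasting X) : Pasting X :=
  t.1.graft fun l => c (t.leafEquiv l)

/-- Grafting a tree with `k i` leaves on the `i`-th leaf of a tree, for each `i`. -/
def graft {k : Fin n → ℕ} (t : T2 X n) (c : ∀ i, T2 X (k i)) : T2 X (∑ i, k i) :=
  ⟨t.plug fun i => (c i).1, by
    have : ∀ i, k i = Nat.card (Leaf (c i).1) := fun i => by rw [← leaves_eq_card, (c i).2]
    simp_rw [leaves_eq_card, this, plug, Nat.card_congr (graftLeafEquiv _ _)]
    rw [Nat.card_congr (Equiv.sigmaCongrLeft t.leafEquiv (β := fun i => Leaf (c i).1))]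
    have : ∀ i, Finite (Leaf (c i).1) := fun i => Finite.of_equiv _ (c i).leafEquiv.symm
    rw [Nat.card_sigma]⟩

end T2

namespace Pasting

variable {X : ℕ → Type u} {Y : ℕ → Type v} {Z : ℕ → Type w} {A : ∀ n, X n → Type u₁}

/-- Substitution of trees in the nodes of a tree: if `s` is a filling of `t` and `d` turns the
elements of the filling into trees, then `subst d t s` is obtained from `t` when each node is
replaced by the corresponding tree, which has as many leaves as the node has children. -/
def subst (d : ∀ n x, A n x → T2 Z n) : (t : Pasting X) → Fill A t → Pasting Z
  | unit, _ => unit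
  | node x t, s => (d _ x s.1).plug fun i => subst d (t i) (s.2 i)

/-- The leaves do not change when trees are substituted in the nodes. -/
def substLeafEquiv (d : ∀ n x, A n x → T2 Z n) : (t : Pasting X) → (s : Fill A t) →
    Leaf (t.subst d s) ≃ Leaf t
  | unit, _ => Equiv.refl _
  | node x t, s => (graftLeafEquiv _ _).trans
      ((Equiv.sigmaCongrLeft (d _ x s.1).leafEquiv
          (β := fun i => Leaf (subst d (t i) (s.2 i)))).trans
        (Equiv.sigmaCongrRight fun i => substLeafEquiv d (t i) (s.2 i)))

theorem before_subst (d : ∀ n x, A n x → T2 Z n) : (t : Pasting X) → (s : Fill A t) →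
    (p q : Leaf (t.subst d s)) → Before _ p q →
      Before t (substLeafEquiv d t s p) (substLeafEquiv d t s q)
  | unit, _, _, _, h => h
  | node x t, s, p, q, h => by
    have h' := before_graft _ _ p q h
    have e : ∀ z, substLeafEquiv d (node x t) s z =
      ⟨(d _ x s.1).leafEquiv (graftLeafEquiv _ _ z).1,
        substLeafEquiv d _ _ (graftLeafEquiv _ _ z).2⟩ := fun _ => rfl
    rw [e, e]
    revert h'
    generalize graftLeafEquiv _ _ p = p'
    generalize graftLeafEquiv _ _ q = q'
    intro h'
    cases h' with
    | left _ _ h' => exact Sigma.Lex.left _ _ ((before_iff _ _ _).1 h')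
    | right _ _ h' => exact Sigma.Lex.right _ _ (before_subst d _ _ _ _ h')

theorem leaves_subst (d : ∀ n x, A n x → T2 Z n) (t : Pasting X) (s : Fill A t) :
    leaves (t.subst d s) = leaves t :=
  (leafEquiv_of_mono (substLeafEquiv d t s) (before_subst d t s)).1

end Pasting

namespace T2

variable {X : ℕ → Type u} {Y : ℕ → Type v} {Z : ℕ → Type w} {A : ∀ n, X n → Type u₁} {n : ℕ}

/-- Substitution of trees in the nodes of a tree. -/
def subst (d : ∀ n x, A n x → T2 Z n) (t : T2 X n) (s : Fill A t.1) : T2 Z n :=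
  ⟨t.1.subst d s, (leaves_subst d t.1 s).trans t.2⟩

/-- A tree whose nodes are labelled by trees, regarded as a tree: each node is replaced by its
label. This is the multiplication of the monad `T2`. -/
def join (t : T2 (T2 X) n) : T2 X n :=
  t.subst (A := fun _ _ => PUnit.{1}) (fun _ x _ => x) (Fill.ofLabels (fun _ _ => PUnit.unit) t.1)

theorem leafEquiv_subst (d : ∀ n x, A n x → T2 Z n) (t : T2 X n) (s : Fill A t.1)
    (l : Leaf (t.subst d s).1) :
    t.leafEquiv (substLeafEquiv d t.1 s l) = (t.subst d s).leafEquiv l :=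
  Fin.ext ((leafEquiv_of_mono (substLeafEquiv d t.1 s) (before_subst d t.1 s)).2 l)

theorem leafEquiv_pure (x : X n) (i : Fin n) : (pure x).leafEquiv ⟨i, ()⟩ = i := by
  apply Fin.ext
  have : (((Pasting.node x fun _ => Pasting.unit).leafEquiv ⟨i, ()⟩ : Fin _) : ℕ) =
    finSigmaFinEquiv (n := fun _ : Fin n => 1) ⟨i, 0⟩ := rfl
  refine this.trans ?_
  simp [finSigmaFinEquiv_apply]

end T2

/-! #### Reindexing -/

/-- A family indexed by `L`, regarded as a family indexed by `Fin n`. -/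
def reindex {L : Type} {n : ℕ} (e : L ≃ Fin n) {P : Fin n → L → Sort u}
    (z : ∀ l, P (e l) l) (i : Fin n) : P i (e.symm i) :=
  Eq.rec (motive := fun j _ => P j (e.symm i)) (z (e.symm i)) (e.apply_symm_apply i)

theorem reindex_apply {L : Type} {n : ℕ} (e : L ≃ Fin n) {P : Fin n → L → Sort u}
    {S : Fin n → Sort v} (G : ∀ i l, P i l → S i) (z : ∀ l, P (e l) l) (l : L) :
    G (e l) _ (reindex e z (e l)) = G (e l) l (z l) := by
  have : ∀ l' (h : e l' = e l), G (e l) l' (Eq.rec (motive := fun j _ => P j l') (z l') h) = G (e l) l (z l) := by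
    intro l' h
    obtain rfl := e.injective h
    rfl
  exact this _ _

theorem reindex_ind {L : Type} {n : ℕ} (e : L ≃ Fin n) {P P' : Fin n → L → Sort u}
    {M : ∀ i l, P i l → P' i l → Prop} (z : ∀ l, P (e l) l) (z' : ∀ l, P' (e l) l)
    (h : ∀ l, M (e l) l (z l) (z' l)) (i : Fin n) :
    M i (e.symm i) (reindex e z i) (reindex e z' i) := by
  have : ∀ j l (hj : e l = j), M j l
      (Eq.rec (motive := fun j _ => P j l) (z l) hj)
      (Eq.rec (motive := fun j _ => P' j l) (z' l) hj) := by
    rintro _ l rfl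
    exact h l
  exact this _ _ _

namespace Pasting

variable {X : ℕ → Type u} {Y : ℕ → Type v} {Z : ℕ → Type w} {A : ∀ n, X n → Type u₁}

/-- The restriction of a filling of a grafted tree to the lower tree. -/
def Fill.bot {n : ℕ} (P : T2 X n) (c : Fin n → Pasting X) (r : Fill A (P.plug c)) : Fill A P.1 :=
  Fill.lower P.1 _ r

/-- The restriction of a filling of a grafted tree to the `i`-th upper tree. -/
def Fill.top {n : ℕ} (P : T2 X n) (c : Fin n → Pasting X) (r : Fill A (P.plug c)) (i : Fin n) :
    Fill A (c i) :=
  reindex P.leafEquiv (P := fun i _ => Fill A (c i)) (Fill.upper P.1 _ r) i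

theorem Fill.top_apply {n : ℕ} (P : T2 X n) (c : Fin n → Pasting X) (r : Fill A (P.plug c))
    (l : Leaf P.1) : Fill.top P c r (P.leafEquiv l) = Fill.upper P.1 _ r l :=
  reindex_apply P.leafEquiv (P := fun i _ => Fill A (c i)) (S := fun i => Fill A (c i))
    (fun _ _ z => z) (Fill.upper P.1 _ r) l

/-- A filling of the tree that arises from `t` by substituting trees in its nodes restricts to a
filling of each of these trees. If `op` turns these fillings into elements of `R`, the result is a
filling of `t` itself. -/
def Fill.blocks {B : ∀ n, Z n → Type u₂} {R : ∀ n, X n → Type v₂} (d : ∀ n x, A n x → T2 Z n)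
    (op : ∀ n x (a : A n x), Fill B (d n x a).1 → R n x) :
    (t : Pasting X) → (s : Fill A t) → Fill B (t.subst d s) → Fill R t
  | unit, _, _ => PUnit.unit
  | node x t, s, r => (op _ _ s.1 (Fill.bot _ _ r), fun i =>
      blocks d op (t i) (s.2 i) (Fill.top (d _ x s.1) (fun i => subst d (t i) (s.2 i)) r i))

/-! #### Grafting and substitution -/

theorem graft_unit : (t : Pasting X) → t.graft (fun _ => unit) = t
  | unit => rfl
  | node x t => congrArg (node x) (funext fun i => graft_unit (t i))

theorem graft_graft : (t : Pasting X) → (a : Leaf t → Pasting X) →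
    (b : ∀ l, Leaf (a l) → Pasting X) →
    (t.graft a).graft (fun p => b (graftLeafEquiv t a p).1 (graftLeafEquiv t a p).2) =
      t.graft fun l => (a l).graft (b l)
  | unit, _, _ => rfl
  | node x t, a, b => congrArg (node x) (funext fun i =>
      graft_graft (t i) (fun l => a ⟨i, l⟩) fun l => b ⟨i, l⟩)

theorem plug_congr {n : ℕ} {P P' : T2 X n} (h : P = P') {c : Leaf P.1 → Pasting X}
    {c' : Fin n → Pasting X} (hc : ∀ l, c l = c' (P.leafEquiv l)) : P.1.graft c = P'.plug c' := by
  subst h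
  exact congrArg _ (funext hc)

theorem subst_graft (d : ∀ n x, A n x → T2 Z n) : (t : Pasting X) → (c : Leaf t → Pasting X) →
    (r : Fill A (t.graft c)) → (t.graft c).subst d r =
      (t.subst d (Fill.lower t c r)).graft fun p =>
        (c (substLeafEquiv d t _ p)).subst d (Fill.upper t c r (substLeafEquiv d t _ p))
  | unit, _, _ => rfl
  | node x t, c, r => by
    refine Eq.trans ?_ (graft_graft (d _ x r.1).1 _ (fun l m =>
      (c (⟨(d _ x r.1).leafEquiv l, substLeafEquiv d _ _ m⟩ : Leaf (node x t))).subst d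
        (Fill.upper (node x t) c r ⟨(d _ x r.1).leafEquiv l, substLeafEquiv d _ _ m⟩))).symm
    refine congrArg (d _ x r.1).1.graft (funext fun l => ?_)
    exact subst_graft d (t _) (fun m => c ⟨_, m⟩) (r.2 _)

theorem subst_plug (d : ∀ n x, A n x → T2 Z n) {n : ℕ} (P : T2 X n) (c : Fin n → Pasting X)
    (r : Fill A (P.plug c)) : (P.plug c).subst d r =
      (P.subst d (Fill.bot P c r)).plug fun i => (c i).subst d (Fill.top P c r i) := by
  refine (subst_graft d P.1 _ r).trans (plug_congr (P := P.subst d (Fill.bot P c r)) rfl fun p => ?_)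
  rw [← T2.leafEquiv_subst]
  exact congrArg (subst d _) (Fill.top_apply P c r _).symm

theorem subst_blocks {B : ∀ n, Z n → Type u₂} {R : ∀ n, X n → Type v₂} {W : ℕ → Type v₁}
    (d : ∀ n x, A n x → T2 Z n) (op : ∀ n x (a : A n x), Fill B (d n x a).1 → R n x)
    (d' : ∀ n x, B n x → T2 W n) (d'' : ∀ n x, R n x → T2 W n)
    (h : ∀ n x a r, d'' n x (op n x a r) = (d n x a).subst d' r) :
    (t : Pasting X) → (s : Fill A t) → (r : Fill B (t.subst d s)) →
    t.subst d'' (Fill.blocks d op t s r) = (t.subst d s).subst d' r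
  | unit, _, _ => rfl
  | node x t, s, r => by
    refine Eq.trans ?_ (subst_plug d' (d _ x s.1) _ r).symm
    refine plug_congr (h _ _ _ _) fun l => ?_
    exact subst_blocks d op d' d'' h _ _ _

/-! #### Fillings of equal trees -/

theorem Fill.node_heq {n : ℕ} {x : X n} {t t' : Fin n → Pasting X} (ht : ∀ i, t i = t' i)
    {r : Fill A (node x t)} {r' : Fill A (node x t')} (h : HEq r r') :
    r.1 = r'.1 ∧ ∀ i, HEq (r.2 i) (r'.2 i) := by
  obtain rfl : t = t' := funext ht
  cases h
  exact ⟨rfl, fun _ => HEq.rfl⟩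

theorem Fill.mk_heq {n : ℕ} {x : X n} {t t' : Fin n → Pasting X} (ht : ∀ i, t i = t' i)
    {r : Fill A (node x t)} {r' : Fill A (node x t')} (h : r.1 = r'.1)
    (h' : ∀ i, HEq (r.2 i) (r'.2 i)) : HEq r r' := by
  obtain rfl : t = t' := funext ht
  obtain ⟨r, rs⟩ := r
  obtain ⟨r', rs'⟩ := r'
  obtain rfl : r = r' := h
  obtain rfl : rs = rs' := funext fun i => eq_of_heq (h' i)
  rfl

theorem Fill.heq_graft {t : Pasting X} {c c' : Leaf t → Pasting X} (hc : ∀ l, c l = c' l)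
    {r : Fill A (t.graft c)} {r' : Fill A (t.graft c')} (h : HEq r r') :
    lower t c r = lower t c' r' ∧ ∀ l, HEq (upper t c r l) (upper t c' r' l) := by
  obtain rfl : c = c' := funext hc
  cases h
  exact ⟨rfl, fun _ => HEq.rfl⟩

theorem Fill.heq_plug {n : ℕ} {P P' : T2 X n} (hP : P = P') {c : Leaf P.1 → Pasting X}
    {c' : Fin n → Pasting X} (hc : ∀ l, c l = c' (P.leafEquiv l))
    {r : Fill A (P.1.graft c)} {r' : Fill A (P'.plug c')} (h : HEq r r') :
    HEq (lower P.1 c r) (bot P' c' r') ∧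
      ∀ l, HEq (upper P.1 c r l) (top P' c' r' (P.leafEquiv l)) := by
  subst hP
  obtain rfl : c = fun l => c' (P.leafEquiv l) := funext hc
  cases h
  refine ⟨HEq.rfl, fun l => ?_⟩
  rw [top_apply]

theorem Fill.heq_graft_graft : (t : Pasting X) → (a : Leaf t → Pasting X) →
    (b : ∀ l, Leaf (a l) → Pasting X) →
    (r : Fill A ((t.graft a).graft
      (fun p => b (graftLeafEquiv t a p).1 (graftLeafEquiv t a p).2))) →
    (r' : Fill A (t.graft fun l => (a l).graft (b l))) → HEq r r' →
    lower t _ (lower _ _ r) = lower t _ r' ∧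
    (∀ l, upper t _ (lower _ _ r) l = lower (a l) _ (upper t _ r' l)) ∧
    ∀ p, upper _ _ r p =
      upper (a (graftLeafEquiv t a p).1) (b _) (upper t _ r' (graftLeafEquiv t a p).1)
        (graftLeafEquiv t a p).2
  | unit, _, _, r, r', h => by
    cases h
    exact ⟨rfl, fun _ => rfl, fun _ => rfl⟩
  | node x t, a, b, r, r', h => by
    have h' := Fill.node_heq (fun i =>
      graft_graft (t i) (fun l => a ⟨i, l⟩) fun l => b ⟨i, l⟩) h
    have ih := fun i => heq_graft_graft (t i) (fun l => a ⟨i, l⟩) (fun l => b ⟨i, l⟩)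
      (r.2 i) (r'.2 i) (h'.2 i)
    refine ⟨?_, ?_, ?_⟩
    · exact Prod.ext h'.1 (funext fun i => (ih i).1)
    · rintro ⟨i, l⟩
      exact (ih i).2.1 l
    · rintro ⟨i, p⟩
      exact (ih i).2.2 p

theorem Fill.blocks_graft {B : ∀ n, Z n → Type u₂} {R : ∀ n, X n → Type v₂}
    (d : ∀ n x, A n x → T2 Z n) (op : ∀ n x (a : A n x), Fill B (d n x a).1 → R n x) :
    (t : Pasting X) → (c : Leaf t → Pasting X) → (r : Fill A (t.graft c)) →
    (q : Fill B ((t.graft c).subst d r)) →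
    (q' : Fill B ((t.subst d (Fill.lower t c r)).graft fun p =>
        (c (substLeafEquiv d t _ p)).subst d (Fill.upper t c r (substLeafEquiv d t _ p)))) →
    HEq q q' →
    lower t c (blocks d op _ r q) = blocks d op t (lower t c r) (lower _ _ q') ∧
    ∀ p, upper t c (blocks d op _ r q) (substLeafEquiv d t _ p) =
      blocks d op _ (upper t c r (substLeafEquiv d t _ p)) (upper _ _ q' p)
  | unit, c, r, q, q', h => by
    cases h
    exact ⟨rfl, fun _ => rfl⟩
  | node x t, c, r, q, q', h => by
    have hg := graft_graft (d _ x r.1).1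
      (fun l => (t ((d _ x r.1).leafEquiv l)).subst d
        (lower (t ((d _ x r.1).leafEquiv l)) (fun m => c ⟨_, m⟩) (r.2 _)))
      (fun l m =>
      (c (⟨(d _ x r.1).leafEquiv l, substLeafEquiv d _ _ m⟩ : Leaf (node x t))).subst d
        (Fill.upper (node x t) c r ⟨(d _ x r.1).leafEquiv l, substLeafEquiv d _ _ m⟩))
    obtain ⟨q'', hq''⟩ : ∃ q'', HEq q'' q' := ⟨cast (congrArg (Fill B) hg) q', cast_heq _ _⟩
    have h₁ := heq_graft_graft (d _ x r.1).1
      (fun l => (t ((d _ x r.1).leafEquiv l)).subst d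
        (lower (t ((d _ x r.1).leafEquiv l)) (fun m => c ⟨_, m⟩) (r.2 _)))
      (fun l m =>
      (c (⟨(d _ x r.1).leafEquiv l, substLeafEquiv d _ _ m⟩ : Leaf (node x t))).subst d
        (Fill.upper (node x t) c r ⟨(d _ x r.1).leafEquiv l, substLeafEquiv d _ _ m⟩))
      q' q'' hq''.symm
    have h₂ := heq_graft (t := (d _ x r.1).1)
      (fun l => subst_graft d (t _) (fun m => c ⟨_, m⟩) (r.2 ((d _ x r.1).leafEquiv l)))
      (r := q) (r' := q'') (h.trans hq''.symm)
    have ih := fun l => blocks_graft d op (t ((d _ x r.1).leafEquiv l)) (fun m => c ⟨_, m⟩)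
      (r.2 _) (top (d _ x r.1) (fun i => subst d ((t i).graft _) (r.2 i)) q _)
      (upper (d _ x r.1).1 _ q'' l)
      ((heq_of_eq (top_apply _ _ _ _)).trans (h₂.2 l))
    refine ⟨?_, fun p => ?_⟩
    · refine Prod.ext (congrArg (op _ x r.1) (h₂.1.trans h₁.1.symm)) (funext fun i => ?_)
      obtain ⟨l, rfl⟩ := (d _ x r.1).leafEquiv.surjective i
      refine (ih l).1.trans ?_
      refine congrArg (blocks d op _ _) (Eq.trans ?_
        (top_apply (d _ x r.1) (fun i => (t i).subst d (lower (t i) (fun m => c ⟨i, m⟩) (r.2 i)))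
          _ l).symm)
      exact (h₁.2.1 l).symm
    · refine ((ih (graftLeafEquiv _ _ p).1).2 (graftLeafEquiv _ _ p).2).trans ?_
      exact congrArg (blocks d op _ _) (h₁.2.2 p).symm

theorem Fill.blocks_plug {B : ∀ n, Z n → Type u₂} {R : ∀ n, X n → Type v₂}
    (d : ∀ n x, A n x → T2 Z n) (op : ∀ n x (a : A n x), Fill B (d n x a).1 → R n x)
    {n : ℕ} (P : T2 X n) (c : Fin n → Pasting X) (r : Fill A (P.plug c))
    (q : Fill B ((P.plug c).subst d r))
    (q' : Fill B ((P.subst d (bot P c r)).plug fun i => (c i).subst d (top P c r i)))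
    (h : HEq q q') :
    bot P c (blocks d op _ r q) = blocks d op P.1 (bot P c r) (bot _ _ q') ∧
    ∀ i, top P c (blocks d op _ r q) i = blocks d op _ (top P c r i) (top _ _ q' i) := by
  have hq := subst_graft d P.1 _ r
  obtain ⟨q₁, hq₁⟩ : ∃ q₁, HEq q₁ q := ⟨cast (congrArg (Fill B) hq) q, cast_heq _ _⟩
  have h₁ := blocks_graft d op P.1 _ r q q₁ hq₁.symm
  have h₂ := heq_plug (P := P.subst d (bot P c r)) rfl (fun p => by
      rw [← T2.leafEquiv_subst, top_apply]; rfl)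
    (r := q₁) (r' := q') (hq₁.trans h)
  refine ⟨h₁.1.trans (congrArg _ (eq_of_heq h₂.1)), fun i => ?_⟩
  obtain ⟨p, rfl⟩ := (P.subst d (bot P c r)).leafEquiv.surjective i
  have key : ∀ (j) (hj : P.leafEquiv (substLeafEquiv d P.1 _ p) = j)
      (z : Fill B ((c j).subst d (top P c r j))), HEq (upper _ _ q₁ p) z →
      top P c (blocks d op _ r q) j = blocks d op _ (top P c r j) z := by
    rintro _ rfl z hz
    rw [top_apply]
    refine (h₁.2 p).trans ?_
    revert z
    rw [top_apply]
    intro z hz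
    cases hz
    rfl
  exact key _ (T2.leafEquiv_subst d P _ p) _ (h₂.2 p)

theorem Fill.blocks_blocks {W : ℕ → Type v₁} {B : ∀ n, Z n → Type u₂} {R : ∀ n, X n → Type v₂}
    {C : ∀ n, W n → Type u₂} {S : ∀ n, X n → Type v₂} {T : ∀ n, Z n → Type v₂}
    (d : ∀ n x, A n x → T2 Z n) (op : ∀ n x (a : A n x), Fill B (d n x a).1 → R n x)
    (d' : ∀ n x, B n x → T2 W n) (d'' : ∀ n x, R n x → T2 W n)
    (h : ∀ n x a r, d'' n x (op n x a r) = (d n x a).subst d' r)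
    (op₁ : ∀ n x (b : R n x), Fill C (d'' n x b).1 → S n x)
    (op₂ : ∀ n x (b : B n x), Fill C (d' n x b).1 → T n x)
    (op₃ : ∀ n x (a : A n x), Fill T (d n x a).1 → S n x)
    (h' : ∀ n x a r (q : Fill C (d'' n x (op n x a r)).1)
      (q' : Fill C ((d n x a).subst d' r).1), HEq q q' →
      op₁ n x (op n x a r) q = op₃ n x a (blocks d' op₂ _ r q')) :
    (t : Pasting X) → (s : Fill A t) → (r : Fill B (t.subst d s)) →
    (q : Fill C (t.subst d'' (blocks d op t s r))) →
    (q' : Fill C ((t.subst d s).subst d' r)) → HEq q q' →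
    blocks d'' op₁ t (blocks d op t s r) q = blocks d op₃ t s (blocks d' op₂ _ r q')
  | unit, _, _, _, _, _ => rfl
  | node x t, s, r, q, q', hq => by
    have hp := subst_plug d' (d _ x s.1) (fun i => (t i).subst d (s.2 i)) r
    obtain ⟨q₁, hq₁⟩ : ∃ q₁, HEq q₁ q' := ⟨cast (congrArg (Fill C) hp) q', cast_heq _ _⟩
    have h₁ := blocks_plug d' op₂ (d _ x s.1) (fun i => (t i).subst d (s.2 i)) r q'
      q₁ hq₁.symm
    have h₂ := heq_plug (h _ x s.1 (bot (d _ x s.1) _ r)) (fun l => by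
        exact subst_blocks d op d' d'' h (t _) (s.2 _) (top (d _ x s.1) _ r _))
      (r := q) (r' := q₁) (hq.trans hq₁.symm)
    refine Prod.ext ?_ (funext fun i => ?_)
    · refine (h' _ x s.1 _ _ _ h₂.1).trans ?_
      exact congrArg (op₃ _ x s.1) h₁.1.symm
    · refine Eq.trans ?_ (congrArg (blocks d op₃ _ _) (h₁.2 i).symm)
      refine blocks_blocks d op d' d'' h op₁ op₂ op₃ h' (t i) (s.2 i) _ _ _ ?_
      obtain ⟨l, rfl⟩ := (d'' _ x (op _ x s.1 (bot (d _ x s.1) _ r))).leafEquiv.surjective i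
      exact (heq_of_eq (top_apply _ _ _ _)).trans (h₂.2 l)

end Pasting

namespace Pasting

variable {X : ℕ → Type u} {Y : ℕ → Type v} {Z : ℕ → Type w} {A : ∀ n, X n → Type u₁}

theorem Fill.lower_ofLabels (f : ∀ n x, A n x) : (t : Pasting X) → (c : Leaf t → Pasting X) →
    lower t c (ofLabels f _) = ofLabels f t
  | unit, _ => rfl
  | node _ t, c => Prod.ext rfl (funext fun i => lower_ofLabels f (t i) fun l => c ⟨i, l⟩)

theorem Fill.upper_ofLabels (f : ∀ n x, A n x) : (t : Pasting X) → (c : Leaf t → Pasting X) →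
    (l : Leaf t) → upper t c (ofLabels f _) l = ofLabels f (c l)
  | unit, _, _ => rfl
  | node _ t, c, ⟨i, l⟩ => upper_ofLabels f (t i) (fun l => c ⟨i, l⟩) l

theorem Fill.top_ofLabels (f : ∀ n x, A n x) {n : ℕ} (P : T2 X n) (c : Fin n → Pasting X)
    (i : Fin n) : top P c (ofLabels f _) i = ofLabels f (c i) := by
  obtain ⟨l, rfl⟩ := P.leafEquiv.surjective i
  rw [top_apply]
  exact upper_ofLabels f _ _ l

theorem subst_pure (d : ∀ n x, A n x → T2 X n) (f : ∀ n x, A n x)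
    (h : ∀ n x, d n x (f n x) = T2.pure x) : (t : Pasting X) →
    t.subst d (Fill.ofLabels f t) = t
  | unit => rfl
  | node x t => by
    have : (T2.pure x).plug (fun i => (t i).subst d (Fill.ofLabels f (t i))) = node x t := by
      refine congrArg (node x) (funext fun i => ?_)
      exact Eq.trans (congrArg (fun i => (t i).subst d (Fill.ofLabels f (t i)))
        (T2.leafEquiv_pure x i)) (subst_pure d f h (t i))
    refine Eq.trans ?_ this
    change (d _ x (f _ x)).plug _ = _
    rw [h]
    rfl

theorem Fill.heq_pure_plug {n : ℕ} (x : X n) {c t : Fin n → Pasting X} (hc : ∀ i, c i = t i)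
    {r : Fill A ((T2.pure x).plug c)} {r' : Fill A (node x t)} (h : HEq r r') :
    (bot (T2.pure x) c r).1 = r'.1 ∧ ∀ i, HEq (top (T2.pure x) c r i) (r'.2 i) := by
  have h₀ := node_heq (t := fun i => c ((T2.pure x).leafEquiv ⟨i, ()⟩))
    (fun i => by rw [T2.leafEquiv_pure, hc]) h
  refine ⟨h₀.1, fun i => ?_⟩
  have h₁ := top_apply (T2.pure x) c r ⟨i, ()⟩
  have h₂ : HEq (top (T2.pure x) c r i) (top (T2.pure x) c r ((T2.pure x).leafEquiv ⟨i, ()⟩)) := by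
    rw [T2.leafEquiv_pure]
  exact h₂.trans ((heq_of_eq h₁).trans (h₀.2 i))

theorem Fill.blocks_ofLabels_right {B : ∀ n, Z n → Type u₂} (d : ∀ n x, A n x → T2 Z n)
    (op : ∀ n x (a : A n x), Fill B (d n x a).1 → A n x) (f : ∀ n x, B n x)
    (h : ∀ n x a, op n x a (ofLabels f _) = a) : (t : Pasting X) → (s : Fill A t) →
    blocks d op t s (ofLabels f _) = s
  | unit, _ => rfl
  | node x t, s => by
    refine Prod.ext ?_ (funext fun i => ?_)
    · exact (congrArg (op _ x s.1) (lower_ofLabels f _ _)).trans (h _ _ _)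
    · exact (congrArg (blocks d op _ _) (top_ofLabels f _ _ i)).trans
        (blocks_ofLabels_right d op f h (t i) (s.2 i))

theorem Fill.blocks_ofLabels_left {B : ∀ n, X n → Type u₂} (d : ∀ n x, A n x → T2 X n)
    (op : ∀ n x (a : A n x), Fill B (d n x a).1 → B n x) (f : ∀ n x, A n x)
    (h : ∀ n x, d n x (f n x) = T2.pure x)
    (h' : ∀ n x (r : Fill B (d n x (f n x)).1) (r' : Fill B (T2.pure x).1), HEq r r' →
      op n x (f n x) r = r'.1) : (t : Pasting X) →
    (r : Fill B (t.subst d (ofLabels f t))) → (r' : Fill B t) → HEq r r' →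
    blocks d op t (ofLabels f t) r = r'
  | unit, _, _, _ => rfl
  | node x t, r, r', hr => by
    have hp : ((d _ x (f _ x)).plug fun i => (t i).subst d (ofLabels f (t i))) =
      (T2.pure x).plug fun i => (t i).subst d (ofLabels f (t i)) := by rw [h]
    obtain ⟨q, hq⟩ : ∃ q : Fill B ((T2.pure x).plug fun i => (t i).subst d (ofLabels f (t i))),
      HEq q r := ⟨cast (congrArg (Fill B) hp) r, cast_heq _ _⟩
    have h₁ := heq_plug (h _ x) (fun _ => rfl) (r := r) (r' := q) hq.symm
    have h₂ := heq_pure_plug x (fun i => subst_pure d f h (t i)) (r := q) (r' := r') (hq.trans hr)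
    refine Prod.ext ((h' _ x _ _ h₁.1).trans h₂.1) (funext fun i => ?_)
    refine blocks_ofLabels_left d op f h h' (t i) _ _ (HEq.trans ?_ (h₂.2 i))
    obtain ⟨l, rfl⟩ := (d _ x (f _ x)).leafEquiv.surjective i
    exact (heq_of_eq (top_apply _ _ _ _)).trans (h₁.2 l)

/-! #### Assembling fillings -/

theorem Fill.lower_graft : (t : Pasting X) → (c : Leaf t → Pasting X) → (s : Fill A t) →
    (r : ∀ l, Fill A (c l)) → lower t c (Fill.graft t c s r) = s
  | unit, _, _, _ => rfl
  | node _ t, _, s, _ => Prod.ext rfl (funext fun i => lower_graft (t i) _ (s.2 i) _)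

theorem Fill.upper_graft : (t : Pasting X) → (c : Leaf t → Pasting X) → (s : Fill A t) →
    (r : ∀ l, Fill A (c l)) → (l : Leaf t) → upper t c (Fill.graft t c s r) l = r l
  | unit, _, _, _, _ => rfl
  | node _ t, c, s, _, ⟨i, l⟩ => upper_graft (t i) (fun l => c ⟨i, l⟩) (s.2 i) _ l

theorem Fill.ext_graft : (t : Pasting X) → (c : Leaf t → Pasting X) →
    (r r' : Fill A (t.graft c)) → lower t c r = lower t c r' →
    (∀ l, upper t c r l = upper t c r' l) → r = r'
  | unit, _, _, _, _, h => h ()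
  | node _ t, _, _, _, h, h' => Prod.ext (Prod.ext_iff.1 h).1 (funext fun i =>
      ext_graft (t i) _ _ _ (congrFun (Prod.ext_iff.1 h).2 i) fun l => h' ⟨i, l⟩)

/-- A filling of `P` and fillings of trees `c i` form a filling of the grafted tree. -/
def Fill.plug {n : ℕ} (P : T2 X n) (c : Fin n → Pasting X) (b : Fill A P.1)
    (f : ∀ i, Fill A (c i)) : Fill A (P.plug c) :=
  Fill.graft P.1 _ b fun l => f (P.leafEquiv l)

/-- The filling of the tree that arises from `t` by substituting trees in its nodes, given by
fillings of each of these trees. -/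
def Fill.assemble {B : ∀ n, Z n → Type u₂} (d : ∀ n x, A n x → T2 Z n)
    (β : ∀ n x a, Fill B (d n x a).1) : (t : Pasting X) → (s : Fill A t) → Fill B (t.subst d s)
  | unit, _ => PUnit.unit
  | node x t, s => Fill.plug (d _ x s.1) (fun i => subst d (t i) (s.2 i)) (β _ x s.1) fun i =>
      assemble d β (t i) (s.2 i)

theorem Fill.assemble_graft {B : ∀ n, Z n → Type u₂} (d : ∀ n x, A n x → T2 Z n)
    (β : ∀ n x a, Fill B (d n x a).1) :
    (t : Pasting X) → (c : Leaf t → Pasting X) → (r : Fill A (t.graft c)) →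
    (q : Fill B ((t.subst d (Fill.lower t c r)).graft fun p =>
        (c (substLeafEquiv d t _ p)).subst d (Fill.upper t c r (substLeafEquiv d t _ p)))) →
    HEq (assemble d β (t.graft c) r) q →
    lower _ _ q = assemble d β t (lower t c r) ∧
    ∀ p, upper _ _ q p =
      assemble d β (c (substLeafEquiv d t _ p)) (upper t c r (substLeafEquiv d t _ p))
  | unit, c, r, q, h => by
    cases h
    exact ⟨rfl, fun _ => rfl⟩
  | node x t, c, r, q', h => by
    have hg := graft_graft (d _ x r.1).1
      (fun l => (t ((d _ x r.1).leafEquiv l)).subst d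
        (lower (t ((d _ x r.1).leafEquiv l)) (fun m => c ⟨_, m⟩) (r.2 _)))
      (fun l m =>
      (c (⟨(d _ x r.1).leafEquiv l, substLeafEquiv d _ _ m⟩ : Leaf (node x t))).subst d
        (Fill.upper (node x t) c r ⟨(d _ x r.1).leafEquiv l, substLeafEquiv d _ _ m⟩))
    obtain ⟨q'', hq''⟩ : ∃ q'', HEq q'' q' := ⟨cast (congrArg (Fill B) hg) q', cast_heq _ _⟩
    have h₁ := heq_graft_graft (d _ x r.1).1
      (fun l => (t ((d _ x r.1).leafEquiv l)).subst d
        (lower (t ((d _ x r.1).leafEquiv l)) (fun m => c ⟨_, m⟩) (r.2 _)))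
      (fun l m =>
      (c (⟨(d _ x r.1).leafEquiv l, substLeafEquiv d _ _ m⟩ : Leaf (node x t))).subst d
        (Fill.upper (node x t) c r ⟨(d _ x r.1).leafEquiv l, substLeafEquiv d _ _ m⟩))
      q' q'' hq''.symm
    have h₂ := heq_graft (t := (d _ x r.1).1)
      (fun l => subst_graft d (t _) (fun m => c ⟨_, m⟩) (r.2 ((d _ x r.1).leafEquiv l)))
      (r := assemble d β ((node x t).graft c) r) (r' := q'') (h.trans hq''.symm)
    have ih := fun l => assemble_graft d β (t ((d _ x r.1).leafEquiv l)) (fun m => c ⟨_, m⟩)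
      (r.2 _) (upper (d _ x r.1).1 _ q'' l)
      ((heq_of_eq (upper_graft _ _ _ _ _).symm).trans (h₂.2 l))
    refine ⟨?_, fun p => ?_⟩
    · refine ext_graft _ _ _ _ ?_ fun l => ?_
      · exact h₁.1.trans (h₂.1.symm.trans ((lower_graft _ _ _ _).trans
          (lower_graft _ _ _ _).symm))
      · refine (h₁.2.1 l).trans ((ih l).1.trans (Eq.symm ?_))
        exact upper_graft (d _ x r.1).1 _ _ (fun l => assemble d β (t _)
          (lower (t ((d _ x r.1).leafEquiv l)) (fun m => c ⟨_, m⟩) (r.2 _))) l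
    · exact (h₁.2.2 p).trans ((ih (graftLeafEquiv _ _ p).1).2 (graftLeafEquiv _ _ p).2)

theorem Fill.graft_plug_heq {n : ℕ} {P P' : T2 X n} (hP : P = P') {c c' : Fin n → Pasting X}
    (hc : ∀ i, c i = c' i) {b : Fill A P.1} {b' : Fill A P'.1} (hb : HEq b b')
    {f : ∀ i, Fill A (c i)} {f' : ∀ i, Fill A (c' i)} (hf : ∀ i, HEq (f i) (f' i)) :
    HEq (Fill.plug P c b f) (Fill.plug P' c' b' f') := by
  subst hP
  obtain rfl : c = c' := funext hc
  cases hb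
  obtain rfl : f = f' := funext fun i => eq_of_heq (hf i)
  rfl

/-- Two fillings are related if their elements are related at each node. -/
def Fill.Rel {A' : ∀ n, X n → Type u₂} (ρ : ∀ n x, A n x → A' n x → Prop) :
    (t : Pasting X) → Fill A t → Fill A' t → Prop
  | unit, _, _ => True
  | node x t, s, s' => ρ _ x s.1 s'.1 ∧ ∀ i, Rel ρ (t i) (s.2 i) (s'.2 i)

theorem subst_congr {A' : ∀ n, X n → Type u₂} (d : ∀ n x, A n x → T2 Z n)
    (d' : ∀ n x, A' n x → T2 Z n) : (t : Pasting X) → (s : Fill A t) → (s' : Fill A' t) →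
    Fill.Rel (fun n x a a' => d n x a = d' n x a') t s s' → t.subst d s = t.subst d' s'
  | unit, _, _, _ => rfl
  | node x t, s, s', h => by
    have : ∀ i, (t i).subst d (s.2 i) = (t i).subst d' (s'.2 i) :=
      fun i => subst_congr d d' (t i) _ _ (h.2 i)
    change (d _ x s.1).plug _ = (d' _ x s'.1).plug _
    rw [h.1, funext this]

theorem Fill.Rel.mono {A' : ∀ n, X n → Type u₂} {ρ ρ' : ∀ n x, A n x → A' n x → Prop}
    (h : ∀ n x a a', ρ n x a a' → ρ' n x a a') : (t : Pasting X) → (s : Fill A t) →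
    (s' : Fill A' t) → Fill.Rel ρ t s s' → Fill.Rel ρ' t s s'
  | unit, _, _, _ => trivial
  | node _ t, s, s', hs => ⟨h _ _ _ _ hs.1, fun i => mono h (t i) (s.2 i) (s'.2 i) (hs.2 i)⟩

theorem Fill.rel_of {A' : ∀ n, X n → Type u₂} (ρ : ∀ n x, A n x → A' n x → Prop)
    (h : ∀ n x a a', ρ n x a a') : (t : Pasting X) → (s : Fill A t) →
    (s' : Fill A' t) → Fill.Rel ρ t s s'
  | unit, _, _ => trivial
  | node _ t, s, s' => ⟨h _ _ _ _, fun i => rel_of ρ h (t i) (s.2 i) (s'.2 i)⟩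

theorem Fill.rel_blocks {B : ∀ n, Z n → Type u₂} {R : ∀ n, X n → Type v₂}
    (d : ∀ n x, A n x → T2 Z n) (op : ∀ n x (a : A n x), Fill B (d n x a).1 → R n x)
    (ρ : ∀ n x, A n x → R n x → Prop) (h : ∀ n x a r, ρ n x a (op n x a r)) :
    (t : Pasting X) → (s : Fill A t) → (r : Fill B (t.subst d s)) →
    Fill.Rel ρ t s (Fill.blocks d op t s r)
  | unit, _, _ => trivial
  | node _ t, s, _ => ⟨h _ _ _ _, fun i => rel_blocks d op ρ h (t i) (s.2 i) _⟩

theorem Fill.rel_blocks_blocks {B : ∀ n, Z n → Type u₂} {R : ∀ n, X n → Type v₂}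
    {R' : ∀ n, X n → Type v₁}
    (d : ∀ n x, A n x → T2 Z n) (op : ∀ n x (a : A n x), Fill B (d n x a).1 → R n x)
    (op' : ∀ n x (a : A n x), Fill B (d n x a).1 → R' n x)
    (ρ : ∀ n x, R n x → R' n x → Prop) (h : ∀ n x a r, ρ n x (op n x a r) (op' n x a r)) :
    (t : Pasting X) → (s : Fill A t) → (r : Fill B (t.subst d s)) →
    Fill.Rel ρ t (Fill.blocks d op t s r) (Fill.blocks d op' t s r)
  | unit, _, _ => trivial
  | node _ t, s, _ => ⟨h _ _ _ _, fun i => rel_blocks_blocks d op op' ρ h (t i) (s.2 i) _⟩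

theorem Fill.assemble_congr {A' : ∀ n, X n → Type u₂} {B : ∀ n, Z n → Type v₂}
    (d : ∀ n x, A n x → T2 Z n)
    (d' : ∀ n x, A' n x → T2 Z n) (β : ∀ n x a, Fill B (d n x a).1)
    (β' : ∀ n x a, Fill B (d' n x a).1) : (t : Pasting X) → (s : Fill A t) → (s' : Fill A' t) →
    Fill.Rel (fun n x a a' => d n x a = d' n x a' ∧ HEq (β n x a) (β' n x a')) t s s' →
    HEq (assemble d β t s) (assemble d' β' t s')
  | unit, _, _, _ => HEq.rfl
  | node x t, s, s', h => by
    have h₁ : ∀ i, (t i).subst d (s.2 i) = (t i).subst d' (s'.2 i) :=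
      fun i => subst_congr d d' (t i) _ _ (Rel.mono (fun _ _ _ _ h => h.1) _ _ _ (h.2 i))
    have h₂ : ∀ i, HEq (assemble d β (t i) (s.2 i)) (assemble d' β' (t i) (s'.2 i)) :=
      fun i => assemble_congr d d' β β' (t i) _ _ (h.2 i)
    have h₃ := h.1
    revert h₃
    change _ ∧ HEq (β _ x s.1) (β' _ x s'.1) → HEq
      (Fill.plug (d _ x s.1) _ (β _ x s.1) fun i => assemble d β (t i) (s.2 i))
      (Fill.plug (d' _ x s'.1) _ (β' _ x s'.1) fun i => assemble d' β' (t i) (s'.2 i))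
    generalize β _ x s.1 = b
    generalize β' _ x s'.1 = b'
    revert b b'
    generalize d _ x s.1 = P
    generalize d' _ x s'.1 = P'
    rintro b b' ⟨rfl, h⟩
    cases h
    exact graft_plug_heq rfl h₁ HEq.rfl h₂

theorem Fill.bot_graft {n : ℕ} (P : T2 X n) (c : Fin n → Pasting X) (b : Fill A P.1)
    (f : ∀ i, Fill A (c i)) :
    bot P c (Fill.plug P c b f) = b :=
  lower_graft _ _ _ _

theorem Fill.top_graft {n : ℕ} (P : T2 X n) (c : Fin n → Pasting X) (b : Fill A P.1)
    (f : ∀ i, Fill A (c i)) (i : Fin n) :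
    top P c (Fill.plug P c b f) i = f i := by
  obtain ⟨l, rfl⟩ := P.leafEquiv.surjective i
  exact (top_apply P c _ l).trans (upper_graft _ _ _ _ l)

theorem Fill.ext_plug {n : ℕ} (P : T2 X n) (c : Fin n → Pasting X) {r r' : Fill A (P.plug c)}
    (h : bot P c r = bot P c r') (h' : ∀ i, top P c r i = top P c r' i) : r = r' :=
  ext_graft P.1 _ _ _ h fun l => by
    have := h' (P.leafEquiv l)
    rwa [top_apply, top_apply] at this

theorem Fill.assemble_plug {B : ∀ n, Z n → Type u₂} (d : ∀ n x, A n x → T2 Z n)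
    (β : ∀ n x a, Fill B (d n x a).1) {n : ℕ} (P : T2 X n) (c : Fin n → Pasting X)
    (r : Fill A (P.plug c))
    (q : Fill B ((P.subst d (bot P c r)).plug fun i => (c i).subst d (top P c r i)))
    (h : HEq (assemble d β (P.plug c) r) q) :
    bot _ _ q = assemble d β P.1 (bot P c r) ∧
    ∀ i, top _ _ q i = assemble d β (c i) (top P c r i) := by
  have hq := subst_graft d P.1 _ r
  obtain ⟨q₁, hq₁⟩ : ∃ q₁, HEq q₁ (assemble d β (P.plug c) r) :=
    ⟨cast (congrArg (Fill B) hq) (assemble d β (P.plug c) r), cast_heq _ _⟩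
  have h₁ := assemble_graft d β P.1 _ r q₁ hq₁.symm
  have h₂ := heq_plug (P := P.subst d (bot P c r)) rfl (fun p => by
      rw [← T2.leafEquiv_subst, top_apply]; rfl)
    (r := q₁) (r' := q) (hq₁.trans h)
  refine ⟨(eq_of_heq h₂.1).symm.trans h₁.1, fun i => ?_⟩
  obtain ⟨p, rfl⟩ := (P.subst d (bot P c r)).leafEquiv.surjective i
  have key : ∀ (j) (hj : P.leafEquiv (substLeafEquiv d P.1 _ p) = j)
      (z : Fill B ((c j).subst d (top P c r j))), HEq (upper _ _ q₁ p) z →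
      z = assemble d β (c j) (top P c r j) := by
    rintro _ rfl
    rw [top_apply]
    intro z hz
    exact (eq_of_heq hz).symm.trans (h₁.2 p)
  exact key _ (T2.leafEquiv_subst d P _ p) _ (h₂.2 p)

theorem Fill.assemble_blocks {W : ℕ → Type v₁} {B : ∀ n, Z n → Type u₂}
    {R : ∀ n, X n → Type v₂} {C : ∀ n, W n → Type v₁}
    (d : ∀ n x, A n x → T2 Z n) (op : ∀ n x (a : A n x), Fill B (d n x a).1 → R n x)
    (d' : ∀ n x, B n x → T2 W n) (d'' : ∀ n x, R n x → T2 W n)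
    (γ : ∀ n x b, Fill C (d' n x b).1) (γ' : ∀ n x r, Fill C (d'' n x r).1)
    (h : ∀ n x a r, d'' n x (op n x a r) = (d n x a).subst d' r)
    (h' : ∀ n x a r, HEq (γ' n x (op n x a r)) (assemble d' γ (d n x a).1 r)) :
    (t : Pasting X) → (s : Fill A t) → (r : Fill B (t.subst d s)) →
    HEq (assemble d'' γ' t (blocks d op t s r)) (assemble d' γ (t.subst d s) r)
  | unit, _, _ => HEq.rfl
  | node x t, s, r => by
    have hp := subst_plug d' (d _ x s.1) (fun i => (t i).subst d (s.2 i)) r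
    obtain ⟨q, hq⟩ : ∃ q, HEq q (assemble d' γ ((node x t).subst d s) r) :=
      ⟨cast (congrArg (Fill C) hp) (assemble d' γ ((node x t).subst d s) r), cast_heq _ _⟩
    have h₁ := assemble_plug d' γ (d _ x s.1) (fun i => (t i).subst d (s.2 i)) r q hq.symm
    refine HEq.trans ?_ hq
    have : q = Fill.plug ((d _ x s.1).subst d' (bot _ _ r)) _ (assemble d' γ _ (bot _ _ r))
        fun i => assemble d' γ _ (top (d _ x s.1) (fun i => (t i).subst d (s.2 i)) r i) :=
      ext_plug _ _ (h₁.1.trans (bot_graft ((d _ x s.1).subst d' (bot _ _ r)) _ _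
          (fun i => assemble d' γ _
            (top (d _ x s.1) (fun i => (t i).subst d (s.2 i)) r i))).symm)
        fun i => (h₁.2 i).trans (top_graft ((d _ x s.1).subst d' (bot _ _ r)) _ _
          (fun i => assemble d' γ _
            (top (d _ x s.1) (fun i => (t i).subst d (s.2 i)) r i)) i).symm
    rw [this]
    exact graft_plug_heq (h _ x s.1 _)
      (fun i => subst_blocks d op d' d'' h (t i) (s.2 i) _) (h' _ x s.1 _)
      (fun i => assemble_blocks d op d' d'' γ γ' h h' (t i) (s.2 i) _)

theorem subst_assemble {W : ℕ → Type v₁} {B : ∀ n, Z n → Type u₂}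
    (d : ∀ n x, A n x → T2 Z n) (γ : ∀ n x a, Fill B (d n x a).1)
    (d' : ∀ n x, B n x → T2 W n) (d₂ : ∀ n x, A n x → T2 W n)
    (h : ∀ n x a, (d n x a).subst d' (γ n x a) = d₂ n x a) :
    (t : Pasting X) → (s : Fill A t) →
    (t.subst d s).subst d' (Fill.assemble d γ t s) = t.subst d₂ s
  | unit, _ => rfl
  | node x t, s => by
    refine (subst_plug d' (d _ x s.1) (fun i => (t i).subst d (s.2 i)) _).trans ?_
    have h₁ := Fill.bot_graft (d _ x s.1) (fun i => (t i).subst d (s.2 i)) (γ _ x s.1)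
      (fun i => Fill.assemble d γ (t i) (s.2 i))
    have h₂ := Fill.top_graft (d _ x s.1) (fun i => (t i).subst d (s.2 i)) (γ _ x s.1)
      (fun i => Fill.assemble d γ (t i) (s.2 i))
    refine plug_congr ?_ fun l => ?_
    · exact (congrArg _ h₁).trans (h _ _ _)
    · exact (congrArg (subst d' _) (h₂ _)).trans (subst_assemble d γ d' d₂ h _ _)

theorem Fill.blocks_assemble {W : ℕ → Type v₁} {B : ∀ n, Z n → Type u₂}
    {C : ∀ n, W n → Type u₂} {T : ∀ n, Z n → Type v₂}
    (d : ∀ n x, A n x → T2 Z n) (γ : ∀ n x a, Fill B (d n x a).1)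
    (d' : ∀ n x, B n x → T2 W n) (op : ∀ n x (b : B n x), Fill C (d' n x b).1 → T n x)
    (d₂ : ∀ n x, A n x → T2 W n) (β : ∀ n x a, Fill C (d₂ n x a).1)
    (δ : ∀ n x a, Fill T (d n x a).1)
    (h : ∀ n x a, (d n x a).subst d' (γ n x a) = d₂ n x a)
    (h' : ∀ n x a q, HEq q (β n x a) → blocks d' op (d n x a).1 (γ n x a) q = δ n x a) :
    (t : Pasting X) → (s : Fill A t) →
    (q : Fill C ((t.subst d s).subst d' (Fill.assemble d γ t s))) →
    HEq q (assemble d₂ β t s) →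
    blocks d' op _ (assemble d γ t s) q = assemble d δ t s
  | unit, _, _, _ => rfl
  | node x t, s, q, hq => by
    have hp := subst_plug d' (d _ x s.1) (fun i => (t i).subst d (s.2 i)) (assemble d γ (node x t) s)
    have hb := Fill.bot_graft (d _ x s.1) (fun i => (t i).subst d (s.2 i)) (γ _ x s.1)
      (fun i => Fill.assemble d γ (t i) (s.2 i))
    have ht := Fill.top_graft (d _ x s.1) (fun i => (t i).subst d (s.2 i)) (γ _ x s.1)
      (fun i => Fill.assemble d γ (t i) (s.2 i))
    obtain ⟨q', hq'⟩ : ∃ q', HEq q' q := ⟨cast (congrArg (Fill C) hp) q, cast_heq _ _⟩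
    have h₁ := blocks_plug d' op (d _ x s.1) (fun i => (t i).subst d (s.2 i))
      (assemble d γ (node x t) s) q q' hq'.symm
    have h₂ : ((d _ x s.1).subst d' (bot (d _ x s.1) _ (assemble d γ (node x t) s))) =
      d₂ _ x s.1 := (congrArg _ hb).trans (h _ _ _)
    have h₃ : ∀ i, ((t i).subst d (s.2 i)).subst d' (top (d _ x s.1) _
        (assemble d γ (node x t) s) i) = (t i).subst d₂ (s.2 i) := fun i =>
      (congrArg (subst d' _) (ht _)).trans (subst_assemble d γ d' d₂ h _ _)
    have h₄ := heq_plug h₂.symm (fun l => (h₃ _).symm) (r := assemble d₂ β (node x t) s)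
      (r' := q') (hq.symm.trans hq'.symm)
    refine ext_plug (d _ x s.1) (fun i => (t i).subst d (s.2 i)) ?_ fun i => ?_
    · refine h₁.1.trans (Eq.trans ?_ (bot_graft _ (fun i => (t i).subst d (s.2 i)) _
        fun i => assemble d δ (t i) (s.2 i)).symm)
      have : HEq (bot _ _ q') (β _ x s.1) :=
        h₄.1.symm.trans (heq_of_eq (lower_graft _ _ _ _))
      revert this
      generalize bot _ _ q' = z
      revert z
      rw [show bot (d _ x s.1) _ (assemble d γ (node x t) s) = γ _ x s.1 from hb]
      exact fun z hz => h' _ _ _ z hz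
    · refine (h₁.2 i).trans (Eq.trans ?_ (top_graft _ (fun i => (t i).subst d (s.2 i)) _
        (fun i => assemble d δ (t i) (s.2 i)) i).symm)
      have : HEq (top _ _ q' i) (assemble d₂ β (t i) (s.2 i)) := by
        obtain ⟨l, rfl⟩ := (d₂ _ x s.1).leafEquiv.surjective i
        exact (h₄.2 l).symm.trans (heq_of_eq (upper_graft _ _ _ _ _))
      revert this
      generalize top _ _ q' i = z
      revert z
      rw [show top (d _ x s.1) _ (assemble d γ (node x t) s) i = _ from ht i]
      exact fun z hz => blocks_assemble d γ d' op d₂ β δ h h' _ _ z hz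

theorem Fill.graft_ofLabels (f : ∀ n x, A n x) : (t : Pasting X) → (c : Leaf t → Pasting X) →
    Fill.graft t c (ofLabels f t) (fun l => ofLabels f (c l)) = ofLabels f _
  | unit, _ => rfl
  | node _ t, c => Prod.ext rfl (funext fun i => graft_ofLabels f (t i) fun l => c ⟨i, l⟩)

theorem Fill.assemble_ofLabels {B : ∀ n, Z n → Type u₂} (d : ∀ n x, A n x → T2 Z n)
    (β : ∀ n x a, Fill B (d n x a).1) (f : ∀ n x, A n x) (g : ∀ n x, B n x)
    (h : ∀ n x, β n x (f n x) = ofLabels g _) : (t : Pasting X) →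
    assemble d β t (ofLabels f t) = ofLabels g _
  | unit => rfl
  | node x t => by
    refine Eq.trans ?_ (graft_ofLabels g (d _ x (f _ x)).1 _)
    have : ∀ i, assemble d β (t i) (ofLabels f (t i)) = ofLabels g _ :=
      fun i => assemble_ofLabels d β f g h (t i)
    change Fill.plug (d _ x (f _ x)) _ (β _ x (f _ x)) (fun i => assemble d β _ (ofLabels f _)) = _
    rw [h]
    exact congrArg (Fill.graft (d _ x (f _ x)).1 _ _) (funext fun l => this _)

theorem Fill.assemble_eq_ofLabels {B : ∀ n, Z n → Type u₂} (d : ∀ n x, A n x → T2 Z n)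
    (β : ∀ n x a, Fill B (d n x a).1) (g : ∀ n x, B n x)
    (h : ∀ n x a, β n x a = ofLabels g _) : (t : Pasting X) → (s : Fill A t) →
    assemble d β t s = ofLabels g _
  | unit, _ => rfl
  | node x t, s => by
    refine Eq.trans ?_ (graft_ofLabels g (d _ x s.1).1 _)
    have : ∀ i, assemble d β (t i) (s.2 i) = ofLabels g _ :=
      fun i => assemble_eq_ofLabels d β g h (t i) (s.2 i)
    change Fill.plug (d _ x s.1) _ (β _ x s.1) (fun i => assemble d β _ (s.2 i)) = _
    rw [h]
    exact congrArg (Fill.graft (d _ x s.1).1 _ _) (funext fun l => this _)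

theorem Fill.graft_unit : (t : Pasting X) → (s : Fill A t) →
    HEq (Fill.graft t (fun _ => unit) s fun _ => PUnit.unit) s
  | unit, _ => HEq.rfl
  | node _ t, s => mk_heq (fun i => Pasting.graft_unit (t i)) rfl fun i =>
      graft_unit (t i) (s.2 i)

end Pasting

/-! ### The categories of trees -/

/-- The `n`-leafed trees. -/
abbrev TR (n : ℕ) : Type := T2 (fun _ => Unit) n

namespace TR

variable {n : ℕ}

/-- Replacing each node of a tree, with `m` children, say, by a given `m`-leafed tree. -/
abbrev expand (τ : TR n) (s : Fill (fun m _ => TR m) τ.tree) : TR n :=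
  τ.subst (fun _ _ σ => σ) s

/-- A map of trees `τ' ⟶ τ` is a tree of the same arity for each node of `τ`, such that `τ'`
is obtained when each node of `τ` is replaced by the corresponding tree. In other words, it is an
element of `T2 (T2 1) n` which is sent to `τ` and `τ'` by the two maps `T2 (T2 1) n → T2 1 n`
given by `T2 1 → 1` and by the multiplication of `T2`. -/
def Hom (τ' τ : TR n) : Type := {s : Fill (fun m _ => TR m) τ.tree // τ.expand s = τ'}

@[ext]
theorem Hom.ext {τ' τ : TR n} {φ ψ : Hom τ' τ} (h : φ.1 = ψ.1) : φ = ψ := Subtype.ext h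

/-- The identity of a tree, in terms of fillings. -/
abbrev idFill (τ : TR n) : Fill (fun m _ => TR m) τ.tree := Fill.ofLabels (fun _ x => T2.pure x) _

theorem expand_idFill (τ : TR n) : τ.expand τ.idFill = τ :=
  T2.ext (subst_pure (fun _ _ σ => σ) (fun _ x => T2.pure x) (fun _ _ => rfl) _)

/-- The composition of maps of trees, in terms of fillings. -/
def compFill (τ : TR n) (s : Fill (fun m _ => TR m) τ.tree)
    (r : Fill (fun m _ => TR m) (τ.expand s).tree) : Fill (fun m _ => TR m) τ.tree :=
  Fill.blocks (fun _ _ σ => σ) (fun _ _ (σ : TR _) ρ => σ.expand ρ) τ.tree s r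

theorem expand_compFill (τ : TR n) (s : Fill (fun m _ => TR m) τ.tree)
    (r : Fill (fun m _ => TR m) (τ.expand s).tree) :
    τ.expand (τ.compFill s r) = (τ.expand s).expand r :=
  T2.ext (subst_blocks _ _ _ _ (fun _ _ _ _ => rfl) _ _ _)

theorem compFill_idFill (τ : TR n) (s : Fill (fun m _ => TR m) τ.tree) :
    τ.compFill s (idFill _) = s :=
  Fill.blocks_ofLabels_right _ _ _ (fun _ _ σ => expand_idFill σ) _ _

theorem idFill_compFill (τ : TR n) (r : Fill (fun m _ => TR m) (τ.expand τ.idFill).tree)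
    (r' : Fill (fun m _ => TR m) τ.tree) (h : HEq r r') : τ.compFill τ.idFill r = r' :=
  Fill.blocks_ofLabels_left (fun _ _ σ => σ) (fun _ _ (σ : TR _) ρ => σ.expand ρ)
    (fun _ x => T2.pure x) (fun _ _ => rfl) (fun _ x r r' h => by
      cases h
      exact T2.ext (graft_unit _)) _ _ _ h

theorem compFill_compFill (τ : TR n) (s : Fill (fun m _ => TR m) τ.tree)
    (r : Fill (fun m _ => TR m) (τ.expand s).tree)
    (q : Fill (fun m _ => TR m) (τ.expand (τ.compFill s r)).tree)
    (q' : Fill (fun m _ => TR m) ((τ.expand s).expand r).tree) (h : HEq q q') :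
    τ.compFill (τ.compFill s r) q = τ.compFill s ((τ.expand s).compFill r q') :=
  Fill.blocks_blocks _ _ _ _ (fun _ _ _ _ => rfl) _ _ _
    (fun _ _ σ r q q' h => by cases h; exact (expand_compFill σ r q).symm) _ _ _ _ _ h

/-- The category of `n`-leafed trees. -/
instance : Category (TR n) where
  Hom := Hom
  id τ := ⟨τ.idFill, τ.expand_idFill⟩
  comp {_ _ τ} φ ψ := ⟨τ.compFill ψ.1 (cast (by rw [ψ.2]) φ.1), by
    obtain ⟨s, rfl⟩ := ψ
    obtain ⟨r, rfl⟩ := φ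
    exact expand_compFill _ _ _⟩
  id_comp := by
    rintro _ τ ⟨s, rfl⟩
    exact Hom.ext (compFill_idFill _ _)
  comp_id := by
    rintro _ τ ⟨s, rfl⟩
    exact Hom.ext (idFill_compFill _ _ _ (cast_heq _ _))
  assoc := by
    rintro _ _ _ τ ⟨q, rfl⟩ ⟨r, rfl⟩ ⟨s, rfl⟩
    exact Hom.ext (compFill_compFill _ _ _ _ _ (cast_heq _ _)).symm

end TR

end Relax

namespace Relax

open Pasting

/-! ### Multicategories over the monad `T2` -/

/-- `T2`-multicategories. An arrow goes from a pasting of objects, with `n` inputs, to an object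
over `n`. -/
structure T2Multicategory where
  /-- the objects over each natural number -/
  Obj : ℕ → Type u
  /-- the arrows from a pasting of objects to an object -/
  Hom : ∀ {n : ℕ}, T2 Obj n → Obj n → Type v
  /-- identities -/
  id {n : ℕ} (x : Obj n) : Hom (T2.pure x) x
  /-- the composite of an arrow `α` with domain `θ` and of an arrow into (the label of) each node
  of `θ` -/
  comp {n : ℕ} {θ : T2 Obj n} {x : Obj n} (α : Hom θ x)
    (Θ : Fill (fun m y => Σ P : T2 Obj m, Hom P y) θ.tree) :
    Hom (θ.subst (fun _ _ β => β.1) Θ) x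
  id_comp {n : ℕ} {θ : T2 Obj n} {x : Obj n} (α : Hom θ x) :
    (⟨_, comp (id x) (⟨θ, α⟩, fun _ => PUnit.unit)⟩ : Σ P : T2 Obj n, Hom P x) = ⟨_, α⟩
  comp_id {n : ℕ} {θ : T2 Obj n} {x : Obj n} (α : Hom θ x) :
    (⟨_, comp α (Fill.ofLabels (fun _ y => ⟨_, id y⟩) θ.tree)⟩ : Σ P : T2 Obj n, Hom P x) = ⟨_, α⟩
  assoc {n : ℕ} {θ : T2 Obj n} {x : Obj n} (α : Hom θ x)
    (Θ : Fill (fun m y => Σ P : T2 Obj m, Hom P y) θ.tree)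
    (Ξ : Fill (fun m y => Σ P : T2 Obj m, Hom P y) (θ.subst (fun _ _ β => β.1) Θ).tree) :
    (⟨_, comp (comp α Θ) Ξ⟩ : Σ P : T2 Obj n, Hom P x) =
      ⟨_, comp α (Fill.blocks (fun _ _ β => β.1) (fun _ _ β ξ => ⟨_, comp β.2 ξ⟩) θ.tree Θ Ξ)⟩

/-- Maps of `T2`-multicategories. -/
structure T2Multicategory.Map (V : T2Multicategory.{u, v}) (W : T2Multicategory.{u₁, v₁}) where
  /-- the action on objects -/
  obj : ∀ n, V.Obj n → W.Obj n
  /-- the action on arrows -/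
  hom : ∀ {n : ℕ} {θ : T2 V.Obj n} {x : V.Obj n}, V.Hom θ x → W.Hom (θ.map obj) (obj n x)
  map_id {n : ℕ} (x : V.Obj n) : hom (V.id x) = W.id (obj n x)
  map_comp {n : ℕ} {θ : T2 V.Obj n} {x : V.Obj n} (α : V.Hom θ x)
    (Θ : Fill (fun m y => Σ P : T2 V.Obj m, V.Hom P y) θ.tree) :
    (⟨_, hom (V.comp α Θ)⟩ : Σ P : T2 W.Obj n, W.Hom P (obj n x)) =
      ⟨_, W.comp (hom α) (Fill.mapLabels obj (fun _ _ β => ⟨_, hom β.2⟩) θ.tree Θ)⟩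

theorem T2.subst_subst {X : ℕ → Type u} {Z : ℕ → Type w} {W : ℕ → Type v₁}
    {A : ∀ n, X n → Type u₁} {B : ∀ n, Z n → Type u₂} {R : ∀ n, X n → Type v₂}
    (d : ∀ n x, A n x → T2 Z n) (op : ∀ n x (a : A n x), Fill B (d n x a).1 → R n x)
    (d' : ∀ n x, B n x → T2 W n) (d'' : ∀ n x, R n x → T2 W n)
    (h : ∀ n x a r, d'' n x (op n x a r) = (d n x a).subst d' r) {n : ℕ} (θ : T2 X n)
    (s : Fill A θ.tree) (r : Fill B (θ.subst d s).tree) :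
    (θ.subst d s).subst d' r = θ.subst d'' (Fill.blocks d op θ.tree s r) :=
  T2.ext (subst_blocks d op d' d'' h θ.tree s r).symm

/-! ### The `T2`-multicategory of trees -/

namespace TR

variable {n : ℕ} {X : ℕ → Type u} {A : ∀ n, X n → Type v}

theorem comp_eqToHom_val {τ₁ τ₂ τ₃ : TR n} (φ : τ₁ ⟶ τ₂) (h : τ₂ = τ₃) :
    HEq (φ ≫ eqToHom h).1 φ.1 := by
  subst h
  simp

theorem eqToHom_val {τ₁ τ₂ : TR n} (h : τ₁ = τ₂) : (eqToHom h).1 = τ₂.idFill := by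
  subst h
  rfl

theorem comp_val {τ₁ τ₂ τ₃ : TR n} (φ : τ₁ ⟶ τ₂) (ψ : τ₂ ⟶ τ₃)
    (r : Fill (fun m _ => TR m) (τ₃.expand ψ.1).tree) (h : HEq r φ.1) :
    (φ ≫ ψ).1 = τ₃.compFill ψ.1 r := by
  obtain ⟨s, rfl⟩ := ψ
  cases h
  rfl

/-- Maps of trees, one for each node of a tree `θ`, induce a map between the trees that arise by
substitution in the nodes of `θ`. -/
def substMap (d₁ d₂ : ∀ n x, A n x → TR n) (β : ∀ n x a, d₁ n x a ⟶ d₂ n x a) (θ : T2 X n)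
    (s : Fill A θ.tree) : θ.subst d₁ s ⟶ θ.subst d₂ s :=
  ⟨Fill.assemble d₂ (fun n x a => (β n x a).1) θ.tree s,
    T2.ext (subst_assemble _ _ _ _ (fun n x a => (β n x a).2) _ _)⟩

theorem substMap_comp (d₁ d₂ d₃ : ∀ n x, A n x → TR n) (β : ∀ n x a, d₁ n x a ⟶ d₂ n x a)
    (γ : ∀ n x a, d₂ n x a ⟶ d₃ n x a) (θ : T2 X n) (s : Fill A θ.tree) :
    substMap d₁ d₂ β θ s ≫ substMap d₂ d₃ γ θ s =
      substMap d₁ d₃ (fun n x a => β n x a ≫ γ n x a) θ s := by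
  apply Hom.ext
  obtain ⟨r, hr⟩ : ∃ r : Fill (fun m _ => TR m)
      (TR.expand (θ.subst d₃ s : TR n) (substMap d₂ d₃ γ θ s).1).tree,
      HEq r (substMap d₁ d₂ β θ s).1 :=
    ⟨cast (by rw [(substMap d₂ d₃ γ θ s).2]) (substMap d₁ d₂ β θ s).1, cast_heq _ _⟩
  refine (comp_val _ _ r hr).trans ?_
  exact Fill.blocks_assemble d₃ (fun n x a => (γ n x a).1) _ _ d₂ (fun n x a => (β n x a).1) _
    (fun n x a => (γ n x a).2)
    (fun n x a q hq => (comp_val (β n x a) (γ n x a) q hq).symm) _ _ _ hr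

theorem substMap_eqToHom (d₁ d₂ : ∀ n x, A n x → TR n) (h : ∀ n x a, d₁ n x a = d₂ n x a)
    (θ : T2 X n) (s : Fill A θ.tree) :
    substMap d₁ d₂ (fun n x a => eqToHom (h n x a)) θ s =
      eqToHom (by obtain rfl : d₁ = d₂ := funext fun n => funext fun x => funext fun a => h n x a
                  rfl) := by
  obtain rfl : d₁ = d₂ := funext fun n => funext fun x => funext fun a => h n x a
  exact Hom.ext (Fill.assemble_eq_ofLabels _ _ _ (fun _ _ _ => rfl) _ _)

theorem eq_conj {a b a' b' : TR n} (ha : a = a') (hb : b = b') {φ : a ⟶ b} {ψ : a' ⟶ b'}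
    (h : HEq φ.1 ψ.1) : φ = eqToHom ha ≫ ψ ≫ eqToHom hb.symm := by
  subst ha
  subst hb
  rw [Hom.ext (eq_of_heq h)]
  simp

theorem substMap_rel {A' : ∀ n, X n → Type w} (d₁ d₂ : ∀ n x, A n x → TR n)
    (β : ∀ n x a, d₁ n x a ⟶ d₂ n x a) (d₁' d₂' : ∀ n x, A' n x → TR n)
    (β' : ∀ n x a, d₁' n x a ⟶ d₂' n x a) (θ : T2 X n)
    (s : Fill A θ.tree) (s' : Fill A' θ.tree)
    (h₁ : Fill.Rel (fun n x a a' => d₁ n x a = d₁' n x a') θ.tree s s')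
    (h₂ : Fill.Rel (fun n x a a' => d₂ n x a = d₂' n x a' ∧ HEq (β n x a).1 (β' n x a').1)
      θ.tree s s') :
    substMap d₁ d₂ β θ s = eqToHom (T2.ext (subst_congr _ _ _ _ _ h₁)) ≫
      substMap d₁' d₂' β' θ s' ≫ eqToHom (T2.ext (subst_congr _ _ _ _ _
        (Fill.Rel.mono (fun _ _ _ _ h => h.1) _ _ _ h₂))).symm :=
  eq_conj _ (T2.ext (subst_congr _ _ _ _ _ (Fill.Rel.mono (fun _ _ _ _ h => h.1) _ _ _ h₂)))
    (Fill.assemble_congr d₂ d₂' (fun n x a => (β n x a).1) (fun n x a => (β' n x a).1)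
    θ.tree s s' h₂)

theorem subst_mk {Z : ℕ → Type w} {B : ∀ n, Z n → Type u₁} (d : ∀ n x, A n x → T2 Z n)
    (d' : ∀ n x, B n x → TR n) (θ : T2 X n)
    (s : Fill A θ.tree) (r : Fill B (θ.subst d s).tree)
    (W : Fill (fun n x => Σ a : A n x, Fill B (d n x a).1) θ.tree)
    (hW : W = Fill.blocks d (fun _ _ a r => ⟨a, r⟩) θ.tree s r) :
    (θ.subst d s).subst d' r = θ.subst (fun n x w => (d n x w.1).subst d' w.2) W := by
  subst hW
  exact T2.ext (subst_blocks _ _ _ _ (fun _ _ _ _ => rfl) _ _ _).symm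

theorem substMap_mk {Z : ℕ → Type w} {B : ∀ n, Z n → Type u₁} (d : ∀ n x, A n x → T2 Z n)
    (d₁ d₂ : ∀ n x, B n x → TR n) (γ : ∀ n x b, d₁ n x b ⟶ d₂ n x b) (θ : T2 X n)
    (s : Fill A θ.tree) (r : Fill B (θ.subst d s).tree)
    (W : Fill (fun n x => Σ a : A n x, Fill B (d n x a).1) θ.tree)
    (hW : W = Fill.blocks d (fun _ _ a r => ⟨a, r⟩) θ.tree s r) :
    substMap d₁ d₂ γ (θ.subst d s) r = eqToHom (subst_mk d d₁ θ s r W hW) ≫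
      substMap (fun n x w => (d n x w.1).subst d₁ w.2)
        (fun n x w => (d n x w.1).subst d₂ w.2) (fun n x w => substMap d₁ d₂ γ _ w.2) θ W ≫
      eqToHom (subst_mk d d₂ θ s r W hW).symm := by
  subst hW
  exact eq_conj _ (subst_mk d d₂ θ s r _ rfl) (Fill.assemble_blocks d
    (fun n x a r => (⟨a, r⟩ : Σ a : A n x, Fill B (d n x a).1)) d₂
    (fun n x w => (d n x w.1).subst d₂ w.2) (fun n x b => (γ n x b).1)
    (fun n x w => (substMap d₁ d₂ γ _ w.2).1) (fun _ _ _ _ => rfl)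
    (fun _ _ _ _ => HEq.rfl) θ.tree s r).symm

theorem subst_irrel (d : ∀ n, X n → TR n) {A' : ∀ n, X n → Type w} (θ : T2 X n)
    (s : Fill A θ.tree) (s' : Fill A' θ.tree) :
    θ.subst (fun n x _ => d n x) s = θ.subst (fun n x _ => d n x) s' :=
  T2.ext (subst_congr _ _ _ _ _ (Fill.rel_of _ (fun _ _ _ _ => rfl) _ _ _))

theorem join_subst (d : ∀ n x, A n x → T2 TR n) (θ : T2 X n) (s : Fill A θ.tree) :
    θ.subst (fun n x a => (d n x a).join) s = (θ.subst d s).join := by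
  refine T2.ext (Eq.trans ?_ (subst_blocks d (B := fun _ _ => PUnit.{1}) (R := A)
    (fun _ _ a _ => a) (fun _ y _ => y) (fun n x a => (d n x a).join)
    (fun n x a r => subst_irrel (fun _ y => y) _ _ r) θ.tree s _))
  exact subst_congr _ _ _ _ _ (Fill.Rel.mono (fun _ _ a b (h : a = b) => by rw [h]) _ _ _
    (Fill.rel_blocks d (fun _ _ a _ => a) (fun _ _ a b => a = b)
    (fun _ _ _ _ => rfl) _ _ _))

theorem join_eq (θ : T2 TR n) {A' : ∀ n, TR n → Type w} (s : Fill A' θ.tree) :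
    θ.join = θ.subst (fun _ σ _ => σ) s :=
  subst_irrel (fun _ σ => σ) θ _ _

theorem conj_val {a b c d e : TR n} (h : a = b) (h' : b = c) (φ : c ⟶ d) (h'' : d = e) :
    HEq (eqToHom h ≫ eqToHom h' ≫ φ ≫ eqToHom h'').1 φ.1 := by
  subst h
  subst h'
  subst h''
  simp

theorem comp_val_of_eq {a b c d e : TR n} (φ : a ⟶ b) (h : b = c) (ψ : c ⟶ d)
    (hψ : ψ.1 = d.idFill) (h' : d = e) : HEq (φ ≫ eqToHom h ≫ ψ ≫ eqToHom h').1 φ.1 := by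
  obtain ⟨s, rfl⟩ := ψ
  obtain rfl : s = _ := hψ
  have h₁ := d.expand_idFill
  have : (⟨d.idFill, rfl⟩ : d.expand d.idFill ⟶ d) = eqToHom h₁ := Hom.ext (eqToHom_val _).symm
  rw [this, eqToHom_trans, eqToHom_trans]
  exact comp_eqToHom_val _ _

theorem join_pure (τ : TR n) : (T2.pure τ).join = τ := T2.ext (graft_unit _)

theorem sigma_ext {τ : TR n} {θ θ' : T2 TR n} (h : θ = θ') {α : τ ⟶ θ.join} {α' : τ ⟶ θ'.join}
    (hα : HEq α.1 α'.1) : (⟨θ, α⟩ : Σ P : T2 TR n, τ ⟶ P.join) = ⟨θ', α'⟩ := by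
  subst h
  rw [Hom.ext (eq_of_heq hα)]

/-- The arrows from `θ` to `τ` in the opposite of the `T2`-structured category of trees are the
maps from `τ` to the composite of `θ`. -/
abbrev OpHom (θ : T2 TR n) (τ : TR n) : Type := τ ⟶ θ.join

/-- The arrows to `τ` in the opposite of the `T2`-structured category of trees. -/
abbrev OpArr (m : ℕ) (τ : TR m) : Type := Σ θ : T2 TR m, OpHom θ τ

/-- The composition of arrows in the opposite of the `T2`-structured category of trees. -/
def opComp {θ : T2 TR n} {τ : TR n} (α : OpHom θ τ) (Θ : Fill OpArr θ.tree) :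
    OpHom (θ.subst (fun _ _ β => β.1) Θ) τ :=
  α ≫ eqToHom (join_eq θ Θ) ≫
    substMap (fun _ σ _ => σ) (fun _ _ β => β.1.join) (fun _ _ β => β.2) θ Θ ≫
    eqToHom (join_subst _ θ Θ)

theorem assoc_aux {C : Type} [Category.{0} C] {a b c d e f g h i j k l p q c' : C} (α : a ⟶ b)
    {S₁ : c ⟶ f} {S₂ : h ⟶ k} {S₃ : c' ⟶ q} {A : d ⟶ e} {B : i ⟶ j}
    {h₁ : c = d} {h₂ : e = f} {h₃ : h = i} {h₄ : j = k} {h₅ : c' = d} {h₆ : e = i} {h₇ : j = p}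
    {h₈ : p = q}
    (e₁ : S₁ = eqToHom h₁ ≫ A ≫ eqToHom h₂) (e₂ : S₂ = eqToHom h₃ ≫ B ≫ eqToHom h₄)
    (e₃ : S₃ = eqToHom h₅ ≫ (A ≫ eqToHom h₆ ≫ B ≫ eqToHom h₇) ≫ eqToHom h₈)
    (k₁ : b = c) (k₂ : f = g) (k₃ : g = h) (k₄ : k = l) (k₅ : b = c') {r : C} (k₆ : q = r)
    (k₇ : r = l) :
    (α ≫ eqToHom k₁ ≫ S₁ ≫ eqToHom k₂) ≫ eqToHom k₃ ≫ S₂ ≫ eqToHom k₄ =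
    (α ≫ eqToHom k₅ ≫ S₃ ≫ eqToHom k₆) ≫ eqToHom k₇ := by
  subst e₁ e₂ e₃
  simp

theorem substMap_opComp (θ : T2 TR n)
    (W : Fill (fun m y => Σ β : OpArr m y, Fill OpArr β.1.tree) θ.tree) (h₁ h₂) :
    substMap (fun _ σ _ => σ)
      (fun _ _ w => (w.1.1.subst (fun _ _ (β : OpArr _ _) => β.1) w.2).join)
      (fun _ _ w => opComp w.1.2 w.2) θ W = substMap (fun _ σ _ => σ)
        (fun _ _ w => w.1.1.join) (fun _ _ w => w.1.2) θ W ≫ eqToHom h₁ ≫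
        substMap (fun _ _ w => w.1.1.subst (fun _ σ _ => σ) w.2)
          (fun _ _ w => w.1.1.subst (fun _ _ (β : OpArr _ _) => β.1.join) w.2)
          (fun _ _ w => substMap (fun _ σ _ => σ) (fun _ _ (β : OpArr _ _) => β.1.join)
            (fun _ _ β => β.2) w.1.1 w.2) θ W ≫ eqToHom h₂ := by
  have q₁ := substMap_eqToHom (fun n x (w : Σ β : OpArr n x, Fill OpArr β.1.tree) =>
    w.1.1.join) (fun _ _ w => w.1.1.subst (fun _ σ _ => σ) w.2)
    (fun _ _ w => join_eq w.1.1 w.2) θ W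
  have q₂ := substMap_eqToHom (fun n x (w : Σ β : OpArr n x, Fill OpArr β.1.tree) =>
    w.1.1.subst (fun _ _ (β : OpArr _ _) => β.1.join) w.2)
    (fun _ _ w => (w.1.1.subst (fun _ _ (β : OpArr _ _) => β.1) w.2).join)
    (fun _ _ w => join_subst _ w.1.1 w.2) θ W
  refine Eq.trans ?_ (congrArg₂ (fun p q => substMap (fun _ σ _ => σ)
      (fun _ _ w => w.1.1.join) (fun _ _ w => w.1.2) θ W ≫ p ≫
      substMap (fun _ _ w => w.1.1.subst (fun _ σ _ => σ) w.2)
        (fun _ _ w => w.1.1.subst (fun _ _ (β : OpArr _ _) => β.1.join) w.2)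
        (fun _ _ w => substMap (fun _ σ _ => σ) (fun _ _ (β : OpArr _ _) => β.1.join)
          (fun _ _ β => β.2) w.1.1 w.2) θ W ≫ q) q₁ q₂)
  simp only [substMap_comp]
  rfl

theorem opComp_assoc {θ : T2 TR n} {τ : TR n} (α : OpHom θ τ) (Θ : Fill OpArr θ.tree)
    (Ξ : Fill OpArr (θ.subst (fun _ _ (β : OpArr _ _) => β.1) Θ).tree)
    (B : Fill OpArr θ.tree)
    (hB : B = Fill.blocks (fun _ _ (β : OpArr _ _) => β.1)
      (fun _ _ β ξ => (⟨_, opComp β.2 ξ⟩ : OpArr _ _)) θ.tree Θ Ξ)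
    (h : (θ.subst (fun _ _ (β : OpArr _ _) => β.1) B).join =
      ((θ.subst (fun _ _ (β : OpArr _ _) => β.1) Θ).subst (fun _ _ (β : OpArr _ _) => β.1) Ξ).join) :
    opComp (opComp α Θ) Ξ = opComp α B ≫ eqToHom h := by
  obtain ⟨W, hW⟩ : ∃ W : Fill (fun m y => Σ β : OpArr m y, Fill OpArr β.1.tree) θ.tree, W =
    Fill.blocks (fun _ _ (β : OpArr _ _) => β.1) (fun _ _ β r => ⟨β, r⟩) θ.tree Θ Ξ := ⟨_, rfl⟩
  have e₁ := substMap_rel (fun _ σ _ => σ) (fun _ _ (β : OpArr _ _) => β.1.join)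
    (fun _ _ β => β.2) (fun _ σ _ => σ) (fun _ _ w => w.1.1.join) (fun _ _ w => w.1.2) θ Θ W
    (Fill.rel_of _ (fun _ _ _ _ => rfl) _ _ _)
    (by
      subst hW
      exact Fill.rel_blocks _ _ _ (fun _ _ _ _ => ⟨rfl, HEq.rfl⟩) _ _ _)
  have e₂ := substMap_mk (fun _ _ (β : OpArr _ _) => β.1) (fun _ σ _ => σ)
    (fun _ _ (β : OpArr _ _) => β.1.join) (fun _ _ β => β.2) θ Θ Ξ W hW
  have e₃ := substMap_rel (fun _ σ _ => σ)
    (fun _ _ (β : OpArr _ _) => β.1.join) (fun _ _ β => β.2)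
    (fun _ σ _ => σ) (fun _ _ w => (w.1.1.subst (fun _ _ (β : OpArr _ _) => β.1) w.2).join)
    (fun _ _ w => opComp w.1.2 w.2) θ B W
    (Fill.rel_of _ (fun _ _ _ _ => rfl) _ _ _)
    (by
      subst hB
      subst hW
      exact Fill.rel_blocks_blocks _ _ _ _ (fun _ _ _ _ => ⟨rfl, HEq.rfl⟩) _ _ _)
  have h₁ : θ.subst (fun _ _ w => w.1.1.join) W =
      θ.subst (fun _ _ w => w.1.1.subst (fun _ σ _ => σ) w.2) W :=
    congrArg (fun d => θ.subst d W) (funext fun _ => funext fun _ => funext fun w =>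
      join_eq w.1.1 w.2)
  have h₂ : θ.subst (fun _ _ w => w.1.1.subst (fun _ _ (β : OpArr _ _) => β.1.join) w.2) W =
      θ.subst (fun _ _ w => (w.1.1.subst (fun _ _ (β : OpArr _ _) => β.1) w.2).join) W :=
    congrArg (fun d => θ.subst d W) (funext fun _ => funext fun _ => funext fun w =>
      join_subst _ w.1.1 w.2)
  have e₄ := e₃.trans (congrArg (fun z => eqToHom _ ≫ z ≫ eqToHom _)
    (substMap_opComp θ W h₁ h₂))
  exact assoc_aux (C := TR n) α e₁ e₂ e₄ _ _ _ _ _ _ h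

end TR

/-- The opposite of the `T2`-structured category of trees, as a `T2`-multicategory. -/
def TRop : T2Multicategory.{0, 0} where
  Obj := TR
  Hom := TR.OpHom
  id τ := eqToHom (TR.join_pure τ).symm
  comp := TR.opComp
  id_comp := by
    intro n θ τ α
    exact TR.sigma_ext (T2.ext (graft_unit _)) ((TR.conj_val _ _ _ _).trans
      (Fill.graft_unit θ.join.tree α.1))
  comp_id := by
    intro n θ τ α
    refine TR.sigma_ext (T2.ext (subst_pure (fun _ _ (β : TR.OpArr _ _) => β.1)
      (fun _ y => (⟨T2.pure y, eqToHom (TR.join_pure y).symm⟩ : TR.OpArr _ _))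
      (fun _ _ => rfl) θ.tree)) (TR.comp_val_of_eq _ _ _ ?_ _)
    exact Fill.assemble_ofLabels (fun _ _ (β : TR.OpArr _ _) => β.1.join) (fun _ _ β => β.2.1)
      (fun _ y => (⟨T2.pure y, eqToHom (TR.join_pure y).symm⟩ : TR.OpArr _ _)) _
      (fun _ y => TR.eqToHom_val (TR.join_pure y).symm) θ.tree
  assoc := by
    intro n θ τ α Θ Ξ
    have h := T2.subst_subst (fun _ _ (β : TR.OpArr _ _) => β.1)
      (fun _ _ β ξ => (⟨_, TR.opComp β.2 ξ⟩ : TR.OpArr _ _)) _ (fun _ _ β => β.1)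
      (fun _ _ _ _ => rfl) θ Θ Ξ
    refine TR.sigma_ext h ?_
    rw [TR.opComp_assoc α Θ Ξ _ rfl (by rw [h])]
    exact TR.comp_eqToHom_val _ _

end Relax

namespace Relax

open Pasting

/-! ### Pasting diagrams with labelled edges -/

/-- Let `K n x b a` be a set for each label `x` of nodes with `n` children and for all `b` and `a`
in `I`. An element of `Filling K t a` consists of an element of `I` for each edge of the tree `t`,
which is `a` for the root edge, and, for each node, of an element of `K n x b a'`, where `x` is the
label of the node, and `b` and `a'` are the elements of `I` for its input edges and its output
edge. -/
def Filling {I : Type u₁} {X : ℕ → Type u} (K : ∀ n, X n → (Fin n → I) → I → Type v) :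
    Pasting X → I → Type (max u₁ v)
  | unit, _ => PUnit
  | node x t, a => Σ b : Fin _ → I, K _ x b a × ∀ i, Filling K (t i) (b i)

namespace Filling

section

variable {I : Type u₁} {X : ℕ → Type u} {K : ∀ n, X n → (Fin n → I) → I → Type v}

/-- The element of `I` for a leaf. -/
def leaf : (t : Pasting X) → {a : I} → Filling K t a → Leaf t → I
  | unit, a, _, _ => a
  | node _ t, _, s, ⟨i, l⟩ => leaf (t i) (s.2.2 i) l

/-- The restriction to the lower tree. -/
def lower : (t : Pasting X) → (c : Leaf t → Pasting X) → {a : I} → Filling K (t.graft c) a →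
    Filling K t a
  | unit, _, _, _ => PUnit.unit
  | node _ t, c, _, s => ⟨s.1, s.2.1, fun i => lower (t i) (fun l => c ⟨i, l⟩) (s.2.2 i)⟩

/-- The restriction to one of the upper trees. -/
def upper : (t : Pasting X) → (c : Leaf t → Pasting X) → {a : I} → (s : Filling K (t.graft c) a) →
    (l : Leaf t) → Filling K (c l) (leaf t (lower t c s) l)
  | unit, _, _, s, _ => s
  | node _ t, c, _, s, ⟨i, l⟩ => upper (t i) (fun l => c ⟨i, l⟩) (s.2.2 i) l

/-- The restriction to the lower tree. -/
def bot {n : ℕ} (P : T2 X n) (c : Fin n → Pasting X) {a : I} (r : Filling K (P.plug c) a) :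
    Filling K P.1 a :=
  lower P.1 _ r

/-- The restriction to the `i`-th upper tree. -/
def top {n : ℕ} (P : T2 X n) (c : Fin n → Pasting X) {a : I} (r : Filling K (P.plug c) a)
    (i : Fin n) : Filling K (c i) (leaf P.1 (bot P c r) (P.leafEquiv.symm i)) :=
  reindex P.leafEquiv (P := fun i l => Filling K (c i) (leaf P.1 (bot P c r) l))
    (upper P.1 _ r) i

/-- A filling of the tree that arises from `t` by substituting trees in its nodes restricts to a
filling of each of these trees. If `act` turns these fillings into elements of the sets `K n x b a`,
the result is a filling of `t` itself. -/
def collapse {Z : ℕ → Type w} {K' : ∀ n, Z n → (Fin n → I) → I → Type v} {A : ∀ n, X n → Type u₂}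
    (d : ∀ n x, A n x → T2 Z n)
    (act : ∀ n x (β : A n x) (a : I) (r : Filling K' (d n x β).1 a),
      K n x (fun i => leaf _ r ((d n x β).leafEquiv.symm i)) a) :
    (t : Pasting X) → (s : Fill A t) → {a : I} → Filling K' (t.subst d s) a → Filling K t a
  | unit, _, _, _ => PUnit.unit
  | node x t, s, _, r => ⟨_, act _ x s.1 _ (bot (d _ x s.1) _ r), fun i =>
      collapse d act (t i) (s.2 i) (top (d _ x s.1) (fun i => subst d (t i) (s.2 i)) r i)⟩

theorem top_heq {n : ℕ} (P : T2 X n) (c : Fin n → Pasting X) {a : I} (r : Filling K (P.plug c) a)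
    (l : Leaf P.1) : HEq (top P c r (P.leafEquiv l)) (upper P.1 _ r l) := by
  have := reindex_apply P.leafEquiv (P := fun i l => Filling K (c i) (leaf P.1 (bot P c r) l))
    (S := fun i => Σ a, Filling K (c i) a) (fun _ l z => ⟨leaf P.1 (bot P c r) l, z⟩)
    (upper P.1 _ r) l
  exact (Sigma.mk.inj_iff.1 this).2

theorem leaf_congr {t : Pasting X} {a a' : I} (ha : a = a') {x : Filling K t a}
    {x' : Filling K t a'} (h : HEq x x') : leaf t x = leaf t x' := by
  subst ha
  cases h
  rfl

theorem leaf_graft : (t : Pasting X) → (c : Leaf t → Pasting X) → {a : I} →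
    (r : Filling K (t.graft c) a) → (p : Leaf (t.graft c)) →
    leaf _ r p = leaf (c (graftLeafEquiv t c p).1) (upper t c r _) (graftLeafEquiv t c p).2
  | unit, _, _, _, _ => rfl
  | node _ t, c, _, r, ⟨i, p⟩ => leaf_graft (t i) (fun l => c ⟨i, l⟩) (r.2.2 i) p

theorem leaf_top {n : ℕ} (P : T2 X n) (c : Fin n → Pasting X) {a : I} (r : Filling K (P.plug c) a)
    (p : Leaf (P.plug c)) :
    leaf _ (top P c r (P.leafEquiv (graftLeafEquiv _ _ p).1)) (graftLeafEquiv _ _ p).2 =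
      leaf _ r p :=
  (congrFun (leaf_congr (by simp; rfl) (top_heq P c r _)) _).trans (leaf_graft P.1 _ r p).symm

theorem node_heq {n : ℕ} {x : X n} {t t' : Fin n → Pasting X} (ht : ∀ i, t i = t' i) {a a' : I}
    (ha : a = a') {r : Filling K (node x t) a} {r' : Filling K (node x t') a'} (h : HEq r r') :
    r.1 = r'.1 ∧ HEq r.2.1 r'.2.1 ∧ ∀ i, HEq (r.2.2 i) (r'.2.2 i) := by
  obtain rfl : t = t' := funext ht
  subst ha
  cases h
  exact ⟨rfl, HEq.rfl, fun _ => HEq.rfl⟩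

theorem mk_heq {n : ℕ} {x : X n} {t t' : Fin n → Pasting X} (ht : ∀ i, t i = t' i) {a a' : I}
    (ha : a = a') {r : Filling K (node x t) a} {r' : Filling K (node x t') a'} (h : r.1 = r'.1)
    (h₁ : HEq r.2.1 r'.2.1) (h₂ : ∀ i, HEq (r.2.2 i) (r'.2.2 i)) : HEq r r' := by
  obtain rfl : t = t' := funext ht
  subst ha
  obtain ⟨b, k, s⟩ := r
  obtain ⟨b', k', s'⟩ := r'
  obtain rfl : b = b' := h
  obtain rfl : k = k' := eq_of_heq h₁
  obtain rfl : s = s' := funext fun i => eq_of_heq (h₂ i)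
  rfl

theorem heq_graft {t : Pasting X} {c c' : Leaf t → Pasting X} (hc : ∀ l, c l = c' l) {a a' : I}
    (ha : a = a') {r : Filling K (t.graft c) a} {r' : Filling K (t.graft c') a'} (h : HEq r r') :
    HEq (lower t c r) (lower t c' r') ∧ ∀ l, HEq (upper t c r l) (upper t c' r' l) := by
  obtain rfl : c = c' := funext hc
  subst ha
  cases h
  exact ⟨HEq.rfl, fun _ => HEq.rfl⟩

theorem heq_plug {n : ℕ} {P P' : T2 X n} (hP : P = P') {c : Leaf P.1 → Pasting X}
    {c' : Fin n → Pasting X} (hc : ∀ l, c l = c' (P.leafEquiv l)) {a a' : I} (ha : a = a')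
    {r : Filling K (P.1.graft c) a} {r' : Filling K (P'.plug c') a'} (h : HEq r r') :
    HEq (lower P.1 c r) (bot P' c' r') ∧
      ∀ l, HEq (upper P.1 c r l) (top P' c' r' (P.leafEquiv l)) := by
  subst hP
  obtain rfl : c = fun l => c' (P.leafEquiv l) := funext hc
  subst ha
  cases h
  exact ⟨HEq.rfl, fun l => (top_heq _ _ _ _).symm⟩

theorem heq_graft_graft : (t : Pasting X) → (a : Leaf t → Pasting X) →
    (b : ∀ l, Leaf (a l) → Pasting X) → {o o' : I} → (ho : o = o') →
    (r : Filling K ((t.graft a).graft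
      (fun p => b (graftLeafEquiv t a p).1 (graftLeafEquiv t a p).2)) o) →
    (r' : Filling K (t.graft fun l => (a l).graft (b l)) o') → HEq r r' →
    HEq (lower t _ (lower _ _ r)) (lower t _ r') ∧
    (∀ l, HEq (upper t _ (lower _ _ r) l) (lower (a l) _ (upper t _ r' l))) ∧
    ∀ p, HEq (upper _ _ r p)
      (upper (a (graftLeafEquiv t a p).1) (b _) (upper t _ r' (graftLeafEquiv t a p).1)
        (graftLeafEquiv t a p).2)
  | unit, _, _, _, _, ho, r, r', h => by
    subst ho
    cases h
    exact ⟨HEq.rfl, fun _ => HEq.rfl, fun _ => HEq.rfl⟩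
  | node x t, a, b, _, _, ho, r, r', h => by
    have h' := node_heq (fun i =>
      graft_graft (t i) (fun l => a ⟨i, l⟩) fun l => b ⟨i, l⟩) ho h
    have ih := fun i => heq_graft_graft (t i) (fun l => a ⟨i, l⟩) (fun l => b ⟨i, l⟩)
      (congrFun h'.1 i) (r.2.2 i) (r'.2.2 i) (h'.2.2 i)
    refine ⟨?_, ?_, ?_⟩
    · exact mk_heq (fun _ => rfl) ho h'.1 h'.2.1 fun i => (ih i).1
    · rintro ⟨i, l⟩
      exact (ih i).2.1 l
    · rintro ⟨i, p⟩
      exact (ih i).2.2 p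

theorem heq_pure_plug {n : ℕ} (x : X n) {c t : Fin n → Pasting X} (hc : ∀ i, c i = t i) {a a' : I}
    (ha : a = a') {r : Filling K ((T2.pure x).plug c) a} {r' : Filling K (node x t) a'}
    (h : HEq r r') :
    (bot (T2.pure x) c r).1 = r'.1 ∧ HEq (bot (T2.pure x) c r).2.1 r'.2.1 ∧
      ∀ i, HEq (top (T2.pure x) c r i) (r'.2.2 i) := by
  have h₀ := node_heq (t := fun i => c ((T2.pure x).leafEquiv ⟨i, ()⟩))
    (fun i => by rw [T2.leafEquiv_pure, hc]) ha h
  refine ⟨h₀.1, h₀.2.1, fun i => ?_⟩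
  have h₁ := top_heq (T2.pure x) c r ⟨i, ()⟩
  have h₂ : HEq (top (T2.pure x) c r i) (top (T2.pure x) c r ((T2.pure x).leafEquiv ⟨i, ()⟩)) := by
    rw [T2.leafEquiv_pure]
  exact h₂.trans (h₁.trans (h₀.2.2 i))

end

end Filling

end Relax

namespace Relax

open Pasting

theorem T2.leafEquiv_symm_pure {X : ℕ → Type u} {n : ℕ} (x : X n) (i : Fin n) :
    (T2.pure x).leafEquiv.symm i = ⟨i, ()⟩ :=
  (Equiv.symm_apply_eq _).2 (T2.leafEquiv_pure x i).symm

namespace Filling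

section

variable {I : Type u₁} {X : ℕ → Type u} {K : ∀ n, X n → (Fin n → I) → I → Type v}
  {Z : ℕ → Type w} {K' : ∀ n, Z n → (Fin n → I) → I → Type v} {A : ∀ n, X n → Type u₂}

theorem leaf_collapse (d : ∀ n x, A n x → T2 Z n)
    (act : ∀ n x (β : A n x) (a : I) (r : Filling K' (d n x β).1 a),
      K n x (fun i => leaf _ r ((d n x β).leafEquiv.symm i)) a) :
    (t : Pasting X) → (s : Fill A t) → {a : I} → (r : Filling K' (t.subst d s) a) →
    (p : Leaf (t.subst d s)) →
    leaf t (collapse d act t s r) (substLeafEquiv d t s p) = leaf _ r p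
  | unit, _, _, _, _ => rfl
  | node x t, s, a, r, p =>
      (leaf_collapse d act (t ((d _ x s.1).leafEquiv (graftLeafEquiv _ _ p).1)) _
        (top (d _ x s.1) (fun i => subst d (t i) (s.2 i)) r _) (graftLeafEquiv _ _ p).2).trans
        (leaf_top (d _ x s.1) _ r p)

theorem collapse_congr (d : ∀ n x, A n x → T2 Z n)
    (act : ∀ n x (β : A n x) (a : I) (r : Filling K' (d n x β).1 a),
      K n x (fun i => leaf _ r ((d n x β).leafEquiv.symm i)) a)
    (t : Pasting X) {s s' : Fill A t} (hs : s = s') {a a' : I} (ha : a = a')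
    {r : Filling K' (t.subst d s) a} {r' : Filling K' (t.subst d s') a'} (hr : HEq r r') :
    HEq (collapse d act t s r) (collapse d act t s' r') := by
  subst hs
  subst ha
  cases hr
  rfl

theorem act_congr {n : ℕ} {x : X n} {P : T2 Z n}
    (f : ∀ (a : I) (r : Filling K' P.1 a), K n x (fun i => leaf _ r (P.leafEquiv.symm i)) a)
    {a a' : I} (ha : a = a') {r : Filling K' P.1 a} {r' : Filling K' P.1 a'} (hr : HEq r r') :
    HEq (f a r) (f a' r') := by
  subst ha
  cases hr
  rfl

theorem leaf_symm {n : ℕ} {P : T2 Z n} {a a' : I} (ha : a = a') {x : Filling K' P.1 a}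
    {x' : Filling K' P.1 a'} (h : HEq x x') (l : Leaf P.1) :
    leaf P.1 x (P.leafEquiv.symm (P.leafEquiv l)) = leaf P.1 x' l := by
  rw [Equiv.symm_apply_apply, leaf_congr ha h]

theorem leaf_heq {n : ℕ} {P P' : T2 Z n} (hP : P = P') {a a' : I} (ha : a = a')
    {x : Filling K' P.1 a} {x' : Filling K' P'.1 a'} (h : HEq x x') (i : Fin n) :
    leaf P.1 x (P.leafEquiv.symm i) = leaf P'.1 x' (P'.leafEquiv.symm i) := by
  subst hP
  rw [leaf_congr ha h]

theorem collapse_graft (d : ∀ n x, A n x → T2 Z n)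
    (act : ∀ n x (β : A n x) (a : I) (r : Filling K' (d n x β).1 a),
      K n x (fun i => leaf _ r ((d n x β).leafEquiv.symm i)) a) :
    (t : Pasting X) → (c : Leaf t → Pasting X) → (r : Fill A (t.graft c)) → {o o' : I} → o = o' →
    (q : Filling K' ((t.graft c).subst d r) o) →
    (q' : Filling K' ((t.subst d (Fill.lower t c r)).graft fun p =>
        (c (substLeafEquiv d t _ p)).subst d (Fill.upper t c r (substLeafEquiv d t _ p))) o') →
    HEq q q' →
    HEq (lower t c (collapse d act _ r q)) (collapse d act t (Fill.lower t c r) (lower _ _ q')) ∧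
    ∀ p, HEq (upper t c (collapse d act _ r q) (substLeafEquiv d t _ p))
      (collapse d act _ (Fill.upper t c r (substLeafEquiv d t _ p)) (upper _ _ q' p))
  | unit, c, r, _, _, ho, q, q', h => by
    subst ho
    cases h
    exact ⟨HEq.rfl, fun _ => HEq.rfl⟩
  | node x t, c, r, o, _, ho, q, q', h => by
    subst ho
    have hg := graft_graft (d _ x r.1).1
      (fun l => (t ((d _ x r.1).leafEquiv l)).subst d
        (Fill.lower (t ((d _ x r.1).leafEquiv l)) (fun m => c ⟨_, m⟩) (r.2 _)))
      (fun l m =>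
      (c (⟨(d _ x r.1).leafEquiv l, substLeafEquiv d _ _ m⟩ : Leaf (node x t))).subst d
        (Fill.upper (node x t) c r ⟨(d _ x r.1).leafEquiv l, substLeafEquiv d _ _ m⟩))
    obtain ⟨q'', hq''⟩ : ∃ q'', HEq q'' q' :=
      ⟨cast (congrArg (fun z => Filling K' z o) hg) q', cast_heq _ _⟩
    have h₁ := heq_graft_graft (d _ x r.1).1
      (fun l => (t ((d _ x r.1).leafEquiv l)).subst d
        (Fill.lower (t ((d _ x r.1).leafEquiv l)) (fun m => c ⟨_, m⟩) (r.2 _)))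
      (fun l m =>
      (c (⟨(d _ x r.1).leafEquiv l, substLeafEquiv d _ _ m⟩ : Leaf (node x t))).subst d
        (Fill.upper (node x t) c r ⟨(d _ x r.1).leafEquiv l, substLeafEquiv d _ _ m⟩))
      rfl q' q'' hq''.symm
    have h₂ := heq_graft (t := (d _ x r.1).1)
      (fun l => subst_graft d (t _) (fun m => c ⟨_, m⟩) (r.2 ((d _ x r.1).leafEquiv l))) rfl
      (r := q) (r' := q'') (h.trans hq''.symm)
    have hb : HEq (bot (d _ x r.1) (fun i => subst d ((t i).graft _) (r.2 i)) q)
      (lower (d _ x r.1).1 _ q'') := h₂.1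
    have ih := fun l => collapse_graft d act (t ((d _ x r.1).leafEquiv l)) (fun m => c ⟨_, m⟩)
      (r.2 _) (leaf_symm rfl hb l)
      (top (d _ x r.1) (fun i => subst d ((t i).graft _) (r.2 i)) q _)
      (upper (d _ x r.1).1 _ q'' l)
      ((top_heq _ _ _ _).trans (h₂.2 l))
    have hbb : HEq (bot (d _ x r.1) (fun i => subst d ((t i).graft _) (r.2 i)) q)
      (bot (d _ x r.1) (fun i => (t i).subst d (Fill.lower (t i) (fun m => c ⟨i, m⟩) (r.2 i)))
        (lower ((node x t).subst d (Fill.lower (node x t) c r)) _ q')) := hb.trans h₁.1.symm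
    refine ⟨?_, fun p => ?_⟩
    · refine mk_heq (fun _ => rfl) rfl ?_ (act_congr (act _ x r.1) rfl hbb) fun i => ?_
      · exact funext fun i => congrFun (leaf_congr rfl hbb) _
      · obtain ⟨l, rfl⟩ := (d _ x r.1).leafEquiv.surjective i
        refine (ih l).1.trans ?_
        refine collapse_congr d act _ rfl ?_ ?_
        · exact (leaf_symm (P := d _ x r.1) rfl h₁.1 l).symm
        · refine (h₁.2.1 l).symm.trans ?_
          exact (top_heq (d _ x r.1)
            (fun i => (t i).subst d (Fill.lower (t i) (fun m => c ⟨i, m⟩) (r.2 i))) _ l).symm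
    · refine ((ih (graftLeafEquiv _ _ p).1).2 (graftLeafEquiv _ _ p).2).trans ?_
      refine collapse_congr d act _ rfl ?_ (h₁.2.2 p).symm
      exact ((leaf_graft _ _ _ p).trans
        (congrFun (leaf_congr (congrFun (leaf_congr rfl h₁.1) _) (h₁.2.1 _)) _)).symm

theorem collapse_plug (d : ∀ n x, A n x → T2 Z n)
    (act : ∀ n x (β : A n x) (a : I) (r : Filling K' (d n x β).1 a),
      K n x (fun i => leaf _ r ((d n x β).leafEquiv.symm i)) a)
    {n : ℕ} (P : T2 X n) (c : Fin n → Pasting X) (r : Fill A (P.plug c)) {o o' : I} (ho : o = o')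
    (q : Filling K' ((P.plug c).subst d r) o)
    (q' : Filling K' ((P.subst d (Fill.bot P c r)).plug
      fun i => (c i).subst d (Fill.top P c r i)) o')
    (h : HEq q q') :
    HEq (bot P c (collapse d act _ r q)) (collapse d act P.1 (Fill.bot P c r) (bot _ _ q')) ∧
    ∀ i, HEq (top P c (collapse d act _ r q) i)
      (collapse d act _ (Fill.top P c r i) (top _ _ q' i)) := by
  subst ho
  have hq := subst_graft d P.1 _ r
  obtain ⟨q₁, hq₁⟩ : ∃ q₁, HEq q₁ q := ⟨cast (congrArg (fun z => Filling K' z o) hq) q, cast_heq _ _⟩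
  have h₁ := collapse_graft d act P.1 _ r rfl q q₁ hq₁.symm
  have h₂ := heq_plug (P := P.subst d (Fill.bot P c r)) rfl (fun p => by
      rw [← T2.leafEquiv_subst, Fill.top_apply]; rfl) rfl
    (r := q₁) (r' := q') (hq₁.trans h)
  refine ⟨h₁.1.trans (collapse_congr d act _ rfl rfl h₂.1), fun i => ?_⟩
  obtain ⟨p, rfl⟩ := (P.subst d (Fill.bot P c r)).leafEquiv.surjective i
  have key : ∀ (j) (hj : P.leafEquiv (substLeafEquiv d P.1 _ p) = j) (o₁ : I)
      (ho₁ : leaf _ (lower _ _ q₁) p = o₁)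
      (z : Filling K' ((c j).subst d (Fill.top P c r j)) o₁), HEq (upper _ _ q₁ p) z →
      HEq (top P c (collapse d act _ r q) j) (collapse d act _ (Fill.top P c r j) z) := by
    rintro _ rfl _ rfl z hz
    refine (top_heq _ _ _ _).trans ((h₁.2 p).trans ?_)
    exact collapse_congr d act _ (Fill.top_apply P c r _).symm rfl hz
  exact key _ (T2.leafEquiv_subst d P _ p) _
    (leaf_symm (P := P.subst d (Fill.bot P c r)) rfl h₂.1.symm p).symm _ (h₂.2 p)

theorem collapse_collapse {W : ℕ → Type v₁} {K'' : ∀ n, W n → (Fin n → I) → I → Type v}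
    {B : ∀ n, Z n → Type u₂} {R : ∀ n, X n → Type v₂}
    (d : ∀ n x, A n x → T2 Z n) (op : ∀ n x (a : A n x), Fill B (d n x a).1 → R n x)
    (d' : ∀ n x, B n x → T2 W n) (d'' : ∀ n x, R n x → T2 W n)
    (h : ∀ n x a r, d'' n x (op n x a r) = (d n x a).subst d' r)
    (act : ∀ n x (β : A n x) (a : I) (r : Filling K' (d n x β).1 a),
      K n x (fun i => leaf _ r ((d n x β).leafEquiv.symm i)) a)
    (act' : ∀ n x (β : B n x) (a : I) (r : Filling K'' (d' n x β).1 a),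
      K' n x (fun i => leaf _ r ((d' n x β).leafEquiv.symm i)) a)
    (act'' : ∀ n x (β : R n x) (a : I) (r : Filling K'' (d'' n x β).1 a),
      K n x (fun i => leaf _ r ((d'' n x β).leafEquiv.symm i)) a)
    (h' : ∀ n x a r o (q : Filling K'' (d'' n x (op n x a r)).1 o)
      (q' : Filling K'' ((d n x a).subst d' r).1 o), HEq q q' →
      HEq (act'' n x (op n x a r) o q) (act n x a o (collapse d' act' _ r q'))) :
    (t : Pasting X) → (s : Fill A t) → (r : Fill B (t.subst d s)) → {o o' : I} → o = o' →
    (q : Filling K'' (t.subst d'' (Fill.blocks d op t s r)) o) →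
    (q' : Filling K'' ((t.subst d s).subst d' r) o') → HEq q q' →
    HEq (collapse d'' act'' t (Fill.blocks d op t s r) q)
      (collapse d act t s (collapse d' act' _ r q'))
  | unit, _, _, _, _, ho, _, _, _ => by
    subst ho
    rfl
  | node (n := n) x t, s, r, o, _, ho, q, q', hq => by
    subst ho
    have hp := subst_plug d' (d _ x s.1) (fun i => (t i).subst d (s.2 i)) r
    obtain ⟨q₁, hq₁⟩ : ∃ q₁, HEq q₁ q' :=
      ⟨cast (congrArg (fun z => Filling K'' z o) hp) q', cast_heq _ _⟩
    have h₁ := collapse_plug d' act' (d _ x s.1) (fun i => (t i).subst d (s.2 i)) r rfl q'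
      q₁ hq₁.symm
    have h₂ := heq_plug (h _ x s.1 (Fill.bot (d _ x s.1) _ r)) (fun l => by
        exact subst_blocks d op d' d'' h (t _) (s.2 _) (Fill.top (d _ x s.1) _ r _)) rfl
      (r := q) (r' := q₁) (hq.trans hq₁.symm)
    have k₁ := leaf_heq (h _ x s.1 (Fill.bot (d _ x s.1) _ r)) rfl h₂.1
    have k₂ : ∀ i, leaf _ (bot ((d _ x s.1).subst d' (Fill.bot (d _ x s.1) _ r)) _ q₁)
        (((d _ x s.1).subst d' (Fill.bot (d _ x s.1) _ r)).leafEquiv.symm i) =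
        leaf _ (bot (d _ x s.1) _ (collapse d' act' _ r q')) ((d _ x s.1).leafEquiv.symm i) := by
      intro i
      obtain ⟨p, rfl⟩ := ((d _ x s.1).subst d' (Fill.bot (d _ x s.1) _ r)).leafEquiv.surjective i
      rw [Equiv.symm_apply_apply, ← T2.leafEquiv_subst]
      exact ((leaf_symm rfl h₁.1 _).trans (leaf_collapse d' act' _ _ _ p)).symm
    refine mk_heq (fun _ => rfl) rfl (funext fun i => (k₁ i).trans (k₂ i)) ?_ fun i => ?_
    · refine (h' _ x s.1 _ _ _ _ h₂.1).trans ?_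
      exact act_congr (act _ x s.1) rfl h₁.1.symm
    · refine HEq.trans ?_ (collapse_congr d act _ rfl ?_ (h₁.2 i).symm)
      · refine collapse_collapse d op d' d'' h act act' act'' h' (t i) (s.2 i) _ ?_ _ _ ?_
        · exact k₁ i
        · obtain ⟨l, rfl⟩ := (d'' _ x (op _ x s.1 (Fill.bot (d _ x s.1) _ r))).leafEquiv.surjective i
          exact (top_heq _ _ _ _).trans (h₂.2 l)
      · exact k₂ i

theorem collapse_ofLabels_left {K' : ∀ n, X n → (Fin n → I) → I → Type v}
    (d : ∀ n x, A n x → T2 X n) (f : ∀ n x, A n x)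
    (h : ∀ n x, d n x (f n x) = T2.pure x)
    (act : ∀ n x (β : A n x) (a : I) (r : Filling K' (d n x β).1 a),
      K' n x (fun i => leaf _ r ((d n x β).leafEquiv.symm i)) a)
    (h' : ∀ n x o (r : Filling K' (d n x (f n x)).1 o) (r' : Filling K' (T2.pure x).1 o),
      HEq r r' → HEq (act n x (f n x) o r) r'.2.1) : (t : Pasting X) → {o o' : I} → o = o' →
    (r : Filling K' (t.subst d (Fill.ofLabels f t)) o) → (r' : Filling K' t o') → HEq r r' →
    HEq (collapse d act t (Fill.ofLabels f t) r) r'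
  | unit, _, _, ho, _, _, _ => by
    subst ho
    rfl
  | node (n := n) x t, o, _, ho, r, r', hr => by
    subst ho
    have hp : ((d _ x (f _ x)).plug fun i => (t i).subst d (Fill.ofLabels f (t i))) =
      (T2.pure x).plug fun i => (t i).subst d (Fill.ofLabels f (t i)) := by rw [h]
    obtain ⟨q, hq⟩ : ∃ q : Filling K' ((T2.pure x).plug
        fun i => (t i).subst d (Fill.ofLabels f (t i))) o,
      HEq q r := ⟨cast (congrArg (fun z => Filling K' z o) hp) r, cast_heq _ _⟩
    have h₁ := heq_plug (h _ x) (fun _ => rfl) rfl (r := r) (r' := q) hq.symm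
    have h₂ := heq_pure_plug x (fun i => subst_pure d f h (t i)) rfl (r := q) (r' := r')
      (hq.trans hr)
    have k₁ := leaf_heq (h _ x) rfl h₁.1
    have k₂ : ∀ i, leaf (T2.pure x).1 (bot (T2.pure x) _ q) ((T2.pure x).leafEquiv.symm i) =
        r'.1 i := by
      intro i
      rw [T2.leafEquiv_symm_pure]
      exact congrFun h₂.1 i
    refine mk_heq (fun _ => rfl) rfl (funext fun i => (k₁ i).trans (k₂ i))
      ((h' _ x _ _ _ h₁.1).trans h₂.2.1) fun i => ?_
    refine collapse_ofLabels_left d f h act h' (t i) ((k₁ i).trans (k₂ i)) _ _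
      (HEq.trans ?_ (h₂.2.2 i))
    obtain ⟨l, rfl⟩ := (d _ x (f _ x)).leafEquiv.surjective i
    exact (top_heq _ _ _ _).trans (h₁.2 l)

theorem lower_unit : (t : Pasting X) → {a : I} → (r : Filling K (t.graft fun _ => unit) a) →
    HEq (lower t _ r) r
  | unit, _, _ => HEq.rfl
  | node _ t, _, r => mk_heq (fun i => (graft_unit (t i)).symm) rfl rfl HEq.rfl fun i =>
      lower_unit (t i) (r.2.2 i)

end

end Filling

end Relax

namespace Relax

open Pasting

namespace Multicategory

variable (D : Multicategory.{u, v})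

/-- For a functor `F : |D| ⥤ |D|`, the sets `D.Hom b (F.obj a)`. They form a profunctor from
`|D|ⁿ` to `|D|`. -/
abbrev hat (n : ℕ) (F : D.Under ⥤ D.Under) (b : Fin n → D.Obj) (a : D.Obj) : Type v :=
  D.Hom b (F.obj a)

variable {D}

/-- `Compat t g x x' h` says that unary arrows from the labels of the edges in `x` to the labels of
the edges in `x'` can be chosen, with `g` for the root and `h l` for each leaf `l`, such that the
square commutes for each node: if `f` and `f'` are the arrows of `D` for a node in `x` and `x'`,
which is labelled by `F`, then the composite of `f` and of `F.map` of the chosen arrow for the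
output edge is the composite of the chosen arrows for the input edges and of `f'`. -/
def Compat : (t : Pasting fun _ => D.Under ⥤ D.Under) → {a a' : D.Under} → (a ⟶ a') →
    Filling D.hat t a → Filling D.hat t a' → (Leaf t → Arrow D.Under) → Prop
  | unit, _, _, g, _, _, h => h () = Arrow.mk g
  | node F t, _, _, g, x, x', h => ∃ gs : ∀ i, (x.1 i : D.Under) ⟶ x'.1 i,
      post (F.map g) x.2.1 = pre x'.2.1 gs ∧
      ∀ i, Compat (t i) (gs i) (x.2.2 i) (x'.2.2 i) fun l => h ⟨i, l⟩

/-- The arrows from `θ` to `F` in the `T2`-multicategory `[D, D]`: families of functions which send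
arrows of `D`, one for each node of `θ`, to an arrow from the labels of the leaves to the image
under `F` of the label of the root, and which are compatible with the composition with unary arrows
at all edges. -/
@[ext]
structure EndoHom {n : ℕ} (θ : T2 (fun _ => D.Under ⥤ D.Under) n) (F : D.Under ⥤ D.Under) where
  /-- the functions -/
  app : ∀ (a : D.Obj) (x : Filling D.hat θ.tree a),
    D.Hom (fun j => Filling.leaf θ.tree x (θ.leafEquiv.symm j)) (F.obj a)
  natural : ∀ {a a' : D.Under} (g : a ⟶ a') (x : Filling D.hat θ.tree a)
    (x' : Filling D.hat θ.tree a')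
    (h : ∀ l, (Filling.leaf θ.tree x l : D.Under) ⟶ Filling.leaf θ.tree x' l),
    Compat θ.tree g x x' (fun l => Arrow.mk (h l)) →
    post (F.map g) (app a x) = pre (app a' x') fun j => h (θ.leafEquiv.symm j)

theorem heq_cast {n : ℕ} {as bs : Fin n → D.Obj} {a : D.Obj} (h : ∀ l, as l = bs l)
    (f : D.Hom as a) : HEq (D.cast rfl h f) f := by
  obtain rfl : as = bs := funext h
  rfl

theorem post_cast {n : ℕ} {as bs : Fin n → D.Obj} {a a' : D.Under} (h : ∀ l, as l = bs l)
    (f : D.Hom as a) (g : a ⟶ a') :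
    post g (D.cast rfl h f) = D.cast rfl h (post g f) := by
  obtain rfl : as = bs := funext h
  rfl

theorem pre_cast {n : ℕ} {as as' bs bs' : Fin n → D.Under} {a : D.Obj}
    (h : ∀ l, bs l = bs' l) (h' : ∀ l, as l = as' l)
    (f : D.Hom bs a) (g : ∀ i, as i ⟶ bs i) (g' : ∀ i, as' i ⟶ bs' i)
    (hg : ∀ i, Arrow.mk (g i) = Arrow.mk (g' i)) :
    pre (D.cast rfl h f) g' = D.cast rfl h' (pre f g) := by
  obtain rfl : bs = bs' := funext h
  obtain rfl : as = as' := funext h'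
  obtain rfl : g = g' := funext fun i => (Arrow.mk_inj _ _).1 (hg i)
  rfl

/-- The identity of a functor `F` in `[D, D]`. -/
def EndoHom.id (n : ℕ) (F : D.Under ⥤ D.Under) :
    EndoHom (D := D) (T2.pure (X := fun _ => D.Under ⥤ D.Under) (n := n) F) F where
  app a x := D.cast rfl (fun l => by rw [T2.leafEquiv_symm_pure]; rfl) x.2.1
  natural := by
    rintro a a' g x x' h ⟨gs, h₁, h₂⟩
    rw [post_cast, h₁]
    refine (pre_cast _ _ _ _ _ fun i => ?_).symm
    rw [T2.leafEquiv_symm_pure]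
    exact (h₂ i).symm

/-- The arrows to `F` in `[D, D]`. -/
abbrev EndoArr (D : Multicategory.{u, v}) (n : ℕ) (F : D.Under ⥤ D.Under) : Type (max u v) :=
  Σ P : T2 (fun _ => D.Under ⥤ D.Under) n, EndoHom P F

/-- Given an arrow of `[D, D]` into each node of `t`, arrows of `D` for the nodes of the domains
of these arrows yield arrows of `D` for the nodes of `t`. -/
def collapse (t : Pasting fun _ => D.Under ⥤ D.Under) (Θ : Fill D.EndoArr t) {a : D.Obj}
    (x : Filling D.hat (t.subst (fun _ _ β => β.1) Θ) a) : Filling D.hat t a :=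
  Filling.collapse (fun _ _ (β : D.EndoArr _ _) => β.1) (fun _ _ β a r => β.2.app a r) t Θ x

theorem compat_graft : (t : Pasting fun _ => D.Under ⥤ D.Under) →
    (c : Leaf t → Pasting fun _ => D.Under ⥤ D.Under) → {a a' : D.Under} → (g : a ⟶ a') →
    (x : Filling D.hat (t.graft c) a) → (x' : Filling D.hat (t.graft c) a') →
    (h : Leaf (t.graft c) → Arrow D.Under) → Compat _ g x x' h →
    ∃ k : ∀ l, (Filling.leaf t (Filling.lower t c x) l : D.Under) ⟶
        Filling.leaf t (Filling.lower t c x') l,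
      Compat t g (Filling.lower t c x) (Filling.lower t c x') (fun l => Arrow.mk (k l)) ∧
      ∀ l, Compat (c l) (k l) (Filling.upper t c x l) (Filling.upper t c x' l)
        fun q => h ((graftLeafEquiv t c).symm ⟨l, q⟩)
  | unit, _, _, _, g, _, _, _, H => ⟨fun _ => g, rfl, fun _ => H⟩
  | node F t, c, _, _, g, x, x', h, ⟨gs, h₁, h₂⟩ => by
    have ih := fun i => compat_graft (t i) (fun l => c ⟨i, l⟩) (gs i) _ _ _ (h₂ i)
    choose k hk hk' using ih
    exact ⟨fun l => k l.1 l.2, ⟨gs, h₁, hk⟩, fun l => hk' l.1 l.2⟩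

theorem compat_collapse : (t : Pasting fun _ => D.Under ⥤ D.Under) → (Θ : Fill D.EndoArr t) →
    {a a' : D.Under} → (g : a ⟶ a') → (x : Filling D.hat (t.subst (fun _ _ β => β.1) Θ) a) →
    (x' : Filling D.hat (t.subst (fun _ _ β => β.1) Θ) a') → (h : Leaf t → Arrow D.Under) →
    Compat _ g x x' (fun p => h (substLeafEquiv _ _ _ p)) →
    Compat t g (collapse t Θ x) (collapse t Θ x') h
  | unit, _, _, _, _, _, _, _, H => H
  | node F t, Θ, a, a', g, x, x', h, H => by
    obtain ⟨k, hk, hk'⟩ := compat_graft Θ.1.1.1 _ g x x' _ H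
    refine ⟨fun i => k (Θ.1.1.leafEquiv.symm i), Θ.1.2.natural g _ _ k hk, fun i => ?_⟩
    refine compat_collapse (t i) (Θ.2 i) _ _ _ _ ?_
    refine reindex_ind Θ.1.1.leafEquiv (M := fun i l z z' =>
      Compat (subst (fun _ _ (β : D.EndoArr _ _) => β.1) (t i) (Θ.2 i)) (k l) z z'
        (fun p => h ⟨i, substLeafEquiv _ _ _ p⟩)) _ _ (fun l => ?_) i
    refine Eq.mp (congrArg (Compat _ _ _ _) (funext fun q => ?_)) (hk' l)
    have : ∀ z (lq : Σ l, Leaf (subst (fun _ _ (β : D.EndoArr _ _) => β.1)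
        (t (Θ.1.1.leafEquiv l)) (Θ.2 (Θ.1.1.leafEquiv l)))), graftLeafEquiv Θ.1.1.1 _ z = lq →
        h (substLeafEquiv (fun _ _ (β : D.EndoArr _ _) => β.1) (node F t) Θ z) =
          h ⟨Θ.1.1.leafEquiv lq.1, substLeafEquiv _ _ _ lq.2⟩ := by
      rintro z _ rfl
      rfl
    exact this _ ⟨l, q⟩ (Equiv.apply_symm_apply _ _)

theorem exists_arrow {a b a' b' : D.Under} (ha : a = a') (hb : b = b') (f : a ⟶ b) :
    ∃ k : a' ⟶ b', Arrow.mk k = Arrow.mk f := by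
  subst ha
  subst hb
  exact ⟨f, rfl⟩

theorem leaf_comp {n : ℕ} (θ : T2 (fun _ => D.Under ⥤ D.Under) n) (Θ : Fill D.EndoArr θ.tree)
    {a : D.Obj} (x : Filling D.hat (θ.subst (fun _ _ (β : D.EndoArr _ _) => β.1) Θ).tree a) (j : Fin n) :
    Filling.leaf θ.tree (collapse θ.tree Θ x) (θ.leafEquiv.symm j) =
      Filling.leaf _ x
        ((θ.subst (fun _ _ (β : D.EndoArr _ _) => β.1) Θ).leafEquiv.symm j) := by
  obtain ⟨p, rfl⟩ := (θ.subst (fun _ _ (β : D.EndoArr _ _) => β.1) Θ).leafEquiv.surjective j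
  rw [← T2.leafEquiv_subst, Equiv.symm_apply_apply]
  refine (Filling.leaf_collapse _ _ _ _ _ p).trans (congrArg _ ?_)
  exact ((Equiv.symm_apply_eq _).2 (T2.leafEquiv_subst _ _ _ _)).symm

/-- The composition in `[D, D]`. -/
def EndoHom.comp {n : ℕ} {θ : T2 (fun _ => D.Under ⥤ D.Under) n} {F : D.Under ⥤ D.Under}
    (α : EndoHom θ F) (Θ : Fill D.EndoArr θ.tree) :
    EndoHom (θ.subst (fun _ _ β => β.1) Θ) F where
  app a x := D.cast rfl (leaf_comp θ Θ x) (α.app a (collapse θ.tree Θ x))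
  natural := by
    intro a a' g x x' h H
    have : ∀ l, ∃ k : (Filling.leaf θ.tree (collapse θ.tree Θ x) l : D.Under) ⟶
        Filling.leaf θ.tree (collapse θ.tree Θ x') l,
        ∀ p, substLeafEquiv _ _ _ p = l → Arrow.mk k = Arrow.mk (h p) := by
      intro l
      obtain ⟨p, rfl⟩ := (substLeafEquiv (fun _ _ (β : D.EndoArr _ _) => β.1) θ.tree Θ).surjective l
      obtain ⟨k, hk⟩ := exists_arrow (Filling.leaf_collapse _ _ _ _ _ p).symm
        (Filling.leaf_collapse _ _ _ _ _ p).symm (h p)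
      refine ⟨k, fun p' hp => ?_⟩
      obtain rfl := (substLeafEquiv (fun _ _ (β : D.EndoArr _ _) => β.1) θ.tree Θ).injective hp
      exact hk
    choose k hk using this
    have key := α.natural g (collapse θ.tree Θ x) (collapse θ.tree Θ x') k
      (compat_collapse θ.tree Θ g x x' _ (by
        refine Eq.mp (congrArg (Compat _ _ _ _) (funext fun p => ?_)) H
        exact (hk _ p rfl).symm))
    rw [post_cast, key]
    refine (pre_cast _ _ _ _ _ fun j => hk _ _ ?_).symm
    obtain ⟨p, rfl⟩ := (θ.subst (fun _ _ (β : D.EndoArr _ _) => β.1) Θ).leafEquiv.surjective j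
    rw [Equiv.symm_apply_apply, ← T2.leafEquiv_subst, Equiv.symm_apply_apply]

theorem id_app_heq (n : ℕ) (F : D.Under ⥤ D.Under) {a : D.Obj} (x) :
    HEq ((EndoHom.id n F).app a x) x.2.1 :=
  heq_cast (fun l => by rw [T2.leafEquiv_symm_pure]; rfl) _

theorem comp_app_heq {n : ℕ} {θ : T2 (fun _ => D.Under ⥤ D.Under) n} {F : D.Under ⥤ D.Under}
    (α : EndoHom θ F) (Θ : Fill D.EndoArr θ.tree) {a : D.Obj} (x) :
    HEq ((α.comp Θ).app a x) (α.app a (collapse θ.tree Θ x)) :=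
  heq_cast (leaf_comp θ Θ x) _

theorem sigma_ext {n : ℕ} {F : D.Under ⥤ D.Under} {θ θ' : T2 (fun _ => D.Under ⥤ D.Under) n}
    (h : θ = θ') {α : EndoHom θ F} {α' : EndoHom θ' F}
    (hα : ∀ a x x', HEq x x' → HEq (α.app a x) (α'.app a x')) :
    (⟨θ, α⟩ : D.EndoArr n F) = ⟨θ', α'⟩ := by
  subst h
  congr 1
  ext a x
  exact eq_of_heq (hα a x x HEq.rfl)

end Multicategory

open Multicategory

/-- The `T2`-multicategory `[D, D]`. The objects over each `n` are the functors `|D| ⥤ |D|`. -/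
def Endo (D : Multicategory.{u, v}) : T2Multicategory.{max u v, max u v} where
  Obj _ := D.Under ⥤ D.Under
  Hom := EndoHom
  id {n} F := EndoHom.id n F
  comp := EndoHom.comp
  id_comp := by
    intro n θ F α
    refine sigma_ext (T2.ext (graft_unit _)) fun a x x' hx => ?_
    refine (comp_app_heq _ _ _).trans ((id_app_heq _ _ _).trans ?_)
    exact Filling.act_congr (K := D.hat) (x := F) α.app rfl ((Filling.lower_unit _ _).trans hx)
  comp_id := by
    intro n θ F α
    refine sigma_ext (T2.ext (subst_pure (fun _ _ (β : D.EndoArr _ _) => β.1)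
      (fun n F => ⟨T2.pure F, EndoHom.id n F⟩) (fun _ _ => rfl) θ.tree)) fun a x x' hx => ?_
    refine (comp_app_heq _ _ _).trans ?_
    refine Filling.act_congr (K := D.hat) (x := F) α.app rfl ?_
    refine Filling.collapse_ofLabels_left (fun _ _ (β : D.EndoArr _ _) => β.1)
      (fun n F => ⟨T2.pure F, EndoHom.id n F⟩) (fun _ _ => rfl) (fun _ _ β a r => β.2.app a r)
      (fun n F o r r' h => ?_) θ.tree rfl _ _ hx
    cases h
    exact id_app_heq _ _ _
  assoc := by
    intro n θ F α Θ Ξ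
    have h := T2.subst_subst (fun _ _ (β : D.EndoArr _ _) => β.1)
      (fun _ _ β ξ => (⟨_, EndoHom.comp β.2 ξ⟩ : D.EndoArr _ _)) _ (fun _ _ β => β.1)
      (fun _ _ _ _ => rfl) θ Θ Ξ
    refine sigma_ext h fun a x x' hx => ?_
    refine (comp_app_heq _ _ _).trans ((comp_app_heq _ _ _).trans
      (HEq.trans ?_ (comp_app_heq _ _ _).symm))
    refine Filling.act_congr (K := D.hat) (x := F) α.app rfl ?_
    refine (Filling.collapse_collapse (fun _ _ (β : D.EndoArr _ _) => β.1)
      (fun _ _ β ξ => (⟨_, EndoHom.comp β.2 ξ⟩ : D.EndoArr _ _)) _ (fun _ _ β => β.1)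
      (fun _ _ _ _ => rfl) (K := D.hat) (K' := D.hat) (K'' := D.hat)
      (fun _ _ β a r => β.2.app a r) (fun _ _ β a r => β.2.app a r)
      (fun _ _ β a r => β.2.app a r) (fun n F β r o q q' hq => ?_) θ.tree Θ Ξ rfl _ _ hx.symm).symm
    cases hq
    exact comp_app_heq _ _ _

end Relax

namespace Relax

open Pasting

/-! ### Relaxed multicategories -/

namespace TR

variable {n : ℕ} {k : Fin n → ℕ}

/-- The tree `τ ∘ (τ 0, …, τ (n - 1))` obtained by grafting the tree `τs i` on the `i`-th leaf of
the tree `τ`, for each `i`. -/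
abbrev comp (τ : TR n) (τs : ∀ i, TR (k i)) : TR (∑ i, k i) := T2.graft τ τs

/-- The map `φ ∘ (φ 0, …, φ (n - 1))` of trees. -/
def compMap {τ' τ : TR n} (φ : τ' ⟶ τ) {τs' τs : ∀ i, TR (k i)} (φs : ∀ i, τs' i ⟶ τs i) :
    comp τ' τs' ⟶ comp τ τs :=
  ⟨Fill.plug τ (fun i => (τs i).1) φ.1 fun i => (φs i).1, T2.ext (by
    have h₁ := Fill.bot_graft τ (fun i => (τs i).1) φ.1 fun i => (φs i).1
    have h₂ := Fill.top_graft τ (fun i => (τs i).1) φ.1 fun i => (φs i).1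
    refine (subst_plug (fun _ _ (σ : TR _) => σ) τ (fun i => (τs i).1)
      (Fill.plug τ (fun i => (τs i).1) φ.1 fun i => (φs i).1)).trans
      (plug_congr (P' := τ') (c' := fun i => (τs' i).1) ((congrArg _ h₁).trans φ.2) fun l => ?_)
    exact (congrArg (subst _ _) (h₂ _)).trans (congrArg T2.tree (φs _).2))⟩

/-- The pasting of a tree `τ` and of a tree `τs i` on each of its leaves. -/
def twoLevel (τ : TR n) (τs : ∀ i, TR (k i)) : T2 TR (∑ i, k i) :=
  ⟨node τ fun i => node (τs i) fun _ => Pasting.unit, by simp [leaves]⟩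

theorem join_twoLevel (τ : TR n) (τs : ∀ i, TR (k i)) : (twoLevel τ τs).join = comp τ τs :=
  T2.ext (plug_congr (P := τ) (c' := fun i => (τs i).1) rfl fun _ => graft_unit _)

theorem join_unit : (T2.unit : T2 TR 1).join = T2.unit := rfl

end TR

/-- The structure of a relaxed multicategory with a set `Obj` of objects and with the sets
`Hom τ as a` of arrows, for each `n`-leafed tree `τ` and for all `as 0, …, as (n - 1)` and `a` in
`Obj`. -/
structure RelaxedMulticategory (Obj : Type u)
    (Hom : ∀ {n : ℕ}, TR n → (Fin n → Obj) → Obj → Type v) where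
  /-- `restrict f φ` is the arrow `f.φ` -/
  restrict {n : ℕ} {τ' τ : TR n} {as : Fin n → Obj} {a : Obj} (f : Hom τ as a) (φ : τ' ⟶ τ) :
    Hom τ' as a
  /-- `comp f fs` is the composite `f ∘ (fs 0, …, fs (n - 1))` -/
  comp {n : ℕ} {k : Fin n → ℕ} {τ : TR n} {τs : ∀ i, TR (k i)} {as : ∀ i, Fin (k i) → Obj}
    {b : Fin n → Obj} {a : Obj} (f : Hom τ b a) (fs : ∀ i, Hom (τs i) (as i) (b i)) :
    Hom (TR.comp τ τs) (concat as) a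
  /-- identities -/
  id (a : Obj) : Hom (T2.unit : TR 1) (fun _ => a) a
  restrict_id {n : ℕ} {τ : TR n} {as : Fin n → Obj} {a : Obj} (f : Hom τ as a) :
    restrict f (𝟙 τ) = f
  restrict_comp {n : ℕ} {τ'' τ' τ : TR n} {as : Fin n → Obj} {a : Obj} (f : Hom τ as a)
    (φ : τ' ⟶ τ) (φ' : τ'' ⟶ τ') : restrict f (φ' ≫ φ) = restrict (restrict f φ) φ'
  id_comp {n : ℕ} {τ : TR n} {as : Fin n → Obj} {a : Obj} (f : Hom τ as a) :
    (⟨_, _, _, comp (id a) (fun _ => f)⟩ :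
      Σ n : ℕ, Σ τ : TR n, Σ as : Fin n → Obj, Hom τ as a) = ⟨_, _, _, f⟩
  comp_id {n : ℕ} {τ : TR n} {as : Fin n → Obj} {a : Obj} (f : Hom τ as a) :
    (⟨_, _, _, comp f (fun i => id (as i))⟩ :
      Σ n : ℕ, Σ τ : TR n, Σ as : Fin n → Obj, Hom τ as a) = ⟨_, _, _, f⟩
  assoc {n : ℕ} {k : Fin n → ℕ} {m : ∀ i, Fin (k i) → ℕ} {τ : TR n} {τs : ∀ i, TR (k i)}
    {σs : ∀ i j, TR (m i j)} {cs : ∀ i j, Fin (m i j) → Obj} {bs : ∀ i, Fin (k i) → Obj}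
    {as : Fin n → Obj} {a : Obj} (f : Hom τ as a) (g : ∀ i, Hom (τs i) (bs i) (as i))
    (h : ∀ i j, Hom (σs i j) (cs i j) (bs i j)) :
    (⟨_, _, _, comp (comp f g)
      (fun l => h (finSigmaFinEquiv.symm l).1 (finSigmaFinEquiv.symm l).2)⟩ :
        Σ n : ℕ, Σ τ : TR n, Σ as : Fin n → Obj, Hom τ as a) =
    ⟨_, _, _, comp f (fun i => comp (g i) (h i))⟩
  comp_restrict {n : ℕ} {k : Fin n → ℕ} {τ' τ : TR n} {τs' τs : ∀ i, TR (k i)}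
    {as : ∀ i, Fin (k i) → Obj} {b : Fin n → Obj} {a : Obj} (f : Hom τ b a)
    (fs : ∀ i, Hom (τs i) (as i) (b i)) (φ : τ' ⟶ τ) (φs : ∀ i, τs' i ⟶ τs i) :
    restrict (comp f fs) (TR.compMap φ φs) = comp (restrict f φ) (fun i => restrict (fs i) (φs i))

/-! ### Maps from the opposite of the `T2`-structured category of trees to `[D, D]` -/

/-- The maps of `T2`-multicategories from the opposite of the `T2`-structured category of trees to
`[D, D]`. -/
abbrev EndoMap (D : Multicategory.{u, v}) : Type (max u v) := T2Multicategory.Map TRop (Endo D)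

namespace EndoMap

variable {D : Multicategory.{u, v}} (Q : EndoMap D) {n : ℕ}

/-- The functor `Q_τ`. -/
def obj (τ : TR n) : D.Under ⥤ D.Under := T2Multicategory.Map.obj Q n τ

/-- The image under `Q` of the arrow from `θ` to `τ` which is given by a map of trees from `τ` to
the composite of `θ`. -/
def hom {θ : T2 TR n} {τ : TR n} (α : τ ⟶ θ.join) :
    Multicategory.EndoHom (D := D) (θ.map (Y := fun _ => D.Under ⥤ D.Under) fun _ => Q.obj) (Q.obj τ) :=
  T2Multicategory.Map.hom Q (show TRop.Hom θ τ from α)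

/-- The effect on arrows of `D` of the natural transformation `Q_τ ⟶ Q_τ'` which is induced by a
map of trees `τ' ⟶ τ`. -/
def restrict {τ' τ : TR n} (φ : τ' ⟶ τ) {as : Fin n → D.Obj} {a : D.Obj}
    (f : D.Hom as ((Q.obj τ).obj a)) : ArrowsTo D.Hom ((Q.obj τ').obj a) :=
  Multicategory.arrow ((Q.hom (θ := T2.pure τ) (φ ≫ eqToHom (TR.join_pure τ).symm)).app a
    ⟨as, f, fun _ => PUnit.unit⟩)

/-- The effect on arrows of `D` of the image under `Q` of the canonical arrow from the pasting of
`τ` and the trees `τs i` to `τ ∘ (τs 0, …, τs (n - 1))`. -/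
def comp {k : Fin n → ℕ} {τ : TR n} {τs : ∀ i, TR (k i)} {as : ∀ i, Fin (k i) → D.Obj}
    {b : Fin n → D.Obj} {a : D.Obj} (f : D.Hom b ((Q.obj τ).obj a))
    (fs : ∀ i, D.Hom (as i) ((Q.obj (τs i)).obj (b i))) :
    ArrowsTo D.Hom ((Q.obj (TR.comp τ τs)).obj a) :=
  Multicategory.arrow ((Q.hom (eqToHom (TR.join_twoLevel τ τs).symm)).app a
    ⟨b, f, fun i => ⟨as i, fs i, fun _ => PUnit.unit⟩⟩)

/-- The image under `Q` of the canonical arrow from the empty pasting to the tree with no node, at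
an object `a`. -/
def id (a : D.Obj) : ArrowsTo D.Hom ((Q.obj (T2.unit : TR 1)).obj a) :=
  Multicategory.arrow ((Q.hom (eqToHom TR.join_unit.symm)).app a PUnit.unit)

end EndoMap

end Relax

namespace Relax

open Pasting

/-! ### Evaluating composites in `[D, D]` -/

namespace Multicategory

variable {D : Multicategory.{u, v}}

/-! The map `Q` turns an arrow `θ ⟶ τ` of `TRop` into an operation: it takes arrows of `D` placed at
the nodes of the pasting `θ` and returns an arrow of `D` into `Q_τ a`. Since `Q` preserves
composition, evaluating `Q` at a composite arrow amounts to evaluating first the images of the inner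
arrows, node by node, and then the image of the outer arrow (`val_comp`, where `collapse` is the
node by node evaluation). Restriction, composition and identities of the relaxed multicategory are
all operations of this kind, so each side of each axiom is the value of `Q` at some composite in
`TRop`, and both sides use the same arrows of `D` on the same pasting. Every axiom thus becomes an
equation between two arrows of `TRop`.

Unit and associativity laws: only arrows given by identity maps of trees occur, and composites of
such arrows are again of this form (`TR.opComp_eqToHom`). Such an arrow is determined by its domain,
because its codomain has to be the tree obtained from the domain by substitution. Hence it suffices
that the two composites have the same domain, namely the one-node pasting of `τ` for the unit laws
and a three-level pasting for associativity; `val_strict` then gives equal values.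

Functoriality of restriction: an arrow with a one-node domain is a map of trees, and composing over
a one-node pasting is composing maps of trees (`TR.opComp_pure_val`).

Compatibility of restriction with composition: both composites go from the two-level pasting of `τ`
and the `τs i` to `τ' ∘ (τs' 0, …, τs' (n - 1))`. Each is given by the filling of the grafted tree
that uses `φ` at the nodes of `τ` and `φs i` at the nodes of `τs i`, which is how `TR.compMap` is
defined.

What remains is bookkeeping. Grafting bare edges, or numbering leaves and looking them up again,
changes trees and sequences of objects only up to propositional equality. Fillings are therefore
compared by `HEq`, and arrows are compared together with their arity, tree and domain, in `Total`.
-/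

theorem arrow_of_heq {n : ℕ} {as bs : Fin n → D.Obj} {a : D.Obj} (h : ∀ l, as l = bs l)
    {f : D.Hom as a} {g : D.Hom bs a} (hfg : HEq f g) : arrow f = arrow g := by
  obtain rfl : as = bs := funext h
  cases hfg
  rfl

/-- The axioms for maps of `T2`-multicategories equate arrows of `[D, D]` paired with their domains.
This turns such an equation into one between arrows of `D`. -/
theorem arrow_app_congr {n : ℕ} {F : D.Under ⥤ D.Under} {β β' : D.EndoArr n F} (h : β = β')
    {a : D.Obj} {x : Filling D.hat β.1.tree a} {x' : Filling D.hat β'.1.tree a} (hx : HEq x x') :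
    arrow (β.2.app a x) = arrow (β'.2.app a x') := by
  subst h
  cases hx
  rfl

/-- A uniform way to replace the label of the root edge by a propositionally equal one. In
`collapse_node` the upper fillings start at a computed leaf label, while the expected values are
stated for the prescribed label. -/
theorem heq_collapse (t : Pasting fun _ => D.Under ⥤ D.Under) (Θ : Fill D.EndoArr t) {o o' : D.Obj}
    (ho : o = o') {s : Pasting fun _ => D.Under ⥤ D.Under} {o'' : D.Obj}
    {x : Filling D.hat s o''} {z : Filling D.hat (t.subst (fun _ _ β => β.1) Θ) o} (hz : HEq x z)
    {y : Filling D.hat t o'}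
    (h : ∀ z : Filling D.hat (t.subst (fun _ _ (β : D.EndoArr _ _) => β.1) Θ) o', HEq x z →
      collapse t Θ z = y) :
    HEq (collapse t Θ z) y := by
  subst ho
  exact heq_of_eq (h z hz)

/-- A criterion for the value of `collapse` at a tree with a node at the root. -/
theorem collapse_node {n : ℕ} {F : D.Under ⥤ D.Under}
    {t : Fin n → Pasting fun _ => D.Under ⥤ D.Under} (Θ : Fill D.EndoArr (node F t))
    {c : Leaf Θ.1.1.1 → Pasting fun _ => D.Under ⥤ D.Under}
    (hc : ∀ l, c l = subst (fun _ _ (β : D.EndoArr _ _) => β.1) (t (Θ.1.1.leafEquiv l))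
      (Θ.2 (Θ.1.1.leafEquiv l)))
    {a : D.Obj} (x : Filling D.hat (Θ.1.1.1.graft c) a)
    (x' : Filling D.hat ((node F t).subst (fun _ _ (β : D.EndoArr _ _) => β.1) Θ) a)
    (hx : HEq x x') (b : Fin n → D.Obj) (f : D.Hom b (F.obj a))
    (y : ∀ i, Filling D.hat (t i) (b i))
    (hf : arrow (Θ.1.2.app a (Filling.lower Θ.1.1.1 c x)) = arrow f)
    (hy : ∀ l (z : Filling D.hat (subst (fun _ _ (β : D.EndoArr _ _) => β.1)
        (t (Θ.1.1.leafEquiv l)) (Θ.2 (Θ.1.1.leafEquiv l)))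
        (b (Θ.1.1.leafEquiv l))), HEq (Filling.upper Θ.1.1.1 c x l) z →
      collapse (t _) (Θ.2 _) z = y (Θ.1.1.leafEquiv l)) :
    collapse (node F t) Θ x' = ⟨b, f, y⟩ := by
  -- The trees `c l` agree with the substituted trees only up to propositional equality. Splitting
  -- both fillings into a lower part and upper parts makes them comparable piece by piece.
  have h := Filling.heq_plug (P := Θ.1.1) rfl hc rfl hx
  -- The subfillings have comparable root labels only once the domains of the two arrows are
  -- identified, so their comparison may assume `b' = b`, which the equation of arrows supplies.
  have key : ∀ (b' : Fin n → D.Obj) (f' : D.Hom b' (F.obj a))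
      (y' : ∀ i, Filling D.hat (t i) (b' i)), arrow f' = arrow f →
      (b' = b → ∀ i, HEq (y' i) (y i)) →
      (⟨b', f', y'⟩ : Filling D.hat (node F t) a) = ⟨b, f, y⟩ := by
    intro b' f' y' hf hy
    obtain ⟨rfl, hf⟩ : b' = b ∧ HEq f' f := by simpa [arrow] using hf
    cases hf
    obtain rfl : y' = y := funext fun i => eq_of_heq (hy rfl i)
    rfl
  refine key _ _ _ ?_ fun hb i => ?_
  · refine Eq.trans (arrow_app_congr (β := Θ.1) rfl ?_) hf
    exact h.1.symm
  · obtain ⟨l, rfl⟩ := Θ.1.1.leafEquiv.surjective i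
    exact heq_collapse _ _ (congrFun hb _) (h.2 l) (hy l)

end Multicategory


/-! ### Composites in `TRop` of identity maps, and over one-node pastings -/

/-- The elements of a filling satisfy a predicate. -/
def Pasting.Fill.All {X : ℕ → Type u} {A : ∀ n, X n → Type v} (p : ∀ n x, A n x → Prop) :
    (t : Pasting X) → Fill A t → Prop
  | unit, _ => True
  | node _ t, s => p _ _ s.1 ∧ ∀ i, All p (t i) (s.2 i)

/-- Grafting fillings that come from one function on labels gives the filling of the grafted tree by
the same function. In contrast to `assemble_eq_ofLabels`, the condition concerns only the elements
that occur in `s`. For one-node trees as the values of `g`, this says that identity maps of trees,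
substituted in a pasting, form an identity map. -/
theorem Pasting.Fill.assemble_of_all {X : ℕ → Type u} {Z : ℕ → Type w} {A : ∀ n, X n → Type v}
    {B : ∀ n, Z n → Type u₂} (d : ∀ n x, A n x → T2 Z n) (β : ∀ n x a, Fill B (d n x a).1)
    (g : ∀ n x, B n x) : (t : Pasting X) → (s : Fill A t) →
    Fill.All (fun n x a => β n x a = ofLabels g _) t s → assemble d β t s = ofLabels g _
  | unit, _, _ => rfl
  | node x t, s, h => by
    refine Eq.trans ?_ (graft_ofLabels g (d _ x s.1).1 _)
    have : ∀ i, assemble d β (t i) (s.2 i) = ofLabels g _ :=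
      fun i => assemble_of_all d β g (t i) (s.2 i) (h.2 i)
    change Fill.plug (d _ x s.1) _ (β _ x s.1) (fun i => assemble d β _ (s.2 i)) = _
    rw [h.1]
    exact congrArg (Fill.graft (d _ x s.1).1 _ _) (funext fun l => this _)

namespace TR

variable {n : ℕ}

/-- A map of trees includes a proof that its domain is the expansion of its codomain by the filling,
so an identity filling forces the two trees to be equal. -/
theorem eq_eqToHom {τ' τ : TR n} {φ : τ' ⟶ τ} (h : φ.1 = τ.idFill) : ∃ e, φ = eqToHom e := by
  have e : τ' = τ := φ.2.symm.trans ((congrArg τ.expand h).trans τ.expand_idFill)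
  exact ⟨e, Hom.ext (h.trans (eqToHom_val e).symm)⟩

/-- A composite of arrows that are given by identity maps of trees is given by an identity map of
trees. -/
theorem opComp_eqToHom {θ : T2 TR n} {τ : TR n} {α : OpHom θ τ} (hα : ∃ e, α = eqToHom e)
    (Θ : Fill OpArr θ.tree) (hΘ : Fill.All (fun _ _ β => β.2.1 = idFill β.1.join) θ.tree Θ) :
    ∃ e, opComp α Θ = eqToHom e := by
  obtain ⟨e, rfl⟩ := hα
  -- Of the four factors of `opComp`, only the substituted map is not visibly an `eqToHom`;
  -- `assemble_of_all` shows that its filling is the identity filling.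
  obtain ⟨e', h⟩ := eq_eqToHom (φ := substMap (fun _ σ _ => σ) (fun _ _ β => β.1.join)
    (fun _ _ β => β.2) θ Θ) (Fill.assemble_of_all _ _ _ _ _ hΘ)
  refine ⟨e.trans ((join_eq θ Θ).trans (e'.trans (join_subst _ θ Θ))), ?_⟩
  rw [opComp, h]
  simp

/-- Over a one-node pasting, substitution only grafts bare edges on the leaves of the substituted
tree, so the composition of `TRop` reduces to that of the category of trees. The domains agree only
propositionally, hence the comparison of underlying fillings. -/
theorem opComp_pure_val {τ τ' : TR n} (α : OpHom (T2.pure τ) τ') (β : OpArr n τ) :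
    HEq (opComp α ((β, fun _ => PUnit.unit) : Fill OpArr (T2.pure τ).tree)).1
      (α ≫ eqToHom (join_pure τ) ≫ β.2).1 := by
  -- The assembled filling is that of `β.2` with empty fillings of bare edges grafted on it.
  have hv : HEq (substMap (fun _ σ _ => σ) (fun _ _ (β : OpArr _ _) => β.1.join)
      (fun _ _ β => β.2) (T2.pure τ) ((β, fun _ => PUnit.unit) : Fill OpArr (T2.pure τ).tree)).1
      β.2.1 := Fill.graft_unit β.1.join.tree β.2.1
  have h := eq_conj (T2.ext (graft_unit _)) (T2.ext (graft_unit _)) hv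
  have h' : opComp α ((β, fun _ => PUnit.unit) : Fill OpArr (T2.pure τ).tree) =
      (α ≫ eqToHom (join_pure τ) ≫ β.2) ≫
      eqToHom (congrArg T2.join (T2.ext (graft_unit β.1.tree))).symm := by
    refine Eq.trans (congrArg (fun z => α ≫ eqToHom _ ≫ z ≫ eqToHom _) h) ?_
    simp
  rw [h']
  exact comp_eqToHom_val _ _

/-- When the outer arrow is an identity map, every factor of `opComp` except the substituted map is
an `eqToHom`, and these do not affect the filling. -/
theorem opComp_eqToHom_val {θ : T2 TR n} {τ : TR n} (e : τ = θ.join) (Θ : Fill OpArr θ.tree) :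
    HEq (opComp (eqToHom e) Θ).1
      (Fill.assemble (fun _ _ β => β.1.join) (fun _ _ β => β.2.1) θ.tree Θ) :=
  conj_val _ _ _ _

end TR

/-! ### Numbering the leaves of a two-level pasting -/

/-- This is the numbering used by `concat`, which is why the domain of a composite in the relaxed
multicategory is a concatenation. The relabelling `f` allows for pastings of functors in place of
pastings of trees. -/
theorem leafEquiv_twoLevel {Y : ℕ → Type u} (f : ∀ n, TR n → Y n) {n : ℕ} {k : Fin n → ℕ}
    (τ : TR n) (τs : ∀ i, TR (k i)) (i : Fin n) (j : Fin (k i)) :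
    ((TR.twoLevel τ τs).map f).leafEquiv ⟨i, j, ()⟩ = finSigmaFinEquiv ⟨i, j⟩ := by
  have h₁ : ∀ i (j : Fin (k i)), ((finSigmaFinEquiv (n := fun _ : Fin (k i) => 1) ⟨j, 0⟩ : Fin _) : ℕ) = j := by
    intro i j
    simp [finSigmaFinEquiv_apply]
  apply Fin.ext
  -- By definition the position is computed by one sum over the lower node and one over each upper
  -- node. The inner one, over bare edges, is trivial by `h₁`.
  have : ((((TR.twoLevel τ τs).map f).leafEquiv ⟨i, j, ()⟩ : Fin _) : ℕ) =
    finSigmaFinEquiv (n := fun i => ∑ _j : Fin (k i), 1)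
      ⟨i, finSigmaFinEquiv (n := fun _ : Fin (k i) => 1) ⟨j, 0⟩⟩ := rfl
  rw [this, finSigmaFinEquiv_apply, h₁, finSigmaFinEquiv_apply]
  simp

theorem leafEquiv_symm_twoLevel {Y : ℕ → Type u} (f : ∀ n, TR n → Y n) {n : ℕ} {k : Fin n → ℕ}
    (τ : TR n) (τs : ∀ i, TR (k i)) (l : Fin (∑ i, k i)) :
    ((TR.twoLevel τ τs).map f).leafEquiv.symm l =
      ⟨(finSigmaFinEquiv.symm l).1, (finSigmaFinEquiv.symm l).2, ()⟩ :=
  (Equiv.symm_apply_eq _).2 ((leafEquiv_twoLevel f τ τs _ _).trans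
    (finSigmaFinEquiv.apply_symm_apply l)).symm

/-! ### Values of `Q` at arrows of `TRop` -/

namespace EndoMap

variable {D : Multicategory.{u, v}} (Q : EndoMap D)

/-- The arrows of the relaxed multicategory into `a`. -/
abbrev Total (a : D.Obj) : Type (max u v) :=
  Σ n : ℕ, Σ τ : TR n, Σ as : Fin n → D.Obj, D.Hom as ((Q.obj τ).obj a)

/-- The labels of the nodes, regarded as functors. -/
abbrev lab (t : Pasting TR) : Pasting fun _ => D.Under ⥤ D.Under := t.map fun _ => Q.obj

/-- The images under `Q` of the elements of a filling. -/
abbrev image (t : Pasting TR) (Θ : Fill TR.OpArr t) : Fill D.EndoArr (Q.lab t) :=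
  Fill.mapLabels (fun _ => Q.obj) (fun _ _ β => ⟨_, Q.hom β.2⟩) t Θ

/-- The value of the image under `Q` of an arrow, at a filling of its domain. -/
def val {n : ℕ} {θ : T2 TR n} {τ : TR n} (α : τ ⟶ θ.join) {a : D.Obj}
    (x : Filling D.hat (Q.lab θ.tree) a) : Q.Total a :=
  ⟨n, τ, _, (Q.hom α).app a x⟩

theorem total_ext {n : ℕ} {τ : TR n} {a : D.Obj} {as bs : Fin n → D.Obj}
    {f : D.Hom as ((Q.obj τ).obj a)} {g : D.Hom bs ((Q.obj τ).obj a)}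
    (h : Multicategory.arrow f = Multicategory.arrow g) :
    (⟨n, τ, as, f⟩ : Q.Total a) = ⟨n, τ, bs, g⟩ := by
  obtain ⟨rfl, h⟩ : as = bs ∧ HEq f g := by simpa [Multicategory.arrow] using h
  cases h
  rfl

theorem arrow_of_total {n : ℕ} {τ : TR n} {a : D.Obj} {as bs : Fin n → D.Obj}
    {f : D.Hom as ((Q.obj τ).obj a)} {g : D.Hom bs ((Q.obj τ).obj a)}
    (h : (⟨n, τ, as, f⟩ : Q.Total a) = ⟨n, τ, bs, g⟩) :
    Multicategory.arrow f = Multicategory.arrow g := by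
  obtain ⟨rfl, h⟩ : as = bs ∧ HEq f g := by simpa using h
  cases h
  rfl

/-- Only the underlying trees and the underlying fillings of the maps have to agree; the proofs that
`T2` and the maps of trees carry play no role. -/
theorem val_congr {n : ℕ} {τ : TR n} {θ θ' : T2 TR n} {α : τ ⟶ θ.join} {α' : τ ⟶ θ'.join}
    (h : θ.tree = θ'.tree) (hα : HEq α.1 α'.1) {a : D.Obj} {x : Filling D.hat (Q.lab θ.tree) a}
    {x' : Filling D.hat (Q.lab θ'.tree) a} (hx : HEq x x') : Q.val α x = Q.val α' x' := by
  obtain rfl : θ = θ' := T2.ext h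
  obtain rfl := TR.Hom.ext (eq_of_heq hα)
  cases hx
  rfl

/-- The coherence principle behind the unit and associativity laws. The codomain of an arrow given
by an identity map is the tree obtained from its domain by substitution, so the domain determines
the codomain, its arity and the arrow. No separate comparison of `τ` with `τ'`, or of `n` with `n'`,
is needed. -/
theorem val_strict {n n' : ℕ} {τ : TR n} {τ' : TR n'} {θ : T2 TR n} {θ' : T2 TR n'}
    {α : τ ⟶ θ.join} {α' : τ' ⟶ θ'.join} (hα : ∃ e, α = eqToHom e) (hα' : ∃ e, α' = eqToHom e)
    (h : θ.tree = θ'.tree) {a : D.Obj} {x : Filling D.hat (Q.lab θ.tree) a}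
    {x' : Filling D.hat (Q.lab θ'.tree) a} (hx : HEq x x') : Q.val α x = Q.val α' x' := by
  -- The arity is eliminated first, as the number of leaves of the tree, so that `h` can then be
  -- used to identify the two pastings.
  obtain ⟨t, rfl⟩ := θ
  obtain ⟨t', rfl⟩ := θ'
  obtain rfl : t = t' := h
  obtain ⟨e, rfl⟩ := hα
  obtain ⟨e', rfl⟩ := hα'
  obtain rfl := e.trans e'.symm
  exact Q.val_congr rfl HEq.rfl hx

/-- The value at a composite arrow. -/
theorem val_comp {n : ℕ} {θ : T2 TR n} {τ : TR n} (α : τ ⟶ θ.join)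
    (Θ : Fill TR.OpArr θ.tree) {a : D.Obj}
    (x : Filling D.hat (Q.lab (θ.subst (fun _ _ (β : TR.OpArr _ _) => β.1) Θ).tree) a)
    (y : Filling D.hat (Q.lab θ.tree) a)
    (h : ∀ z, HEq x z → Multicategory.collapse _ (Q.image θ.tree Θ) z = y) :
    Q.val (TR.opComp α Θ) x = Q.val α y := by
  -- Relabelling the substituted pasting, and substituting in the relabelled pasting, give trees
  -- that are equal only propositionally. Hence `x` has to be transported to a filling `z` before
  -- the composite in `[D, D]` can be evaluated on it.
  have hm := Q.map_comp (θ := θ) (x := τ) α Θ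
  have ht := congrArg (fun β => β.1.tree) hm
  obtain ⟨z, hz⟩ : ∃ z : Filling D.hat ((Q.lab θ.tree).subst
      (fun _ _ (β : D.EndoArr _ _) => β.1) (Q.image θ.tree Θ)) a, HEq x z :=
    ⟨cast (congrArg (fun t => Filling D.hat t a) ht) x, (cast_heq _ _).symm⟩
  obtain rfl := h z hz
  refine Q.total_ext ?_
  refine (Multicategory.arrow_app_congr hm hz).trans ?_
  -- Composition in `[D, D]` is, up to a cast of the domain, the application of the outer arrow to
  -- the collapsed filling.
  exact Multicategory.arrow_cast rfl
    (Multicategory.leaf_comp (θ.map fun _ => Q.obj) (Q.image θ.tree Θ) z) _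

/-- The identity of `τ`, as an arrow of `TRop`. -/
abbrev idArr {n : ℕ} (τ : TR n) : TR.OpArr n τ := ⟨T2.pure τ, eqToHom (TR.join_pure τ).symm⟩

theorem leaf_pure {n : ℕ} {τ : TR n} {a : D.Obj}
    (x : Filling D.hat (Q.lab (T2.pure τ).tree) a) (i : Fin n) :
    Filling.leaf (Q.lab (T2.pure τ).tree) x (((T2.pure τ).map fun _ => Q.obj).leafEquiv.symm i) =
      x.1 i := by
  rw [show ((T2.pure τ).map fun _ => Q.obj).leafEquiv.symm i = ⟨i, ()⟩ from
    T2.leafEquiv_symm_pure (X := fun _ => D.Under ⥤ D.Under) (Q.obj τ) i]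
  rfl

/-- `Q` preserves identities, and an identity of `[D, D]` returns the arrow placed at its single
node. -/
theorem arrow_idArr {n : ℕ} (τ : TR n) {a : D.Obj}
    (x : Filling D.hat (Q.lab (T2.pure τ).tree) a) :
    Multicategory.arrow ((Q.hom (idArr τ).2).app a x) = Multicategory.arrow x.2.1 := by
  have h : Q.hom (idArr τ).2 = Multicategory.EndoHom.id n (Q.obj τ) := Q.map_id (n := n) τ
  rw [h]
  exact Multicategory.arrow_of_heq (Q.leaf_pure x)
    (Multicategory.id_app_heq n (Q.obj τ) x)

/-- The filling of the one-node pasting of `τ` by an arrow. -/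
abbrev single {n : ℕ} {τ : TR n} {as : Fin n → D.Obj} {a : D.Obj}
    (f : D.Hom as ((Q.obj τ).obj a)) : Filling D.hat (Q.lab (T2.pure τ).tree) a :=
  ⟨as, f, fun _ => PUnit.unit⟩

/-- Presents a bare arrow `f` as a value of `Q`, so that the right-hand sides of the identity laws
can be compared with values at composite arrows. -/
theorem val_pure {n : ℕ} {τ : TR n} {as : Fin n → D.Obj} {a : D.Obj}
    (f : D.Hom as ((Q.obj τ).obj a)) :
    Q.val (idArr τ).2 (Q.single f) = ⟨n, τ, as, f⟩ :=
  Q.total_ext (Q.arrow_idArr τ _)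

/-- The filling of a two-level pasting by arrows. -/
abbrev double {n : ℕ} {k : Fin n → ℕ} {τ : TR n} {τs : ∀ i, TR (k i)}
    {as : ∀ i, Fin (k i) → D.Obj} {b : Fin n → D.Obj} {a : D.Obj} (f : D.Hom b ((Q.obj τ).obj a))
    (fs : ∀ i, D.Hom (as i) ((Q.obj (τs i)).obj (b i))) :
    Filling D.hat (Q.lab (TR.twoLevel τ τs).tree) a :=
  ⟨b, f, fun i => ⟨as i, fs i, fun _ => PUnit.unit⟩⟩

theorem leaf_double {n : ℕ} {k : Fin n → ℕ} {τ : TR n} {τs : ∀ i, TR (k i)}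
    {as : ∀ i, Fin (k i) → D.Obj} {b : Fin n → D.Obj} {a : D.Obj} (f : D.Hom b ((Q.obj τ).obj a))
    (fs : ∀ i, D.Hom (as i) ((Q.obj (τs i)).obj (b i))) (l : Fin (∑ i, k i)) :
    Filling.leaf (Q.lab (TR.twoLevel τ τs).tree) (Q.double f fs)
      (((TR.twoLevel τ τs).map fun _ => Q.obj).leafEquiv.symm l) = concat as l := by
  rw [leafEquiv_symm_twoLevel]
  rfl

/-! ### The operations of the relaxed multicategory -/

/-- The arrow `f.φ`. -/
def restrictHom {n : ℕ} {τ' τ : TR n} {as : Fin n → D.Obj} {a : D.Obj}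
    (f : D.Hom as ((Q.obj τ).obj a)) (φ : τ' ⟶ τ) : D.Hom as ((Q.obj τ').obj a) :=
  D.cast rfl (Q.leaf_pure (Q.single f))
    ((Q.hom (θ := T2.pure τ) (φ ≫ eqToHom (TR.join_pure τ).symm)).app a (Q.single f))

theorem arrow_restrictHom {n : ℕ} {τ' τ : TR n} {as : Fin n → D.Obj} {a : D.Obj}
    (f : D.Hom as ((Q.obj τ).obj a)) (φ : τ' ⟶ τ) :
    Multicategory.arrow (Q.restrictHom f φ) = Q.restrict φ f :=
  Multicategory.arrow_cast rfl (Q.leaf_pure (Q.single f)) _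

/-- The composite `f ∘ (fs 0, …, fs (n - 1))`. -/
def compHom {n : ℕ} {k : Fin n → ℕ} {τ : TR n} {τs : ∀ i, TR (k i)}
    {as : ∀ i, Fin (k i) → D.Obj} {b : Fin n → D.Obj} {a : D.Obj} (f : D.Hom b ((Q.obj τ).obj a))
    (fs : ∀ i, D.Hom (as i) ((Q.obj (τs i)).obj (b i))) :
    D.Hom (concat as) ((Q.obj (TR.comp τ τs)).obj a) :=
  D.cast rfl (Q.leaf_double f fs)
    ((Q.hom (eqToHom (TR.join_twoLevel τ τs).symm)).app a (Q.double f fs))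

theorem arrow_compHom {n : ℕ} {k : Fin n → ℕ} {τ : TR n} {τs : ∀ i, TR (k i)}
    {as : ∀ i, Fin (k i) → D.Obj} {b : Fin n → D.Obj} {a : D.Obj} (f : D.Hom b ((Q.obj τ).obj a))
    (fs : ∀ i, D.Hom (as i) ((Q.obj (τs i)).obj (b i))) :
    Multicategory.arrow (Q.compHom f fs) = Q.comp f fs :=
  Multicategory.arrow_cast rfl (Q.leaf_double f fs) _

/-- The identity of `a`. -/
def idHom (a : D.Obj) : D.Hom (fun _ : Fin 1 => a) ((Q.obj (T2.unit : TR 1)).obj a) :=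
  (Q.hom (eqToHom TR.join_unit.symm)).app a PUnit.unit

/-- Together with `compHom_total`, this removes the casts from the operations and puts the axioms in
the form to which `val_comp` applies. -/
theorem restrictHom_total {n : ℕ} {τ' τ : TR n} {as : Fin n → D.Obj} {a : D.Obj}
    (f : D.Hom as ((Q.obj τ).obj a)) (φ : τ' ⟶ τ) :
    (⟨n, τ', as, Q.restrictHom f φ⟩ : Q.Total a) =
      Q.val (θ := T2.pure τ) (φ ≫ eqToHom (TR.join_pure τ).symm) (Q.single f) :=
  Q.total_ext (Q.arrow_restrictHom f φ)

theorem compHom_total {n : ℕ} {k : Fin n → ℕ} {τ : TR n} {τs : ∀ i, TR (k i)}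
    {as : ∀ i, Fin (k i) → D.Obj} {b : Fin n → D.Obj} {a : D.Obj} (f : D.Hom b ((Q.obj τ).obj a))
    (fs : ∀ i, D.Hom (as i) ((Q.obj (τs i)).obj (b i))) :
    (⟨_, TR.comp τ τs, _, Q.compHom f fs⟩ : Q.Total a) =
      Q.val (eqToHom (TR.join_twoLevel τ τs).symm) (Q.double f fs) :=
  Q.total_ext (Q.arrow_compHom f fs)

/-! ### Functoriality of restriction -/

theorem restrictHom_id {n : ℕ} {τ : TR n} {as : Fin n → D.Obj} {a : D.Obj}
    (f : D.Hom as ((Q.obj τ).obj a)) : Q.restrictHom f (𝟙 τ) = f := by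
  refine Multicategory.arrow_inj (Q.arrow_of_total ((Q.restrictHom_total f (𝟙 τ)).trans ?_))
  -- The arrow that remains is the identity of `τ` in `TRop`.
  rw [Category.id_comp]
  exact Q.val_pure f

theorem restrictHom_comp {n : ℕ} {τ'' τ' τ : TR n} {as : Fin n → D.Obj} {a : D.Obj}
    (f : D.Hom as ((Q.obj τ).obj a)) (φ : τ' ⟶ τ) (φ' : τ'' ⟶ τ') :
    Q.restrictHom f (φ' ≫ φ) = Q.restrictHom (Q.restrictHom f φ) φ' := by
  refine Multicategory.arrow_inj (Q.arrow_of_total ?_)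
  rw [restrictHom_total, restrictHom_total]
  -- The iterated restriction is the value at a composite over the one-node pasting of `τ'`, whose
  -- single node is filled with the arrow for `φ`.
  refine Eq.trans ?_ (Q.val_comp (θ := T2.pure τ') (φ' ≫ eqToHom (TR.join_pure τ').symm)
    (⟨T2.pure τ, φ ≫ eqToHom (TR.join_pure τ).symm⟩, fun _ => PUnit.unit) (Q.single f) _
    fun z hz => ?_)
  · refine Q.val_congr (by rfl) ?_ HEq.rfl
    have h := TR.opComp_pure_val (φ' ≫ eqToHom (TR.join_pure τ').symm)
      ⟨T2.pure τ, φ ≫ eqToHom (TR.join_pure τ).symm⟩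
    refine HEq.trans (heq_of_eq ?_) h.symm
    simp
  · refine Multicategory.collapse_node _ (c := fun _ => Pasting.unit) (fun _ => rfl) (Q.single f)
      z hz _ _ _ ?_ fun _ _ _ => rfl
    exact Q.arrow_restrictHom f φ |>.symm

/-! ### Unit laws -/

/-- The value of `collapse` at a tree whose root is filled with an arrow that has a one-node
domain. -/
theorem collapse_pure {n : ℕ} {τ τ' : TR n} (α : TR.OpHom (T2.pure τ) τ') {t : Fin n → Pasting TR}
    (Θ : ∀ i, Fill TR.OpArr (t i)) {a : D.Obj} {s : Fin n → Pasting fun _ => D.Under ⥤ D.Under}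
    (hs : ∀ i, s i = subst (fun _ _ (β : D.EndoArr _ _) => β.1) (Q.lab (t i))
      (Q.image (t i) (Θ i)))
    (b : Fin n → D.Obj) (f : D.Hom b ((Q.obj τ).obj a)) (f' : D.Hom b ((Q.obj τ').obj a))
    (x : ∀ i, Filling D.hat (s i) (b i)) (y : ∀ i, Filling D.hat (Q.lab (t i)) (b i))
    (z : Filling D.hat (subst (fun _ _ (β : D.EndoArr _ _) => β.1) (Q.lab (node τ' t))
      (Q.image (node τ' t) (⟨_, α⟩, Θ))) a)
    (hz : HEq (⟨b, f, x⟩ : Filling D.hat (node (Q.obj τ) s) a) z)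
    (hf : Multicategory.arrow ((Q.hom α).app a (Q.single f)) = Multicategory.arrow f')
    (hy : ∀ i z, HEq (x i) z →
      Multicategory.collapse (Q.lab (t i)) (Q.image (t i) (Θ i)) z = y i) :
    Multicategory.collapse (Q.lab (node τ' t)) (Q.image (node τ' t) (⟨_, α⟩, Θ)) z =
      ⟨b, f', y⟩ := by
  -- The number of the `i`-th leaf of a one-node tree is `i` only propositionally. The families
  -- indexed by leaves must therefore be moved along this equality, below by generalizing over `j =
  -- i`.
  have he : ∀ i : Fin n, ((T2.pure τ).map fun _ => Q.obj).leafEquiv ⟨i, ()⟩ = i :=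
    T2.leafEquiv_pure (Q.obj τ)
  refine Multicategory.collapse_node (Q.image (node τ' t) (⟨_, α⟩, Θ)) (c := fun l => s l.1)
    ?_ ⟨b, f, x⟩ z hz b f' y hf ?_
  · rintro ⟨i, _⟩
    refine (hs i).trans ?_
    exact congrArg (fun i => subst (fun _ _ (β : D.EndoArr _ _) => β.1) (Q.lab (t i))
      (Q.image (t i) (Θ i))) (he i).symm
  · rintro ⟨i, _⟩
    have : ∀ j, j = i → ∀ z : Filling D.hat (subst (fun _ _ (β : D.EndoArr _ _) => β.1)
        (Q.lab (t j)) (Q.image (t j) (Θ j))) (b j), HEq (x i) z →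
        Multicategory.collapse (Q.lab (t j)) (Q.image (t j) (Θ j)) z = y j := by
      rintro _ rfl
      exact hy _
    exact this _ (he i)

theorem idHom_compHom{n : ℕ} {τ : TR n} {as : Fin n → D.Obj} {a : D.Obj}
    (f : D.Hom as ((Q.obj τ).obj a)) :
    (⟨_, _, _, Q.compHom (Q.idHom _) (fun _ => f)⟩ : Q.Total a) = ⟨_, _, _, f⟩ := by
  rw [compHom_total, ← val_pure]
  -- The lower node is filled with the canonical arrow from the empty pasting, which produces `1_a`,
  -- and the upper node with the identity of `τ`. The composite has the one-node pasting of `τ` as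
  -- its domain and takes `f` as its only input.
  refine (Q.val_comp (θ := TR.twoLevel T2.unit fun _ => τ) _
    (⟨T2.unit, eqToHom TR.join_unit.symm⟩, fun _ => (idArr τ, fun _ => PUnit.unit)) (Q.single f) _
    fun z hz => ?_).symm.trans ?_
  · refine Multicategory.collapse_node _ (c := fun _ => (T2.pure (Q.obj τ)).tree) (fun _ => rfl)
      (Q.single f) z hz _ _ _ rfl fun _ z hz => ?_
    exact Q.collapse_pure _ _ (fun _ => rfl) _ f f _ _ z hz (Q.arrow_idArr τ _) fun _ _ _ => rfl
  -- Only identity maps of trees were composed, so the value is that at the identity of `τ`.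
  · refine Q.val_strict (TR.opComp_eqToHom ⟨_, rfl⟩ _ ?_) (θ' := T2.pure τ)
      (α' := (idArr τ).2) ⟨(TR.join_pure τ).symm, rfl⟩ rfl HEq.rfl
    exact ⟨TR.eqToHom_val TR.join_unit.symm, fun _ => ⟨TR.eqToHom_val (TR.join_pure τ).symm, fun _ => trivial⟩⟩

theorem compHom_idHom {n : ℕ} {τ : TR n} {as : Fin n → D.Obj} {a : D.Obj}
    (f : D.Hom as ((Q.obj τ).obj a)) :
    (⟨_, _, _, Q.compHom f (fun i => Q.idHom (as i))⟩ : Q.Total a) = ⟨_, _, _, f⟩ := by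
  rw [compHom_total, ← val_pure]
  -- Here the identity of `τ` is below, and each upper node is erased by the canonical arrow from
  -- the empty pasting.
  refine (Q.val_comp (θ := TR.twoLevel τ fun _ => T2.unit) _
    (idArr τ, fun _ => (⟨T2.unit, eqToHom TR.join_unit.symm⟩, fun _ => PUnit.unit)) (Q.single f) _
    fun z hz => ?_).symm.trans ?_
  · refine Q.collapse_pure _ _ (fun _ => rfl) _ f f _ _ z hz (Q.arrow_idArr τ _) fun i z hz => ?_
    refine Multicategory.collapse_node (F := Q.obj T2.unit) (t := fun _ => Pasting.unit)
      (Q.image (node T2.unit fun _ => Pasting.unit)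
        (⟨T2.unit, eqToHom TR.join_unit.symm⟩, fun _ => PUnit.unit))
      (c := fun _ => Pasting.unit) (fun _ => rfl)
      (PUnit.unit : Filling D.hat Pasting.unit (as i)) z hz _ _ _ rfl fun _ _ _ => rfl
  · refine Q.val_strict (TR.opComp_eqToHom ⟨_, rfl⟩ _ ?_) (θ' := T2.pure τ)
      (α' := (idArr τ).2) ⟨(TR.join_pure τ).symm, rfl⟩ rfl HEq.rfl
    exact ⟨TR.eqToHom_val (TR.join_pure τ).symm, fun _ => ⟨TR.eqToHom_val TR.join_unit.symm, fun _ => trivial⟩⟩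

/-! ### Compatibility of restriction with composition -/

theorem compHom_restrictHom {n : ℕ} {k : Fin n → ℕ} {τ' τ : TR n} {τs' τs : ∀ i, TR (k i)}
    {as : ∀ i, Fin (k i) → D.Obj} {b : Fin n → D.Obj} {a : D.Obj}
    (f : D.Hom b ((Q.obj τ).obj a)) (fs : ∀ i, D.Hom (as i) ((Q.obj (τs i)).obj (b i)))
    (φ : τ' ⟶ τ) (φs : ∀ i, τs' i ⟶ τs i) :
    Q.restrictHom (Q.compHom f fs) (TR.compMap φ φs) =
      Q.compHom (Q.restrictHom f φ) fun i => Q.restrictHom (fs i) (φs i) := by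
  refine Multicategory.arrow_inj (Q.arrow_of_total ?_)
  rw [restrictHom_total, compHom_total]
  -- Composing first and restricting afterwards: the canonical two-level arrow is substituted in the
  -- one-node pasting on which `TR.compMap φ φs` acts.
  have h₁ := Q.val_comp (θ := T2.pure (TR.comp τ τs)) (τ := TR.comp τ' τs')
    (TR.compMap φ φs ≫ eqToHom (TR.join_pure _).symm)
    (⟨TR.twoLevel τ τs, eqToHom (TR.join_twoLevel τ τs).symm⟩, fun _ => PUnit.unit)
    (Q.double f fs) (Q.single (Q.compHom f fs)) fun z hz => by
      refine Multicategory.collapse_node _ (c := fun _ => Pasting.unit) (fun _ => rfl)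
        (Q.double f fs) z hz _ _ _ ?_ fun _ _ _ => rfl
      exact Q.arrow_compHom f fs |>.symm
  have he : ∀ i : Fin n, (T2.pure τ).leafEquiv ⟨i, ()⟩ = i := T2.leafEquiv_pure τ
  -- Restricting first and composing afterwards: the arrows for `φ` and the `φs i` are substituted
  -- in the nodes of the two-level pasting of the restricted trees.
  let Θ : Fill TR.OpArr (TR.twoLevel τ' τs').tree :=
    (⟨T2.pure τ, φ ≫ eqToHom (TR.join_pure τ).symm⟩, fun i =>
      (⟨T2.pure (τs i), φs i ≫ eqToHom (TR.join_pure (τs i)).symm⟩, fun _ => PUnit.unit))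
  have ht : (T2.subst (fun _ _ (β : TR.OpArr _ _) => β.1) (TR.twoLevel τ' τs') Θ).tree =
      (TR.twoLevel τ τs).tree :=
    congrArg (node τ) (funext fun i => congrArg (fun i => node (τs i) fun _ => Pasting.unit) (he i))
  obtain ⟨x, hx⟩ : ∃ x, HEq x (Q.double f fs) :=
    ⟨cast (congrArg (fun t => Filling D.hat (Q.lab t) a) ht.symm) (Q.double f fs), cast_heq _ _⟩
  have h₂ := Q.val_comp (θ := TR.twoLevel τ' τs') (eqToHom (TR.join_twoLevel τ' τs').symm)
    Θ x (Q.double (Q.restrictHom f φ) fun i => Q.restrictHom (fs i) (φs i)) fun z hz => by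
      refine Q.collapse_pure _ Θ.2 (s := fun i => Q.lab (T2.pure (τs i)).tree) (fun _ => rfl) b f _
        (Q.double f fs).2.2 _ z (hx.symm.trans hz)
        (Q.arrow_restrictHom f φ).symm fun i z hz => ?_
      exact Q.collapse_pure _ (Θ.2 i).2 (s := fun _ => Pasting.unit) (fun _ => rfl) _ (fs i) _
        (fun _ => PUnit.unit) _ z hz
        (Q.arrow_restrictHom (fs i) (φs i)).symm fun _ _ _ => rfl
  refine h₁.symm.trans (Eq.trans ?_ h₂)
  refine Q.val_congr ht.symm ?_ hx.symm
  -- On the left, the composite is `TR.compMap φ φs` up to `eqToHom`; on the right, the outer arrow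
  -- is an identity map, so the filling is the assembled one.
  refine (TR.opComp_pure_val _ _).trans (HEq.trans ?_ (TR.opComp_eqToHom_val _ _).symm)
  simp only [Category.assoc, eqToHom_trans]
  refine (TR.comp_eqToHom_val _ _).trans ?_
  -- Both fillings are those of `φ` and the `φs i` grafted together. They differ only by the bare
  -- edges grafted on one-node pastings and by `eqToHom` factors.
  exact Fill.graft_plug_heq (TR.join_pure τ).symm
    (fun i => (graft_unit (T2.pure (τs i)).join.tree).symm ▸ (congrArg T2.tree (TR.join_pure (τs i))).symm)
    (TR.comp_eqToHom_val _ _).symm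
    fun i => (TR.comp_eqToHom_val _ _).symm.trans (Fill.graft_unit _ _).symm

/-! ### Associativity -/

theorem compHom_assoc {n : ℕ} {k : Fin n → ℕ} {m : ∀ i, Fin (k i) → ℕ} {τ : TR n}
    {τs : ∀ i, TR (k i)} {σs : ∀ i j, TR (m i j)} {cs : ∀ i j, Fin (m i j) → D.Obj}
    {bs : ∀ i, Fin (k i) → D.Obj} {as : Fin n → D.Obj} {a : D.Obj}
    (f : D.Hom as ((Q.obj τ).obj a)) (g : ∀ i, D.Hom (bs i) ((Q.obj (τs i)).obj (as i)))
    (h : ∀ i j, D.Hom (cs i j) ((Q.obj (σs i j)).obj (bs i j))) :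
    (⟨_, _, _, Q.compHom (Q.compHom f g)
      (fun l => h (finSigmaFinEquiv.symm l).1 (finSigmaFinEquiv.symm l).2)⟩ : Q.Total a) =
    ⟨_, _, _, Q.compHom f (fun i => Q.compHom (g i) (h i))⟩ := by
  refine (Q.compHom_total (Q.compHom f g) _).trans (Eq.trans ?_ (Q.compHom_total f _).symm)
  -- The common domain of both composites is the three-level pasting, and `X` places `f`, `g` and
  -- `h` at its nodes.
  let T : Pasting TR := node τ fun i => node (τs i) fun j => node (σs i j) fun _ => Pasting.unit
  let X : Filling D.hat (Q.lab T) a := ⟨as, f, fun i => ⟨bs i, g i, fun j => Q.single (h i j)⟩⟩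
  -- `Θ₁` merges the two lower levels and leaves the top one alone; `Θ₂` merges the two upper levels
  -- and leaves the bottom one alone.
  let Θ₁ : Fill TR.OpArr (TR.twoLevel (TR.comp τ τs) fun l =>
      σs (finSigmaFinEquiv.symm l).1 (finSigmaFinEquiv.symm l).2).tree :=
    (⟨TR.twoLevel τ τs, eqToHom (TR.join_twoLevel τ τs).symm⟩, fun l =>
      (idArr _, fun _ => PUnit.unit))
  let Θ₂ : Fill TR.OpArr (TR.twoLevel τ fun i => TR.comp (τs i) (σs i)).tree :=
    (idArr τ, fun i => (⟨TR.twoLevel (τs i) (σs i),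
      eqToHom (TR.join_twoLevel (τs i) (σs i)).symm⟩, fun _ => PUnit.unit))
  have hp : ∀ i : Fin n, (T2.pure τ).leafEquiv ⟨i, ()⟩ = i := T2.leafEquiv_pure τ
  -- The family for the top level is indexed by `Fin (∑ i, k i)`. This puts its entry for `(i, j)`
  -- on the `j`-th input of the `i`-th upper node.
  have ht : ∀ (i : Fin n) (j : Fin (k i)), finSigmaFinEquiv.symm
      (((TR.twoLevel τ τs).map fun _ => Q.obj).leafEquiv ⟨i, j, ()⟩) = ⟨i, j⟩ := fun i j => by
    rw [leafEquiv_twoLevel, Equiv.symm_apply_apply]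
  have ht' : ∀ (i : Fin n) (j : Fin (k i)), finSigmaFinEquiv.symm
      ((TR.twoLevel τ τs).leafEquiv ⟨i, j, ()⟩) = ⟨i, j⟩ := ht
  have e₁ : (T2.subst (fun _ _ (β : TR.OpArr _ _) => β.1) _ Θ₁).tree = T :=
    congrArg (node τ) (funext fun i => congrArg (node (τs i)) (funext fun j =>
      congrArg (fun p : Σ i, Fin (k i) => node (σs p.1 p.2) fun _ => Pasting.unit) (ht' i j)))
  have e₂ : (T2.subst (fun _ _ (β : TR.OpArr _ _) => β.1) _ Θ₂).tree = T :=
    congrArg (node τ) (funext fun i => congrArg (fun i => node (τs i) fun j =>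
      node (σs i j) fun _ => Pasting.unit) (hp i))
  obtain ⟨x₁, hx₁⟩ : ∃ x, HEq x X :=
    ⟨cast (congrArg (fun t => Filling D.hat (Q.lab t) a) e₁.symm) X, cast_heq _ _⟩
  obtain ⟨x₂, hx₂⟩ : ∃ x, HEq x X :=
    ⟨cast (congrArg (fun t => Filling D.hat (Q.lab t) a) e₂.symm) X, cast_heq _ _⟩
  -- Each bracketing is the value at a composite of identity maps with domain `T`, and such values
  -- agree by `val_strict`.
  refine (Q.val_comp _ Θ₁ x₁ _ fun z hz => ?_).symm.trans
    ((Q.val_strict (TR.opComp_eqToHom ⟨_, rfl⟩ Θ₁ ?_) (TR.opComp_eqToHom ⟨_, rfl⟩ Θ₂ ?_)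
      (e₁.trans e₂.symm) (hx₁.trans hx₂.symm)).trans (Q.val_comp _ Θ₂ x₂ _ fun z hz => ?_))
  · refine Multicategory.collapse_node (Q.image _ Θ₁)
      (c := fun l : Leaf (Q.lab (TR.twoLevel τ τs).tree) =>
        Q.lab (T2.pure (σs l.1 l.2.1)).tree) ?_
      X z (hx₁.symm.trans hz) _ _ _ (Q.arrow_compHom f g |>.symm) ?_
    · rintro ⟨i, j, _⟩
      exact congrArg (fun p : Σ i, Fin (k i) => Q.lab (T2.pure (σs p.1 p.2)).tree) (ht i j).symm
    · rintro ⟨i, j, _⟩ z hz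
      refine Q.collapse_pure _ (Θ₁.2 _).2 (s := fun _ => Pasting.unit) (fun _ => rfl) _ _ _
        (fun _ => PUnit.unit) _ z (HEq.trans ?_ hz) (Q.arrow_idArr _ _) fun _ _ _ => rfl
      -- The pair obtained by decoding the number of the leaf is generalized, since it occurs in the
      -- type of the arrow as well.
      have : ∀ p : Σ i, Fin (k i), p = ⟨i, j⟩ →
          HEq (Q.single (h p.1 p.2)) (Q.single (h i j)) := by
        rintro _ rfl
        rfl
      exact this _ (ht i j)
  · exact ⟨TR.eqToHom_val (TR.join_twoLevel _ _).symm, fun _ =>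
      ⟨TR.eqToHom_val (TR.join_pure _).symm, fun _ => trivial⟩⟩
  · exact ⟨TR.eqToHom_val (TR.join_pure _).symm, fun _ =>
      ⟨TR.eqToHom_val (TR.join_twoLevel _ _).symm, fun _ => trivial⟩⟩
  · refine Q.collapse_pure _ Θ₂.2
      (s := fun i => Q.lab (TR.twoLevel (τs i) (σs i)).tree) (fun _ => rfl) _ f f X.2.2 _ z (hx₂.symm.trans hz)
      (Q.arrow_idArr τ _) fun i z hz => ?_
    exact Multicategory.collapse_node (Q.image _ (Θ₂.2 i)) (c := fun _ => Pasting.unit)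
      (fun _ => rfl) (Q.double (g i) (h i)) z hz _ _ _
      (Q.arrow_compHom (g i) (h i)).symm fun _ _ _ => rfl

/-- The relaxed multicategory that is given by a map of `T2`-multicategories. -/
def relaxed : RelaxedMulticategory D.Obj (fun τ as a => D.Hom as ((Q.obj τ).obj a)) where
  restrict := Q.restrictHom
  comp := Q.compHom
  id := Q.idHom
  restrict_id := Q.restrictHom_id
  restrict_comp := Q.restrictHom_comp
  id_comp := Q.idHom_compHom
  comp_id := Q.compHom_idHom
  assoc := Q.compHom_assoc
  comp_restrict := Q.compHom_restrictHom

end EndoMap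

end Relax

theorem theorem4p5p2 (D : Relax.Multicategory.{u, v}) (Q : Relax.EndoMap D) :
    ∃ C : Relax.RelaxedMulticategory D.Obj (fun τ as a => D.Hom as ((Q.obj τ).obj a)),
      (∀ {n : ℕ} {τ' τ : Relax.TR n} (φ : τ' ⟶ τ) {as : Fin n → D.Obj} {a : D.Obj}
        (f : D.Hom as ((Q.obj τ).obj a)),
        Relax.Multicategory.arrow (C.restrict f φ) = Q.restrict φ f) ∧
      (∀ {n : ℕ} {k : Fin n → ℕ} {τ : Relax.TR n} {τs : ∀ i, Relax.TR (k i)}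
        {as : ∀ i, Fin (k i) → D.Obj} {b : Fin n → D.Obj} {a : D.Obj}
        (f : D.Hom b ((Q.obj τ).obj a)) (fs : ∀ i, D.Hom (as i) ((Q.obj (τs i)).obj (b i))),
        Relax.Multicategory.arrow (C.comp f fs) = Q.comp f fs) ∧
      ∀ a : D.Obj, Relax.Multicategory.arrow (C.id a) = Q.id a :=
  -- The identities agree definitionally, as the only leaf of the empty pasting carries the label of
  -- the root; the other two operations involve casts of their domains.
  ⟨Q.relaxed, fun φ _ _ f => Q.arrow_restrictHom f φ, Q.arrow_compHom, fun _ => rfl⟩
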